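/- Let $n\ge 2$ and $\tfrac12\le\alpha<\tfrac32$, and let $1\le p\le \frac{2n+2}{n+1+4\alpha}$ with $(\alpha,p)\neq\bigl(\tfrac12,\tfrac{2n+2}{n+3}\bigr)$. For $f\in L^p(\mathbb R^n)$ let $\hat f$ be its Fourier transform, normalized by $\hat f(\xi)=\int_{\mathbb R^n}e^{-i\xi\cdot x}f(x)\,dx$ for Schwartz functions $f$ and extended to $L^p$ in the sense of tempered distributions, in which sense $\hat f$ is a locally integrable function because $1\le p\le 2$. We say that $\hat f$ vanishes on the unit sphere (in the $L^2$-trace sense) if there are Schwartz functions $\varphi_k$ with $\varphi_k\to f$ in $L^p(\mathbb R^n)$ and $\hat\varphi_k|_{\mathbb S^{n-1}}\to 0$ in $L^2(\mathbb S^{n-1})$ with respect to surface measure. Let $S^{-\alpha}f$ be the tempered distribution, if it is defined, given by $$(S^{-\alpha}f)^{\wedge}(\xi)=(1-|\xi|^2)_+^{-\alpha}\,\hat f(\xi),$$ where $(1-|\xi|^2)_+^{-\alpha}$ equals $(1-|\xi|^2)^{-\alpha}$ for $|\xi|<1$ and $0$ for $|\xi|\ge1$. Then there is a constant $C=C(n,\alpha,p)<\infty$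 such that for every $f\in L^p(\mathbb R^n)$ for which $\hat f$ vanishes on the unit sphere, $S^{-\alpha}f$ is defined, belongs to $L^2(\mathbb R^n)$, and satisfies $$\|S^{-\alpha}f\|_{L^2(\mathbb R^n)}\le C\,\|f\|_{L^p(\mathbb R^n)}.$$ -/

import Mathlib

open MeasureTheory Filter Topology
open scoped SchwartzMap ENNReal NNReal

namespace BochnerRiesz

noncomputable section

/-- Euclidean space `ℝⁿ`, with the Euclidean norm and Lebesgue measure. -/
abbrev E (n : ℕ) : Type := EuclideanSpace ℝ (Fin n)

/-- The Fourier integral `f̂(ξ) = ∫ e^{-i ξ·x} f(x) dx` (no factor `2π` in the exponent). It is used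
only for Schwartz functions, where the integral converges absolutely. -/
def fourierInt {n : ℕ} (f : E n → ℂ) (ξ : E n) : ℂ :=
  ∫ x : E n, Complex.exp (-Complex.I * ((inner ℝ ξ x : ℝ) : ℂ)) * f x

/-- Comparison with Mathlib's Fourier transform, whose kernel is `e^{-2πi ξ·x}`. -/
theorem fourierInt_eq_fourier {n : ℕ} (f : E n → ℂ) (ξ : E n) :
    fourierInt f ξ = FourierTransform.fourier f ((2 * Real.pi)⁻¹ • ξ) := by
  rw [Real.fourier_eq', fourierInt]
  refine integral_congr_ae (Eventually.of_forall fun x => ?_)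
  have h : (-2 * Real.pi * inner ℝ x ((2 * Real.pi)⁻¹ • ξ) : ℝ) = -inner ℝ ξ x := by
    rw [inner_smul_right, real_inner_comm]
    have := Real.pi_ne_zero
    field_simp
  simp only [h, smul_eq_mul]
  congr 2
  push_cast
  ring

/-- `IsFourierTransform f g`: the Fourier transform of `f`, as a tempered distribution, is the
function `g`. That is, `∫ g φ = ∫ f φ̂` for all Schwartz `φ`, where both integrals converge
absolutely. The function `g` is determined by `f`, and `f` by `g`, up to null sets. Every function
in `L^p` with `1 ≤ p ≤ 2` has such a Fourier transform. -/
def IsFourierTransform {n : ℕ} (f g : E n → ℂ) : Prop :=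
  ∀ φ : 𝓢(E n, ℂ),
    Integrable (fun ξ => g ξ * φ ξ) ∧ Integrable (fun x => f x * fourierInt φ x) ∧
      ∫ ξ, g ξ * φ ξ = ∫ x, f x * fourierInt φ x

/-- The multiplier `(1 - |ξ|²)_+^z`, equal to `(1 - |ξ|²)^z` for `|ξ| < 1` and to `0` elsewhere. -/
def multiplier {n : ℕ} (z : ℝ) (ξ : E n) : ℝ :=
  if ‖ξ‖ < 1 then (1 - ‖ξ‖ ^ 2) ^ z else 0

/-- `IsBochnerRiesz z f u`: the function `u` is `S^z f`, that is,
`û(ξ) = (1 - |ξ|²)_+^z f̂(ξ)`. Such a `u` is unique up to null sets. -/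
def IsBochnerRiesz {n : ℕ} (z : ℝ) (f u : E n → ℂ) : Prop :=
  ∃ g : E n → ℂ, IsFourierTransform f g ∧
    IsFourierTransform u (fun ξ => (multiplier z ξ : ℂ) * g ξ)

/-- The surface measure on the unit sphere of `ℝⁿ`. -/
abbrev surfaceMeasure (n : ℕ) : Measure (Metric.sphere (0 : E n) 1) :=
  (volume : Measure (E n)).toSphere

/-- `HasSphereTrace p f h`: the function `h` is the `L²` trace on the unit sphere of the Fourier
transform of `f ∈ L^p`: there are Schwartz functions `φ_k → f` in `L^p` whose Fourier transforms,
restricted to the sphere, tend to `h` in `L²` of surface measure. For `1 ≤ p ≤ (2n+2)/(n+3)`,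
`n ≥ 2`, restriction is bounded from `L^p` to `L²` of the sphere, so that `h` exists, is unique, and
is the limit along every such sequence. -/
def HasSphereTrace {n : ℕ} (p : ℝ≥0∞) (f : E n → ℂ) (h : Metric.sphere (0 : E n) 1 → ℂ) : Prop :=
  ∃ φ : ℕ → 𝓢(E n, ℂ),
    Tendsto (fun k => eLpNorm (fun x => φ k x - f x) p volume) atTop (𝓝 0) ∧
    Tendsto (fun k => eLpNorm (fun ω : Metric.sphere (0 : E n) 1 =>
      fourierInt (φ k) (ω : E n) - h ω) 2 (surfaceMeasure n)) atTop (𝓝 0)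

/-- The Fourier transform of `f ∈ L^p` vanishes on the unit sphere, in the `L²` trace sense. -/
def FourierVanishesOnSphere {n : ℕ} (p : ℝ≥0∞) (f : E n → ℂ) : Prop :=
  HasSphereTrace p f (fun _ => 0)

end

end BochnerRiesz

/-!
Put `γ = 2 α - 1`, so that the square of the multiplier is `s ^ (-(γ + 1))` at `s = 1 - |ξ|²`. On
the unit ball it is dominated by a sum `W` of dyadic Gaussian bumps in `s`. The vanishing of `f̂` on
the sphere allows one to subtract from `W` a multiple of the point mass at `s = 0` for which the
total integral becomes `0`. The result is, up to a constant, the cosine transform of a function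
`h` which vanishes at `t = 0` and is a symbol of order `γ`, and the operator of the quadratic form
`∫ ĥ(1 - |ξ|²) e^{-|ξ|²} |f̂|²` is the superposition, with weight `h(t)`, of the damped Schrödinger
propagators `e^{it(1 + Δ)} e^{Δ}`.

Split `h` at a time `T`, correcting both parts so that the lower one has integral `0`. The lower
part has a multiplier bounded by `T ^ (γ + 1) min(T |s|, 1 / (T |s|))`, concentrated on
`|s| ≈ 1 / T`. The upper part has an oscillatory integral for its kernel, which by van der Corput's
lemma is bounded by `T ^ (γ - (n - 1) / 2)`. Decompose `f` into its dyadic level sets, and in the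
form apply this splitting to each pair of pieces with a `T` that depends on the product of the two
heights. The lower parts are almost orthogonal, because for different `T` their multipliers live on
different shells, so they sum by Plancherel's theorem and Schur's test; the upper parts sum in `L¹`.
For the exponents `p` at hand both sums are bounded by powers of the `L^p` norm, without loss at the
endpoint.

If `α = 1 / 2`, where `γ = 0`, the exponent is not the endpoint one, so there is room to replace `α`
by a larger exponent, for which the multiplier is larger on the unit ball.
-/

namespace BochnerRiesz

open Complex (I)

section OscillatoryIntegrals

variable {φ φ' φ'' : ℝ → ℝ} {a b l : ℝ}

theorem hasDerivAt_cexp_mul_I {d x : ℝ} (h : HasDerivAt φ d x) :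
    HasDerivAt (fun t ↦ Complex.exp (φ t * I)) (Complex.exp (φ x * I) * (d * I)) x :=
  (h.ofReal_comp.mul_const I).cexp

theorem intervalIntegrable_cexp_mul_I (hφ : ContinuousOn φ (Set.uIcc a b)) :
    IntervalIntegrable (fun x ↦ Complex.exp (φ x * I)) volume a b :=
  ((Complex.continuous_ofReal.comp_continuousOn hφ).mul continuousOn_const).cexp.intervalIntegrable

theorem norm_integral_cexp_mul_I_le_sub (hab : a ≤ b) :
    ‖∫ x in a..b, Complex.exp (φ x * I)‖ ≤ b - a := by
  have h := intervalIntegral.norm_integral_le_of_norm_le_const (a := a) (b := b)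
    fun x _ ↦ (Complex.norm_exp_ofReal_mul_I (φ x)).le
  rwa [one_mul, abs_of_nonneg (sub_nonneg.2 hab)] at h

section DerivativeTests

variable (hab : a ≤ b) (hφ : ∀ x ∈ Set.Icc a b, HasDerivAt φ (φ' x) x)
  (hφ' : ∀ x ∈ Set.Icc a b, HasDerivAt φ' (φ'' x) x) (hφ'' : ContinuousOn φ'' (Set.Icc a b))

include hab hφ' hφ''

theorem integral_deriv_div_sq (hne : ∀ x ∈ Set.Icc a b, φ' x ≠ 0) :
    IntervalIntegrable (fun x ↦ φ'' x / φ' x ^ 2) volume a b ∧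
      ∫ x in a..b, φ'' x / φ' x ^ 2 = (φ' a)⁻¹ - (φ' b)⁻¹ := by
  have hcont : ContinuousOn (fun x ↦ φ'' x / φ' x ^ 2) (Set.uIcc a b) := by
    rw [Set.uIcc_of_le hab]
    exact hφ''.div ((HasDerivAt.continuousOn hφ').pow 2) fun x hx ↦ pow_ne_zero 2 (hne x hx)
  refine ⟨hcont.intervalIntegrable, ?_⟩
  rw [intervalIntegral.integral_eq_sub_of_hasDerivAt (f := fun x ↦ -(φ' x)⁻¹) (fun x hx ↦ ?_)
    hcont.intervalIntegrable]
  · ring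
  · rw [Set.uIcc_of_le hab] at hx
    exact (((hφ' x hx).inv (hne x hx)).neg).congr_deriv (by ring)

include hφ

theorem integral_cexp_mul_I_eq (hne : ∀ x ∈ Set.Icc a b, φ' x ≠ 0) :
    ∫ x in a..b, Complex.exp (φ x * I) =
      ((φ' a)⁻¹ : ℝ) * I * Complex.exp (φ a * I) - ((φ' b)⁻¹ : ℝ) * I * Complex.exp (φ b * I) -
        ∫ x in a..b, (φ'' x / φ' x ^ 2 : ℝ) * I * Complex.exp (φ x * I) := by
  have hIcc : Set.uIcc a b = Set.Icc a b := Set.uIcc_of_le hab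
  have hinv : ∀ x ∈ Set.uIcc a b, HasDerivAt (fun t ↦ (-(φ' t)⁻¹ : ℝ) * I)
      ((φ'' x / φ' x ^ 2 : ℝ) * I) x := fun x hx ↦
    ((((hφ' x (hIcc ▸ hx)).inv (hne x (hIcc ▸ hx))).neg).congr_deriv
      (by ring)).ofReal_comp.mul_const I
  have hexp : ContinuousOn (fun x ↦ Complex.exp (φ x * I) * (φ' x * I)) (Set.uIcc a b) := by
    have h := HasDerivAt.continuousOn hφ
    have h' := HasDerivAt.continuousOn hφ'
    rw [hIcc]
    fun_prop
  have hint := (integral_deriv_div_sq hab hφ' hφ'' hne).1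
  have hparts := intervalIntegral.integral_mul_deriv_eq_deriv_mul hinv
    (fun x hx ↦ hasDerivAt_cexp_mul_I (hφ x (hIcc ▸ hx)))
    (IntervalIntegrable.mul_const ⟨hint.1.ofReal, hint.2.ofReal⟩ I) hexp.intervalIntegrable
  have hcancel : ∀ x ∈ Set.uIcc a b, Complex.exp (φ x * I) =
      (-(φ' x)⁻¹ : ℝ) * I * (Complex.exp (φ x * I) * (φ' x * I)) := by
    intro x hx
    have hx0 : (φ' x : ℂ) ≠ 0 := by exact_mod_cast hne x (hIcc ▸ hx)
    calc Complex.exp (φ x * I)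
        = -(I * I) * ((φ' x : ℂ)⁻¹ * φ' x) * Complex.exp (φ x * I) := by
          rw [inv_mul_cancel₀ hx0, Complex.I_mul_I]
          ring
      _ = _ := by
          push_cast
          ring
  rw [intervalIntegral.integral_congr hcancel, hparts]
  push_cast
  ring

/- The second derivative has a sign, so the total variation of `1 / φ'` is the difference of its
boundary values. -/
theorem norm_integral_cexp_mul_I_le_of_le_abs_deriv (hl : 0 < l)
    (hnonneg : ∀ x ∈ Set.Icc a b, 0 ≤ φ'' x) (hle : ∀ x ∈ Set.Icc a b, l ≤ |φ' x|) :
    ‖∫ x in a..b, Complex.exp (φ x * I)‖ ≤ 4 / l := by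
  have hne : ∀ x ∈ Set.Icc a b, φ' x ≠ 0 := fun x hx ↦ abs_pos.1 (hl.trans_le (hle x hx))
  obtain ⟨hint, hvar⟩ := integral_deriv_div_sq hab hφ' hφ'' hne
  have hinv : ∀ x ∈ Set.Icc a b, |(φ' x)⁻¹| ≤ 1 / l := fun x hx ↦ by
    rw [abs_inv, one_div]
    exact inv_anti₀ hl (hle x hx)
  have ha := hinv a ⟨le_rfl, hab⟩
  have hb := hinv b ⟨hab, le_rfl⟩
  have hrest : ‖∫ x in a..b, (φ'' x / φ' x ^ 2 : ℝ) * I * Complex.exp (φ x * I)‖ ≤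
      |(φ' a)⁻¹| + |(φ' b)⁻¹| := by
    refine (intervalIntegral.norm_integral_le_of_norm_le hab
      (Eventually.of_forall fun x hx ↦ le_of_eq ?_) hint).trans (hvar.le.trans ?_)
    · rw [norm_mul, norm_mul, Complex.norm_exp_ofReal_mul_I, Complex.norm_I, Complex.norm_real,
        mul_one, mul_one, Real.norm_of_nonneg]
      exact div_nonneg (hnonneg x (Set.Ioc_subset_Icc_self hx)) (sq_nonneg _)
    · exact (le_abs_self _).trans (abs_sub _ _)
  have hbdry : ∀ x, ‖((φ' x)⁻¹ : ℝ) * I * Complex.exp (φ x * I)‖ = |(φ' x)⁻¹| := fun x ↦ by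
    rw [norm_mul, norm_mul, Complex.norm_exp_ofReal_mul_I, Complex.norm_I,
      Complex.norm_real, mul_one, mul_one, Real.norm_eq_abs]
  rw [integral_cexp_mul_I_eq hab hφ hφ' hφ'' hne]
  calc _ ≤ |(φ' a)⁻¹| + |(φ' b)⁻¹| + (|(φ' a)⁻¹| + |(φ' b)⁻¹|) := by
        refine (norm_sub_le _ _).trans (add_le_add ((norm_sub_le _ _).trans_eq ?_) hrest)
        rw [hbdry, hbdry]
    _ ≤ 1 / l + 1 / l + (1 / l + 1 / l) := by gcongr
    _ = 4 / l := by ring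

theorem norm_integral_cexp_mul_I_le_of_mul_sub_le_abs_deriv (hl : 0 < l)
    (hnonneg : ∀ x ∈ Set.Icc a b, 0 ≤ φ'' x) (hle : ∀ x ∈ Set.Icc a b, l * (x - a) ≤ |φ' x|) :
    ‖∫ x in a..b, Complex.exp (φ x * I)‖ ≤ 5 / √l := by
  have hsqrt : 0 < √l := Real.sqrt_pos.2 hl
  rcases le_or_gt b (a + 1 / √l) with hb | hb
  · calc _ ≤ b - a := norm_integral_cexp_mul_I_le_sub hab
      _ ≤ 1 / √l := by linarith
      _ ≤ 5 / √l := by gcongr; norm_num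
  set c := a + 1 / √l
  have hac : a ≤ c := le_add_of_nonneg_right (by positivity)
  have hsub : Set.Icc c b ⊆ Set.Icc a b := Set.Icc_subset_Icc_left hac
  have hnear : ‖∫ x in a..c, Complex.exp (φ x * I)‖ ≤ 1 / √l :=
    (norm_integral_cexp_mul_I_le_sub hac).trans_eq (add_sub_cancel_left _ _)
  have hfar : ‖∫ x in c..b, Complex.exp (φ x * I)‖ ≤ 4 / √l := by
    refine norm_integral_cexp_mul_I_le_of_le_abs_deriv hb.le (fun x hx ↦ hφ x (hsub hx))
      (fun x hx ↦ hφ' x (hsub hx)) (hφ''.mono hsub) hsqrt (fun x hx ↦ hnonneg x (hsub hx))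
      fun x hx ↦ le_trans ?_ (hle x (hsub hx))
    calc √l = l * (1 / √l) := by rw [mul_one_div, Real.div_sqrt]
      _ ≤ l * (x - a) := by gcongr; linarith [hx.1]
  have hcont := HasDerivAt.continuousOn hφ
  rw [← intervalIntegral.integral_add_adjacent_intervals (b := c)
    (intervalIntegrable_cexp_mul_I (hcont.mono ?_))
    (intervalIntegrable_cexp_mul_I (hcont.mono ?_))]
  · calc _ ≤ 1 / √l + 4 / √l := (norm_add_le _ _).trans (add_le_add hnear hfar)
      _ = 5 / √l := by ring
  · rw [Set.uIcc_of_le hac]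
    exact Set.Icc_subset_Icc_right hb.le
  · rwa [Set.uIcc_of_le hb.le]

end DerivativeTests

theorem exists_forall_mul_abs_sub_le_abs {g g' : ℝ → ℝ} (hab : a ≤ b)
    (hg : ∀ x ∈ Set.Icc a b, HasDerivAt g (g' x) x) (hl : ∀ x ∈ Set.Icc a b, l ≤ g' x) :
    ∃ c ∈ Set.Icc a b, ∀ x ∈ Set.Icc a b, l * |x - c| ≤ |g x| := by
  have hcont := HasDerivAt.continuousOn hg
  have hgrow : ∀ x ∈ Set.Icc a b, ∀ y ∈ Set.Icc a b, x ≤ y → l * (y - x) ≤ g y - g x := by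
    refine (convex_Icc a b).mul_sub_le_image_sub_of_le_deriv hcont
      (fun x hx ↦ (hg x (interior_subset hx)).differentiableAt.differentiableWithinAt) ?_
    intro x hx
    rw [(hg x (interior_subset hx)).deriv]
    exact hl x (interior_subset hx)
  have hright : ∀ c ∈ Set.Icc a b, 0 ≤ g c → ∀ x ∈ Set.Icc a b, c ≤ x → l * |x - c| ≤ |g x| := by
    intro c hc hgc x hx hcx
    rw [abs_of_nonneg (sub_nonneg.2 hcx)]
    linarith [hgrow c hc x hx hcx, le_abs_self (g x)]
  have hleft : ∀ c ∈ Set.Icc a b, g c ≤ 0 → ∀ x ∈ Set.Icc a b, x ≤ c → l * |x - c| ≤ |g x| := by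
    intro c hc hgc x hx hxc
    rw [abs_of_nonpos (sub_nonpos.2 hxc)]
    linarith [hgrow x hx c hc hxc, neg_le_abs (g x)]
  have ha : a ∈ Set.Icc a b := ⟨le_rfl, hab⟩
  have hb : b ∈ Set.Icc a b := ⟨hab, le_rfl⟩
  rcases le_total 0 (g a) with hga | hga
  · exact ⟨a, ha, fun x hx ↦ hright a ha hga x hx hx.1⟩
  rcases le_total (g b) 0 with hgb | hgb
  · exact ⟨b, hb, fun x hx ↦ hleft b hb hgb x hx hx.2⟩
  obtain ⟨c, hc, hgc⟩ := intermediate_value_Icc hab hcont ⟨hga, hgb⟩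
  exact ⟨c, hc, fun x hx ↦
    (le_total c x).elim (hright c hc hgc.ge x hx) (hleft c hc hgc.le x hx)⟩

/- Van der Corput's second derivative test. The left half of the interval is reflected, so that the
point near which `φ'` may be small becomes its left end. -/
theorem norm_integral_cexp_mul_I_le_of_le_deriv2 (hab : a ≤ b) (hl : 0 < l)
    (hφ : ∀ x ∈ Set.Icc a b, HasDerivAt φ (φ' x) x)
    (hφ' : ∀ x ∈ Set.Icc a b, HasDerivAt φ' (φ'' x) x)
    (hφ'' : ContinuousOn φ'' (Set.Icc a b)) (hle : ∀ x ∈ Set.Icc a b, l ≤ φ'' x) :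
    ‖∫ x in a..b, Complex.exp (φ x * I)‖ ≤ 10 / √l := by
  obtain ⟨c, hc, hgrow⟩ := exists_forall_mul_abs_sub_le_abs hab hφ' hle
  have hsubR : Set.Icc c b ⊆ Set.Icc a b := Set.Icc_subset_Icc_left hc.1
  have hsubL : Set.Icc a c ⊆ Set.Icc a b := Set.Icc_subset_Icc_right hc.2
  have hneg : ∀ x ∈ Set.Icc (-c) (-a), -x ∈ Set.Icc a b := fun x hx ↦
    hsubL ⟨le_neg_of_le_neg hx.2, neg_le_of_neg_le hx.1⟩
  have hright : ‖∫ x in c..b, Complex.exp (φ x * I)‖ ≤ 5 / √l :=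
    norm_integral_cexp_mul_I_le_of_mul_sub_le_abs_deriv hc.2 (fun x hx ↦ hφ x (hsubR hx))
      (fun x hx ↦ hφ' x (hsubR hx)) (hφ''.mono hsubR) hl
      (fun x hx ↦ hl.le.trans (hle x (hsubR hx)))
      fun x hx ↦ (abs_of_nonneg (sub_nonneg.2 hx.1)) ▸ hgrow x (hsubR hx)
  have hleft : ‖∫ x in a..c, Complex.exp (φ x * I)‖ ≤ 5 / √l := by
    have hreflect := intervalIntegral.integral_comp_neg (a := -c) (b := -a)
      fun x ↦ Complex.exp (φ x * I)
    rw [neg_neg, neg_neg] at hreflect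
    rw [← hreflect]
    refine norm_integral_cexp_mul_I_le_of_mul_sub_le_abs_deriv (φ := fun x ↦ φ (-x))
      (φ' := fun x ↦ -φ' (-x)) (φ'' := fun x ↦ φ'' (-x)) (neg_le_neg hc.1)
      (fun x hx ↦ ((hφ (-x) (hneg x hx)).comp x (hasDerivAt_neg x)).congr_deriv (by ring))
      (fun x hx ↦ ((hφ' (-x) (hneg x hx)).comp x (hasDerivAt_neg x)).neg.congr_deriv (by ring))
      (hφ''.comp continuousOn_neg hneg) hl (fun x hx ↦ hl.le.trans (hle _ (hneg x hx)))
      fun x hx ↦ ?_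
    have h := hgrow (-x) (hneg x hx)
    rwa [← abs_neg, abs_of_nonneg (by linarith [hx.1]), show -(-x - c) = x - -c by ring,
      ← abs_neg (φ' _)] at h
  have hcont := HasDerivAt.continuousOn hφ
  rw [← intervalIntegral.integral_add_adjacent_intervals (b := c)
    (intervalIntegrable_cexp_mul_I (hcont.mono (Set.uIcc_of_le hc.1 ▸ hsubL)))
    (intervalIntegrable_cexp_mul_I (hcont.mono (Set.uIcc_of_le hc.2 ▸ hsubR)))]
  calc _ ≤ 5 / √l + 5 / √l := (norm_add_le _ _).trans (add_le_add hleft hright)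
    _ = 10 / √l := by ring

theorem norm_integral_mul_le_of_norm_primitive_le {A A' e : ℝ → ℂ} {M : ℝ} (hab : a ≤ b)
    (hA : ∀ x ∈ Set.Icc a b, HasDerivAt A (A' x) x) (hA' : ContinuousOn A' (Set.Icc a b))
    (he : Continuous e) (hM : ∀ x ∈ Set.Icc a b, ‖∫ t in a..x, e t‖ ≤ M) :
    ‖∫ x in a..b, A x * e x‖ ≤ M * (‖A b‖ + ∫ x in a..b, ‖A' x‖) := by
  rw [← Set.uIcc_of_le hab] at hA hA'
  have hprimitive (x : ℝ) : HasDerivAt (fun x ↦ ∫ t in a..x, e t) (e x) x :=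
    intervalIntegral.integral_hasDerivAt_right (he.intervalIntegrable _ _)
      (he.stronglyMeasurableAtFilter _ _) he.continuousAt
  have hmul : ∀ z : ℂ, ∀ x ∈ Set.Icc a b, ‖z * ∫ t in a..x, e t‖ ≤ M * ‖z‖ := fun z x hx ↦ by
    rw [norm_mul, mul_comm]
    exact mul_le_mul_of_nonneg_right (hM x hx) (norm_nonneg _)
  have hrest : ‖∫ x in a..b, A' x * ∫ t in a..x, e t‖ ≤ M * ∫ x in a..b, ‖A' x‖ := by
    rw [← intervalIntegral.integral_const_mul]
    exact intervalIntegral.norm_integral_le_of_norm_le hab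
      (Eventually.of_forall fun x hx ↦ hmul _ x (Set.Ioc_subset_Icc_self hx))
      (hA'.norm.intervalIntegrable.const_mul M)
  rw [intervalIntegral.integral_mul_deriv_eq_deriv_mul hA (fun x _ ↦ hprimitive x)
    hA'.intervalIntegrable (he.intervalIntegrable _ _), intervalIntegral.integral_same, mul_zero,
    sub_zero, mul_add]
  exact (norm_sub_le _ _).trans (add_le_add (hmul _ b ⟨hab, le_rfl⟩) hrest)

end OscillatoryIntegrals

noncomputable section DampedKernel

variable {d r t : ℝ}

/-- With `d = n / 2`, the convolution kernel on `ℝⁿ`, at distance `r` from the origin, of the damped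
Schrödinger multiplier `e^{it(1-|ξ|²)} e^{-|ξ|²}`, up to a power of `2π`. -/
def gaussKernel (d t r : ℝ) : ℂ :=
  Complex.exp (t * I) * (Real.pi / (1 + t * I)) ^ (d : ℂ) *
    Complex.exp (-r ^ 2 / (4 * (1 + t * I)))

/-- The phase of `gaussKernel d t r`, without the slowly varying argument of `(1 + it)^{-d}`. -/
def kernelPhase (r t : ℝ) : ℝ := t + r ^ 2 / 4 * (t / (1 + t ^ 2))

/-- The derivative of `kernelPhase r`. -/
def kernelPhaseDeriv (r t : ℝ) : ℝ := 1 + r ^ 2 / 4 * ((1 - t ^ 2) / (1 + t ^ 2) ^ 2)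

/-- The second derivative of `kernelPhase r`. -/
def kernelPhaseDeriv2 (r t : ℝ) : ℝ := r ^ 2 / 4 * (2 * t * (t ^ 2 - 3) / (1 + t ^ 2) ^ 3)

/-- The exponent of the Gaussian decay of `gaussKernel d t r`. -/
def gaussArg (r t : ℝ) : ℝ := r ^ 2 / (4 * (1 + t ^ 2))

/-- The amplitude of `gaussKernel d t r`, that is, the kernel without its oscillation
`e^{i kernelPhase r t}`. -/
def kernelEnvelope (d r t : ℝ) : ℂ :=
  (Real.pi / (1 + t * I)) ^ (d : ℂ) * Real.exp (-gaussArg r t)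

/-- The logarithmic derivative of `kernelEnvelope d r`. -/
def kernelLogDeriv (d r t : ℝ) : ℂ :=
  (gaussArg r t * (2 * t / (1 + t ^ 2)) : ℝ) - d * I / (1 + t * I)

theorem one_add_mul_I_ne_zero (t : ℝ) : (1 + t * I : ℂ) ≠ 0 := fun h ↦ by
  simpa using congrArg Complex.re h

theorem norm_one_add_mul_I (t : ℝ) : ‖(1 + t * I : ℂ)‖ = √(1 + t ^ 2) := by
  simpa using Complex.norm_add_mul_I 1 t

theorem le_sqrt_one_add_sq (t : ℝ) : t ≤ √(1 + t ^ 2) :=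
  Real.le_sqrt_of_sq_le (by linarith)

theorem gaussArg_nonneg (r t : ℝ) : 0 ≤ gaussArg r t := by
  unfold gaussArg
  positivity

theorem gaussKernel_eq (d t r : ℝ) :
    gaussKernel d t r = kernelEnvelope d r t * Complex.exp (kernelPhase r t * I) := by
  have hne := one_add_mul_I_ne_zero t
  have hsq : (1 + (t : ℂ) ^ 2) ≠ 0 := by exact_mod_cast (by positivity : (1 + t ^ 2 : ℝ) ≠ 0)
  have hmul : (1 + t * I) * (1 - t * I) = 1 + (t : ℂ) ^ 2 := by
    linear_combination (-(t : ℂ) ^ 2) * Complex.I_sq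
  have hne' : (1 - t * I : ℂ) ≠ 0 := right_ne_zero_of_mul (hmul ▸ hsq)
  have hexponent : t * I + -(r : ℂ) ^ 2 / (4 * (1 + t * I)) =
      ((-gaussArg r t : ℝ) : ℂ) + kernelPhase r t * I := by
    have hrationalize : -(r : ℂ) ^ 2 / (4 * (1 + t * I)) =
        -(r : ℂ) ^ 2 * (1 - t * I) / (4 * (1 + (t : ℂ) ^ 2)) := by
      rw [← hmul]
      field_simp
    rw [hrationalize, kernelPhase, gaussArg]
    push_cast
    field_simp
    ring
  rw [gaussKernel, kernelEnvelope, Complex.ofReal_exp, mul_right_comm, ← Complex.exp_add,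
    hexponent, Complex.exp_add]
  ring

theorem norm_kernelEnvelope (d r t : ℝ) :
    ‖kernelEnvelope d r t‖ = (Real.pi / √(1 + t ^ 2)) ^ d * Real.exp (-gaussArg r t) := by
  rw [kernelEnvelope, norm_mul, Complex.norm_cpow_real, norm_div, norm_one_add_mul_I,
    Complex.norm_real, Complex.norm_real, Real.norm_of_nonneg Real.pi_pos.le,
    Real.norm_of_nonneg (Real.exp_pos _).le]

theorem norm_kernelEnvelope_le (hd : 0 ≤ d) (ht : 0 < t) :
    ‖kernelEnvelope d r t‖ ≤ Real.pi ^ d * (t ^ (-d) * Real.exp (-gaussArg r t)) := by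
  rw [norm_kernelEnvelope, ← mul_assoc, Real.rpow_neg ht.le, ← div_eq_mul_inv,
    ← Real.div_rpow Real.pi_pos.le ht.le]
  gcongr
  exact le_sqrt_one_add_sq t

theorem norm_gaussKernel_le (hd : 0 ≤ d) (t r : ℝ) : ‖gaussKernel d t r‖ ≤ Real.pi ^ d := by
  rw [gaussKernel_eq, norm_mul, Complex.norm_exp_ofReal_mul_I, mul_one, norm_kernelEnvelope]
  have hsqrt : 1 ≤ √(1 + t ^ 2) := Real.one_le_sqrt.2 (le_add_of_nonneg_right (sq_nonneg t))
  have hexp : Real.exp (-gaussArg r t) ≤ 1 :=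
    Real.exp_le_one_iff.2 (neg_nonpos.2 (gaussArg_nonneg r t))
  calc _ ≤ (Real.pi / √(1 + t ^ 2)) ^ d * 1 := by gcongr
    _ ≤ Real.pi ^ d := by
      rw [mul_one]
      exact Real.rpow_le_rpow (by positivity) (div_le_self Real.pi_pos.le hsqrt) hd

theorem pi_div_one_add_mul_I_mem_slitPlane (t : ℝ) :
    (Real.pi : ℂ) / (1 + t * I) ∈ Complex.slitPlane := by
  refine Complex.mem_slitPlane_iff.2 (Or.inl ?_)
  have hnormSq : 0 < Complex.normSq (1 + t * I) := Complex.normSq_pos.2 (one_add_mul_I_ne_zero t)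
  have hre : (1 + t * I : ℂ).re = 1 := by simp
  rw [Complex.div_re, Complex.ofReal_re, Complex.ofReal_im, zero_mul, zero_div, add_zero, hre]
  have := Real.pi_pos
  positivity

theorem hasDerivAt_kernelEnvelope (d r t : ℝ) :
    HasDerivAt (kernelEnvelope d r) (kernelLogDeriv d r t * kernelEnvelope d r t) t := by
  have hne := one_add_mul_I_ne_zero t
  have hpi : (Real.pi : ℂ) ≠ 0 := by exact_mod_cast Real.pi_ne_zero
  have hquot : HasDerivAt (fun t : ℝ ↦ (Real.pi : ℂ) / (1 + t * I))
      (-(Real.pi * I) / (1 + t * I) ^ 2) t := by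
    have hden : HasDerivAt (fun t : ℝ ↦ (1 + t * I : ℂ)) I t := by
      simpa using ((hasDerivAt_id t).ofReal_comp.mul_const I).const_add 1
    simpa using (hasDerivAt_const t (Real.pi : ℂ)).fun_div hden hne
  have hpow := (Complex.hasStrictDerivAt_cpow_const (c := (d : ℂ))
    (pi_div_one_add_mul_I_mem_slitPlane t)).hasDerivAt.comp t hquot
  have hgauss : HasDerivAt (fun t ↦ Real.exp (-gaussArg r t))
      (Real.exp (-gaussArg r t) * (gaussArg r t * (2 * t / (1 + t ^ 2)))) t := by
    have hsq : HasDerivAt (fun t : ℝ ↦ 4 * (1 + t ^ 2)) (8 * t) t :=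
      (((hasDerivAt_pow 2 t).const_add 1).const_mul 4).congr_deriv (by norm_num; ring)
    refine (((hasDerivAt_const t (r ^ 2)).fun_div hsq (by positivity)).fun_neg.exp).congr_deriv ?_
    rw [gaussArg]
    field_simp
    ring
  refine (hpow.mul hgauss.ofReal_comp).congr_deriv ?_
  rw [kernelLogDeriv, kernelEnvelope, Complex.cpow_sub _ _ (div_ne_zero hpi hne),
    Complex.cpow_one]
  simp only [Function.comp_apply]
  push_cast
  field_simp
  ring

theorem continuous_kernelEnvelope (d r : ℝ) : Continuous (kernelEnvelope d r) :=
  continuous_iff_continuousAt.2 fun t ↦ (hasDerivAt_kernelEnvelope d r t).continuousAt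

theorem continuous_kernelLogDeriv (d r : ℝ) : Continuous (kernelLogDeriv d r) := by
  have hsq : ∀ t : ℝ, 1 + t ^ 2 ≠ 0 := fun t ↦ by positivity
  have harg : Continuous (gaussArg r) :=
    continuous_const.div (by fun_prop) fun t ↦ mul_ne_zero four_ne_zero (hsq t)
  exact (Complex.continuous_ofReal.comp (harg.mul (.div (by fun_prop) (by fun_prop) hsq))).sub
    (.div (by fun_prop) (by fun_prop) one_add_mul_I_ne_zero)

theorem norm_kernelLogDeriv_le (hd : 0 ≤ d) (ht : 0 < t) :
    ‖kernelLogDeriv d r t‖ ≤ (d + 2 * gaussArg r t) / t := by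
  have hy := gaussArg_nonneg r t
  have hgauss : gaussArg r t * (2 * t / (1 + t ^ 2)) ≤ gaussArg r t * (2 / t) := by
    refine mul_le_mul_of_nonneg_left ?_ hy
    rw [div_le_div_iff₀ (by positivity) ht]
    linarith
  have hpow : d / √(1 + t ^ 2) ≤ d / t :=
    div_le_div_of_nonneg_left hd ht (le_sqrt_one_add_sq t)
  calc _ ≤ gaussArg r t * (2 * t / (1 + t ^ 2)) + d / √(1 + t ^ 2) := by
        refine (norm_sub_le _ _).trans_eq ?_
        rw [Complex.norm_real, Real.norm_of_nonneg (by positivity), norm_div, norm_mul,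
          Complex.norm_real, Complex.norm_I, mul_one, norm_one_add_mul_I, Real.norm_of_nonneg hd]
    _ ≤ gaussArg r t * (2 / t) + d / t := add_le_add hgauss hpow
    _ = (d + 2 * gaussArg r t) / t := by ring

theorem hasDerivAt_kernelPhase (r t : ℝ) :
    HasDerivAt (kernelPhase r) (kernelPhaseDeriv r t) t := by
  have hden : HasDerivAt (fun t : ℝ ↦ 1 + t ^ 2) (2 * t) t := by
    simpa using (hasDerivAt_pow 2 t).const_add 1
  have hquot := (hasDerivAt_id t).fun_div hden (by positivity)
  refine ((hasDerivAt_id t).add (hquot.const_mul (r ^ 2 / 4))).congr_deriv ?_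
  simp only [id, kernelPhaseDeriv]
  ring

theorem hasDerivAt_kernelPhaseDeriv (r t : ℝ) :
    HasDerivAt (kernelPhaseDeriv r) (kernelPhaseDeriv2 r t) t := by
  have hnum : HasDerivAt (fun t : ℝ ↦ 1 - t ^ 2) (-(2 * t)) t := by
    simpa using (hasDerivAt_pow 2 t).const_sub 1
  have hden : HasDerivAt (fun t : ℝ ↦ (1 + t ^ 2) ^ 2) (2 * (1 + t ^ 2) * (2 * t)) t := by
    simpa using ((hasDerivAt_pow 2 t).const_add 1).fun_pow 2
  have hquot := (hnum.fun_div hden (by positivity)).const_mul (r ^ 2 / 4)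
  refine (hquot.const_add 1).congr_deriv ?_
  simp only [kernelPhaseDeriv2]
  field_simp
  ring

theorem continuous_kernelPhaseDeriv2 (r : ℝ) : Continuous (kernelPhaseDeriv2 r) :=
  continuous_const.mul (.div (by fun_prop) (by fun_prop) fun t ↦ by positivity)

theorem continuous_cexp_kernelPhase (r : ℝ) :
    Continuous fun t ↦ Complex.exp (kernelPhase r t * I) :=
  continuous_iff_continuousAt.2 fun t ↦
    (hasDerivAt_cexp_mul_I (hasDerivAt_kernelPhase r t)).continuousAt

theorem continuous_gaussKernel (d r : ℝ) : Continuous fun t ↦ gaussKernel d t r := by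
  simp only [gaussKernel_eq]
  exact (continuous_kernelEnvelope d r).mul (continuous_cexp_kernelPhase r)

theorem half_le_abs_kernelPhaseDeriv (hr : 0 ≤ r) (ht : 2 ≤ t) (hrt : r ≤ t) :
    1 / 2 ≤ |kernelPhaseDeriv r t| := by
  have hsq : r ^ 2 ≤ t ^ 2 := pow_le_pow_left₀ hr hrt 2
  have hquot : -(1 / t ^ 2) ≤ (1 - t ^ 2) / (1 + t ^ 2) ^ 2 := by
    rw [← neg_div, div_le_div_iff₀ (by positivity) (by positivity)]
    nlinarith [sq_nonneg t]
  have hprod : r ^ 2 / 4 * (1 / t ^ 2) ≤ 1 / 4 := by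
    rw [mul_one_div, div_le_iff₀ (by positivity)]
    linarith
  refine le_trans ?_ (le_abs_self _)
  rw [kernelPhaseDeriv]
  linarith [mul_le_mul_of_nonneg_left hquot (by positivity : 0 ≤ r ^ 2 / 4)]

theorem kernelPhaseDeriv2_nonneg (r : ℝ) (ht : 2 ≤ t) : 0 ≤ kernelPhaseDeriv2 r t := by
  have : 0 ≤ t ^ 2 - 3 := by nlinarith
  have : 0 ≤ t := by linarith
  unfold kernelPhaseDeriv2
  positivity

theorem one_div_le_kernelPhaseDeriv2 (ht : 2 ≤ t) (htr : t ≤ r) :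
    1 / (16 * r) ≤ kernelPhaseDeriv2 r t := by
  have ht0 : 0 < t := by linarith
  have hr0 : 0 < r := by linarith
  have hcube : 1 / (16 * r) ≤ r ^ 2 / 4 * (1 / (4 * t ^ 3)) := by
    rw [div_mul_div_comm, div_le_div_iff₀ (by positivity) (by positivity)]
    nlinarith [pow_le_pow_left₀ ht0.le htr 3]
  have hquot : 1 / (4 * t ^ 3) ≤ 2 * t * (t ^ 2 - 3) / (1 + t ^ 2) ^ 3 := by
    rw [div_le_div_iff₀ (by positivity) (by positivity), ← sub_nonneg]
    have hz : 0 ≤ t ^ 2 - 4 := by nlinarith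
    calc 0 ≤ 3 + 117 * (t ^ 2 - 4) + 57 * (t ^ 2 - 4) ^ 2 + 7 * (t ^ 2 - 4) ^ 3 := by positivity
      _ = _ := by ring
  exact hcube.trans (mul_le_mul_of_nonneg_left hquot (by positivity))

theorem rpow_mul_exp_neg_le {κ y : ℝ} (hκ : 0 < κ) (hy : 0 ≤ y) :
    y ^ κ * Real.exp (-y) ≤ κ ^ κ := by
  have hlin : y / κ ≤ Real.exp (y / κ) := by linarith [Real.add_one_le_exp (y / κ)]
  have hpow : y ^ κ ≤ κ ^ κ * Real.exp y := by
    calc y ^ κ = κ ^ κ * (y / κ) ^ κ := by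
          rw [← Real.mul_rpow hκ.le (by positivity), mul_div_cancel₀ _ hκ.ne']
      _ ≤ κ ^ κ * Real.exp (y / κ) ^ κ := by gcongr
      _ = κ ^ κ * Real.exp y := by rw [← Real.exp_mul, div_mul_cancel₀ _ hκ.ne']
  rwa [Real.exp_neg, ← div_eq_mul_inv, div_le_iff₀ (Real.exp_pos y)]

theorem max_sq_le_sq_mul_gaussArg (r : ℝ) (ht : 2 ≤ t) :
    max t r ^ 2 ≤ t ^ 2 * (1 + 5 * gaussArg r t) := by
  have hmul : r ^ 2 ≤ t ^ 2 * (5 * gaussArg r t) := by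
    rw [gaussArg, mul_div_assoc', mul_div_assoc', le_div_iff₀ (by positivity)]
    nlinarith [mul_nonneg (sq_nonneg r) (by nlinarith : 0 ≤ t ^ 2 - 4)]
  rcases max_choice t r with h | h <;> rw [h] <;> nlinarith [gaussArg_nonneg r t, sq_nonneg t]

/- The Gaussian factor turns decay in `t` into decay in `max t r`, since `max t r ^ 2` is at most
`t ^ 2 * (1 + 5 * gaussArg r t)`. -/
theorem exists_rpow_mul_exp_neg_gaussArg_le {b c : ℝ} (hb : 0 ≤ b) (hc : 0 ≤ c) :
    ∃ C : ℝ, 0 ≤ C ∧ ∀ r t : ℝ, 2 ≤ t →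
      t ^ (-b) * ((c + 2 * gaussArg r t) * Real.exp (-gaussArg r t)) ≤ C * max t r ^ (-b) := by
  set κ := b / 2 + 1
  refine ⟨(c + 1) * ((5 * κ) ^ κ * Real.exp (1 / 5)), by positivity, fun r t ht ↦ ?_⟩
  have hy := gaussArg_nonneg r t
  have hsq := max_sq_le_sq_mul_gaussArg r ht
  set y := gaussArg r t
  set m := max t r
  have ht0 : 0 < t := by linarith
  have hm0 : 0 < m := ht0.trans_le (le_max_left t r)
  have hratio : (m / t) ^ b ≤ (1 + 5 * y) ^ (b / 2) := by
    calc (m / t) ^ b = ((m / t) ^ (2 : ℝ)) ^ (b / 2) := by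
          rw [← Real.rpow_mul (by positivity), mul_div_cancel₀ _ two_ne_zero]
      _ ≤ (1 + 5 * y) ^ (b / 2) := by
          rw [Real.rpow_two, div_pow]
          gcongr
          rwa [div_le_iff₀' (by positivity)]
  have hrescale : t ^ (-b) = (m / t) ^ b * m ^ (-b) := by
    rw [Real.div_rpow hm0.le ht0.le, Real.rpow_neg ht0.le, Real.rpow_neg hm0.le]
    field_simp
  have hexp : (1 + 5 * y) ^ κ * Real.exp (-y) ≤ (5 * κ) ^ κ * Real.exp (1 / 5) := by
    have h := rpow_mul_exp_neg_le (κ := κ) (y := (1 + 5 * y) / 5) (by positivity) (by positivity)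
    calc _ = 5 ^ κ * (((1 + 5 * y) / 5) ^ κ * Real.exp (-((1 + 5 * y) / 5))) *
          Real.exp (1 / 5) := by
          rw [Real.div_rpow (by positivity) (by norm_num), mul_assoc, mul_assoc, ← Real.exp_add,
            ← mul_assoc, mul_div_cancel₀ _ (by positivity)]
          congr 2
          ring
      _ ≤ 5 ^ κ * κ ^ κ * Real.exp (1 / 5) := by gcongr
      _ = _ := by rw [Real.mul_rpow (by norm_num) (by positivity)]
  calc _ = (m / t) ^ b * (c + 2 * y) * Real.exp (-y) * m ^ (-b) := by rw [hrescale]; ring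
    _ ≤ (1 + 5 * y) ^ (b / 2) * ((c + 1) * (1 + 5 * y)) * Real.exp (-y) * m ^ (-b) := by
        gcongr
        nlinarith
    _ = (c + 1) * ((1 + 5 * y) ^ κ * Real.exp (-y)) * m ^ (-b) := by
        rw [Real.rpow_add_one (by positivity)]
        ring
    _ ≤ _ := by gcongr

end DampedKernel

noncomputable section KernelBounds

/-- `h`, with derivative `h'`, satisfies on `s` the first two bounds of a symbol of order `γ`, with
constant `H`. -/
structure IsSymbolOn (h h' : ℝ → ℝ) (γ H : ℝ) (s : Set ℝ) : Prop where
  hasDerivAt : ∀ t ∈ s, HasDerivAt h (h' t) t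
  continuousOn_deriv : ContinuousOn h' s
  abs_le : ∀ t ∈ s, |h t| ≤ H * t ^ γ
  abs_deriv_le : ∀ t ∈ s, |h' t| ≤ H * t ^ (γ - 1)

theorem IsSymbolOn.mono {h h' : ℝ → ℝ} {γ H : ℝ} {s s' : Set ℝ} (hs : IsSymbolOn h h' γ H s)
    (hsub : s' ⊆ s) : IsSymbolOn h h' γ H s' :=
  ⟨fun t ht ↦ hs.hasDerivAt t (hsub ht), hs.continuousOn_deriv.mono hsub,
    fun t ht ↦ hs.abs_le t (hsub ht), fun t ht ↦ hs.abs_deriv_le t (hsub ht)⟩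

/-- The derivative of the amplitude `h t * kernelEnvelope d r t` of `h t * gaussKernel d t r`. -/
def kernelAmpDeriv (h h' : ℝ → ℝ) (d r t : ℝ) : ℂ :=
  (h' t + h t * kernelLogDeriv d r t) * kernelEnvelope d r t

variable {h h' : ℝ → ℝ} {γ H : ℝ} {d r t T T' M : ℝ}

theorem IsSymbolOn.hasDerivAt_amp {s : Set ℝ} (hs : IsSymbolOn h h' γ H s) (ht : t ∈ s) :
    HasDerivAt (fun t ↦ h t * kernelEnvelope d r t) (kernelAmpDeriv h h' d r t) t :=
  ((hs.hasDerivAt t ht).ofReal_comp.mul (hasDerivAt_kernelEnvelope d r t)).congr_deriv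
    (by rw [kernelAmpDeriv]; ring)

theorem IsSymbolOn.continuousOn_ampDeriv {s : Set ℝ} (hs : IsSymbolOn h h' γ H s) :
    ContinuousOn (kernelAmpDeriv h h' d r) s :=
  ((Complex.continuous_ofReal.comp_continuousOn hs.continuousOn_deriv).add
    ((Complex.continuous_ofReal.comp_continuousOn (HasDerivAt.continuousOn hs.hasDerivAt)).mul
      (continuous_kernelLogDeriv d r).continuousOn)).mul
    (continuous_kernelEnvelope d r).continuousOn

theorem norm_mul_kernelEnvelope_le (hd : 0 ≤ d) (ht : 0 < t) (hb : |h t| ≤ H * t ^ γ) :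
    ‖h t * kernelEnvelope d r t‖ ≤
      H * Real.pi ^ d * (t ^ (-(d - γ)) * Real.exp (-gaussArg r t)) := by
  rw [norm_mul, Complex.norm_real, Real.norm_eq_abs, neg_sub, sub_eq_add_neg, Real.rpow_add ht]
  calc _ ≤ H * t ^ γ * (Real.pi ^ d * (t ^ (-d) * Real.exp (-gaussArg r t))) :=
        mul_le_mul hb (norm_kernelEnvelope_le hd ht) (norm_nonneg _) ((abs_nonneg _).trans hb)
    _ = _ := by ring

theorem norm_kernelAmpDeriv_le (hd : 0 ≤ d) (ht : 0 < t) (hb : |h t| ≤ H * t ^ γ)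
    (hb' : |h' t| ≤ H * t ^ (γ - 1)) :
    ‖kernelAmpDeriv h h' d r t‖ ≤ H * Real.pi ^ d *
      (t ^ (-(d - γ + 1)) * ((1 + d + 2 * gaussArg r t) * Real.exp (-gaussArg r t))) := by
  have hpow : t ^ (γ - 1) = t ^ γ / t := Real.rpow_sub_one ht.ne' γ
  have hH : 0 ≤ H * t ^ γ := (abs_nonneg _).trans hb
  have hsum : ‖(h' t : ℂ) + h t * kernelLogDeriv d r t‖ ≤
      H * t ^ γ / t * (1 + d + 2 * gaussArg r t) := by
    calc _ ≤ |h' t| + |h t| * ‖kernelLogDeriv d r t‖ := by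
          refine (norm_add_le _ _).trans_eq ?_
          rw [norm_mul, Complex.norm_real, Complex.norm_real, Real.norm_eq_abs, Real.norm_eq_abs]
      _ ≤ H * t ^ (γ - 1) + H * t ^ γ * ((d + 2 * gaussArg r t) / t) :=
          add_le_add hb' (mul_le_mul hb (norm_kernelLogDeriv_le hd ht) (norm_nonneg _) hH)
      _ = _ := by
          rw [hpow]
          ring
  rw [kernelAmpDeriv, norm_mul]
  calc _ ≤ H * t ^ γ / t * (1 + d + 2 * gaussArg r t) *
        (Real.pi ^ d * (t ^ (-d) * Real.exp (-gaussArg r t))) :=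
        mul_le_mul hsum (norm_kernelEnvelope_le hd ht) (norm_nonneg _)
          ((norm_nonneg _).trans hsum)
    _ = _ := by
        rw [show -(d - γ + 1) = -d + (γ - 1) by ring, Real.rpow_add ht, hpow]
        ring

theorem exists_norm_kernelAmp_le (hd : 0 ≤ d) (hb : 0 ≤ d - γ) :
    ∃ C : ℝ, 0 ≤ C ∧ ∀ (h h' : ℝ → ℝ) (H r : ℝ) (s : Set ℝ), IsSymbolOn h h' γ H s →
      ∀ t ∈ s, 2 ≤ t → 0 ≤ H ∧ ‖h t * kernelEnvelope d r t‖ ≤ C * H * max t r ^ (-(d - γ)) ∧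
        ‖kernelAmpDeriv h h' d r t‖ ≤ C * H * max t r ^ (-(d - γ + 1)) := by
  obtain ⟨C₁, hC₁, hle₁⟩ := exists_rpow_mul_exp_neg_gaussArg_le hb zero_le_one
  obtain ⟨C₂, hC₂, hle₂⟩ := exists_rpow_mul_exp_neg_gaussArg_le (b := d - γ + 1) (c := 1 + d)
    (by linarith) (by linarith)
  refine ⟨Real.pi ^ d * (C₁ + C₂), by positivity, fun h h' H r s hs t hts ht ↦ ?_⟩
  have ht0 : 0 < t := by linarith
  have hH : 0 ≤ H := nonneg_of_mul_nonneg_left ((abs_nonneg _).trans (hs.abs_le t hts))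
    (by positivity)
  refine ⟨hH, ?_, ?_⟩
  · have hy := gaussArg_nonneg r t
    calc _ ≤ H * Real.pi ^ d * (t ^ (-(d - γ)) *
          ((1 + 2 * gaussArg r t) * Real.exp (-gaussArg r t))) := by
          refine (norm_mul_kernelEnvelope_le hd ht0 (hs.abs_le t hts)).trans ?_
          gcongr
          exact le_mul_of_one_le_left (Real.exp_pos _).le (by linarith)
      _ ≤ H * Real.pi ^ d * ((C₁ + C₂) * max t r ^ (-(d - γ))) := by
          refine mul_le_mul_of_nonneg_left ((hle₁ r t ht).trans ?_) (by positivity)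
          exact mul_le_mul_of_nonneg_right (by linarith) (by positivity)
      _ = _ := by ring
  · calc _ ≤ H * Real.pi ^ d * ((C₁ + C₂) * max t r ^ (-(d - γ + 1))) := by
          refine (norm_kernelAmpDeriv_le hd ht0 (hs.abs_le t hts) (hs.abs_deriv_le t hts)).trans ?_
          refine mul_le_mul_of_nonneg_left ((hle₂ r t ht).trans ?_) (by positivity)
          exact mul_le_mul_of_nonneg_right (by linarith) (by positivity)
      _ = _ := by ring

theorem norm_integral_mul_gaussKernel_le (hT : T ≤ T')
    (hs : IsSymbolOn h h' γ H (Set.Icc T T'))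
    (hM : ∀ x ∈ Set.Icc T T', ‖∫ t in T..x, Complex.exp (kernelPhase r t * I)‖ ≤ M) :
    ‖∫ t in T..T', h t * gaussKernel d t r‖ ≤
      M * (‖h T' * kernelEnvelope d r T'‖ + ∫ t in T..T', ‖kernelAmpDeriv h h' d r t‖) := by
  simp only [gaussKernel_eq, ← mul_assoc]
  exact norm_integral_mul_le_of_norm_primitive_le hT (fun t ht ↦ hs.hasDerivAt_amp ht)
    hs.continuousOn_ampDeriv (continuous_cexp_kernelPhase r) hM

theorem norm_integral_cexp_kernelPhase_le_of_le (hr : 0 ≤ r) (hT : 2 ≤ T) (hrT : r ≤ T)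
    (hTT' : T ≤ T') : ‖∫ t in T..T', Complex.exp (kernelPhase r t * I)‖ ≤ 8 := by
  refine (norm_integral_cexp_mul_I_le_of_le_abs_deriv (l := 1 / 2) hTT'
    (fun t _ ↦ hasDerivAt_kernelPhase r t) (fun t _ ↦ hasDerivAt_kernelPhaseDeriv r t)
    (continuous_kernelPhaseDeriv2 r).continuousOn (by norm_num)
    (fun t ht ↦ kernelPhaseDeriv2_nonneg r (hT.trans ht.1))
    fun t ht ↦ half_le_abs_kernelPhaseDeriv hr (hT.trans ht.1) (hrT.trans ht.1)).trans_eq ?_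
  norm_num

theorem norm_integral_cexp_kernelPhase_le_sqrt (hT : 2 ≤ T) (hTT' : T ≤ T') (hr : T' ≤ r) :
    ‖∫ t in T..T', Complex.exp (kernelPhase r t * I)‖ ≤ 40 * √r := by
  have hr0 : 0 < r := by linarith
  refine (norm_integral_cexp_mul_I_le_of_le_deriv2 (l := 1 / (16 * r)) hTT' (by positivity)
    (fun t _ ↦ hasDerivAt_kernelPhase r t) (fun t _ ↦ hasDerivAt_kernelPhaseDeriv r t)
    (continuous_kernelPhaseDeriv2 r).continuousOn
    fun t ht ↦ one_div_le_kernelPhaseDeriv2 (hT.trans ht.1) (ht.2.trans hr)).trans_eq ?_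
  rw [Real.sqrt_div zero_le_one, Real.sqrt_one, Real.sqrt_mul (by norm_num),
    show (16 : ℝ) = 4 ^ 2 by norm_num, Real.sqrt_sq (by norm_num)]
  field_simp
  norm_num

theorem integral_rpow_neg_le {b : ℝ} (hb : 1 / 2 ≤ b) (hT : 0 < T) (hTT' : T ≤ T') :
    ∫ t in T..T', t ^ (-(b + 1)) ≤ 2 * T ^ (-b) := by
  have hzero : (0 : ℝ) ∉ Set.uIcc T T' := by
    rw [Set.uIcc_of_le hTT']
    exact fun hmem ↦ hT.not_ge hmem.1
  rw [integral_rpow (Or.inr ⟨by linarith, hzero⟩), neg_add, neg_add_cancel_right, div_neg,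
    ← neg_div, neg_sub, div_le_iff₀ (by linarith)]
  have hT' : 0 ≤ T' ^ (-b) := Real.rpow_nonneg (by linarith) _
  nlinarith [Real.rpow_nonneg hT.le (-b)]

theorem IsSymbolOn.exists_norm_integral_gaussKernel_le_of_le (hd : 0 ≤ d) (hb : 1 / 2 ≤ d - γ) :
    ∃ C : ℝ, 0 ≤ C ∧ ∀ (h h' : ℝ → ℝ) (H r T T' : ℝ), 0 ≤ r → 2 ≤ T → r ≤ T → T ≤ T' →
      IsSymbolOn h h' γ H (Set.Icc T T') →
      ‖∫ t in T..T', h t * gaussKernel d t r‖ ≤ C * H * T ^ (-(d - γ)) := by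
  obtain ⟨C, hC, hle⟩ := exists_norm_kernelAmp_le hd (by linarith)
  refine ⟨24 * C, by positivity, fun h h' H r T T' hr hT hrT hTT' hs ↦ ?_⟩
  have hT0 : 0 < T := by linarith
  have hmax : ∀ t ∈ Set.Icc T T', max t r = t := fun t ht ↦ max_eq_left (hrT.trans ht.1)
  obtain ⟨hH, hend, -⟩ := hle h h' H r _ hs T' ⟨hTT', le_rfl⟩ (hT.trans hTT')
  rw [hmax T' ⟨hTT', le_rfl⟩] at hend
  have hint : ∫ t in T..T', ‖kernelAmpDeriv h h' d r t‖ ≤ C * H * (2 * T ^ (-(d - γ))) := by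
    have hzero : (0 : ℝ) ∉ Set.uIcc T T' := by
      rw [Set.uIcc_of_le hTT']
      exact fun hmem ↦ hT0.not_ge hmem.1
    calc _ ≤ ∫ t in T..T', C * H * t ^ (-(d - γ + 1)) := by
          refine intervalIntegral.integral_mono_on hTT' ?_
            ((intervalIntegral.intervalIntegrable_rpow (Or.inr hzero)).const_mul _) fun t ht ↦ ?_
          · exact (Set.uIcc_of_le hTT' ▸ hs.continuousOn_ampDeriv).norm.intervalIntegrable
          · have h := (hle h h' H r _ hs t ht (hT.trans ht.1)).2.2
            rwa [hmax t ht] at h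
      _ ≤ _ := by
          rw [intervalIntegral.integral_const_mul]
          exact mul_le_mul_of_nonneg_left (integral_rpow_neg_le hb hT0 hTT') (by positivity)
  have hend' : C * H * T' ^ (-(d - γ)) ≤ C * H * T ^ (-(d - γ)) :=
    mul_le_mul_of_nonneg_left (Real.rpow_le_rpow_of_nonpos hT0 hTT' (by linarith)) (by positivity)
  calc _ ≤ 8 * (C * H * T ^ (-(d - γ)) + C * H * (2 * T ^ (-(d - γ)))) := by
        refine (norm_integral_mul_gaussKernel_le hTT' hs fun x hx ↦
          norm_integral_cexp_kernelPhase_le_of_le hr hT hrT hx.1).trans ?_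
        gcongr
        exact hend.trans hend'
    _ = _ := by ring

theorem IsSymbolOn.exists_norm_integral_gaussKernel_le_of_ge (hd : 0 ≤ d) (hb : 0 ≤ d - γ) :
    ∃ C : ℝ, 0 ≤ C ∧ ∀ (h h' : ℝ → ℝ) (H r T T' : ℝ), 2 ≤ T → T ≤ T' → T' ≤ r →
      IsSymbolOn h h' γ H (Set.Icc T T') →
      ‖∫ t in T..T', h t * gaussKernel d t r‖ ≤ C * H * r ^ (1 / 2 - (d - γ)) := by
  obtain ⟨C, hC, hle⟩ := exists_norm_kernelAmp_le hd hb
  refine ⟨80 * C, by positivity, fun h h' H r T T' hT hTT' hr hs ↦ ?_⟩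
  have hr0 : 0 < r := by linarith
  have hmax : ∀ t ∈ Set.Icc T T', max t r = r := fun t ht ↦ max_eq_right (ht.2.trans hr)
  obtain ⟨hH, hend, -⟩ := hle h h' H r _ hs T' ⟨hTT', le_rfl⟩ (hT.trans hTT')
  rw [hmax T' ⟨hTT', le_rfl⟩] at hend
  have hint : ∫ t in T..T', ‖kernelAmpDeriv h h' d r t‖ ≤ C * H * r ^ (-(d - γ)) := by
    calc _ ≤ ∫ _ in T..T', C * H * r ^ (-(d - γ + 1)) := by
          refine intervalIntegral.integral_mono_on hTT' ?_ (by simp) fun t ht ↦ ?_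
          · exact (Set.uIcc_of_le hTT' ▸ hs.continuousOn_ampDeriv).norm.intervalIntegrable
          · have h := (hle h h' H r _ hs t ht (hT.trans ht.1)).2.2
            rwa [hmax t ht] at h
      _ ≤ r * (C * H * r ^ (-(d - γ + 1))) := by
          rw [intervalIntegral.integral_const, smul_eq_mul]
          exact mul_le_mul_of_nonneg_right (by linarith) (by positivity)
      _ = _ := by
          rw [neg_add, ← sub_eq_add_neg, Real.rpow_sub_one hr0.ne']
          field_simp
  calc _ ≤ 40 * √r * (C * H * r ^ (-(d - γ)) + C * H * r ^ (-(d - γ))) := by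
        refine (norm_integral_mul_gaussKernel_le hTT' hs fun x hx ↦
          norm_integral_cexp_kernelPhase_le_sqrt hT hx.1 (hx.2.trans hr)).trans ?_
        gcongr
    _ = _ := by
        rw [sub_eq_add_neg (1 / 2), Real.rpow_add hr0, ← Real.sqrt_eq_rpow]
        ring

theorem IsSymbolOn.intervalIntegrable_mul_gaussKernel (hs : IsSymbolOn h h' γ H (Set.uIcc T T')) :
    IntervalIntegrable (fun t ↦ h t * gaussKernel d t r) volume T T' :=
  ((Complex.continuous_ofReal.comp_continuousOn (HasDerivAt.continuousOn hs.hasDerivAt)).mul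
    (continuous_gaussKernel d r).continuousOn).intervalIntegrable

/- Past `t = r` the phase has derivative bounded below; before it only the second derivative test is
available, and loses `√r`. -/
theorem IsSymbolOn.exists_norm_integral_gaussKernel_le (hd : 0 ≤ d) (hb : 1 / 2 ≤ d - γ) :
    ∃ C : ℝ, 0 ≤ C ∧ ∀ (h h' : ℝ → ℝ) (H r T T' : ℝ), 0 ≤ r → 2 ≤ T → T ≤ T' →
      IsSymbolOn h h' γ H (Set.Icc T T') →
      ‖∫ t in T..T', h t * gaussKernel d t r‖ ≤ C * H * T ^ (1 / 2 - (d - γ)) := by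
  obtain ⟨C₁, hC₁, hle₁⟩ := exists_norm_integral_gaussKernel_le_of_le hd hb
  obtain ⟨C₂, hC₂, hle₂⟩ := exists_norm_integral_gaussKernel_le_of_ge hd (by linarith : 0 ≤ d - γ)
  refine ⟨C₁ + C₂, by positivity, fun h h' H r T T' hr hT hTT' hs ↦ ?_⟩
  have hT0 : 0 < T := by linarith
  have hH : 0 ≤ H := nonneg_of_mul_nonneg_left
    ((abs_nonneg _).trans (hs.abs_le T ⟨le_rfl, hTT'⟩)) (by positivity)
  set m := min (max T r) T'
  have hm : m ∈ Set.Icc T T' := ⟨le_min (le_max_left T r) hTT', min_le_right _ _⟩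
  have hleft : Set.Icc T m ⊆ Set.Icc T T' := Set.Icc_subset_Icc_right hm.2
  have hright : Set.Icc m T' ⊆ Set.Icc T T' := Set.Icc_subset_Icc_left hm.1
  have hdecay : ∀ x, T ≤ x → x ^ (1 / 2 - (d - γ)) ≤ T ^ (1 / 2 - (d - γ)) := fun x hx ↦
    Real.rpow_le_rpow_of_nonpos hT0 hx (by linarith)
  have hnear : ‖∫ t in T..m, h t * gaussKernel d t r‖ ≤ C₂ * H * T ^ (1 / 2 - (d - γ)) := by
    rcases le_total r T with hrT | hTr
    · rw [show m = T by simp [m, hrT, hTT'], intervalIntegral.integral_same, norm_zero]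
      positivity
    · refine (hle₂ h h' H r T m hT hm.1 ?_ (hs.mono hleft)).trans ?_
      · exact (min_le_left _ _).trans_eq (max_eq_right hTr)
      · exact mul_le_mul_of_nonneg_left (hdecay r hTr) (by positivity)
  have hfar : ‖∫ t in m..T', h t * gaussKernel d t r‖ ≤ C₁ * H * T ^ (1 / 2 - (d - γ)) := by
    rcases le_total r T' with hrT' | hTr'
    · have hrm : r ≤ m := le_min (le_max_right T r) hrT'
      refine (hle₁ h h' H r m T' hr (hT.trans hm.1) hrm hm.2 (hs.mono hright)).trans ?_
      refine mul_le_mul_of_nonneg_left (le_trans ?_ (hdecay m hm.1)) (by positivity)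
      exact Real.rpow_le_rpow_of_exponent_le (by linarith [hm.1]) (by linarith)
    · rw [show m = T' from min_eq_right (hTr'.trans (le_max_right T r)),
        intervalIntegral.integral_same, norm_zero]
      positivity
  rw [← intervalIntegral.integral_add_adjacent_intervals (b := m)
    (hs.mono (Set.uIcc_of_le hm.1 ▸ hleft)).intervalIntegrable_mul_gaussKernel
    (hs.mono (Set.uIcc_of_le hm.2 ▸ hright)).intervalIntegrable_mul_gaussKernel]
  calc _ ≤ C₂ * H * T ^ (1 / 2 - (d - γ)) + C₁ * H * T ^ (1 / 2 - (d - γ)) :=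
        (norm_add_le _ _).trans (add_le_add hnear hfar)
    _ = _ := by ring

end KernelBounds

noncomputable section Splitting

/-- `h`, with derivative `h'`, is integrable on the half-line and satisfies there the first two
bounds of a symbol of order `γ`, with constant `H`. For `γ = 0` the bound on `h'` is not required
at `0`. -/
structure IsSymbol (h h' : ℝ → ℝ) (γ H : ℝ) : Prop where
  hasDerivAt : ∀ t, HasDerivAt h (h' t) t
  continuous_deriv : Continuous h'
  abs_le : ∀ t, 0 ≤ t → |h t| ≤ H * t ^ γ
  abs_deriv_le : ∀ t, 0 < t → |h' t| ≤ H * t ^ (γ - 1)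
  integrableOn : IntegrableOn h (Set.Ioi 0)

/-- The Fourier multiplier, as a function of `s = 1 - |ξ|²`, of the superposition with weight `h` of
the propagators `e^{its}`. -/
def halfMultiplier (h : ℝ → ℝ) (s : ℝ) : ℂ :=
  ∫ t in Set.Ioi (0 : ℝ), h t * Complex.exp ((t * s : ℝ) * I)

/-- The superposition with weight `h` of the kernels `gaussKernel`; it is the convolution kernel of
the multiplier `halfMultiplier h (1 - |ξ|²) e^{-|ξ|²}`. -/
def halfKernel (d : ℝ) (h : ℝ → ℝ) (r : ℝ) : ℂ :=
  ∫ t in Set.Ioi (0 : ℝ), h t * gaussKernel d t r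

/-- The mean of `h` over `[0, T]`. -/
def initialMean (h : ℝ → ℝ) (T : ℝ) : ℝ := (∫ t in 0..T, h t) / T

/-- The restriction of `h` to `(0, T]`, corrected by a constant on `(T, 2T]` so that its integral,
which is the value at `s = 0` of its multiplier, vanishes. -/
def lowPart (h : ℝ → ℝ) (T t : ℝ) : ℝ :=
  (Set.Ioc 0 T).indicator h t - (Set.Ioc T (2 * T)).indicator (fun _ ↦ initialMean h T) t

/-- The complement of `lowPart h T` in `h`. -/
def highPart (h : ℝ → ℝ) (T t : ℝ) : ℝ := h t - lowPart h T t

variable {h h' : ℝ → ℝ} {γ H d r s T : ℝ}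

theorem IsSymbol.continuous (hs : IsSymbol h h' γ H) : Continuous h :=
  continuous_iff_continuousAt.2 fun t ↦ (hs.hasDerivAt t).continuousAt

theorem IsSymbol.isSymbolOn {S : Set ℝ} (hs : IsSymbol h h' γ H) (hS : S ⊆ Set.Ioi 0) :
    IsSymbolOn h h' γ H S :=
  ⟨fun t _ ↦ hs.hasDerivAt t, hs.continuous_deriv.continuousOn,
    fun t ht ↦ hs.abs_le t (hS ht).le, fun t ht ↦ hs.abs_deriv_le t (hS ht)⟩

theorem IsSymbol.nonneg (hs : IsSymbol h h' γ H) : 0 ≤ H := by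
  simpa using (abs_nonneg _).trans (hs.abs_le 1 zero_le_one)

theorem IsSymbol.abs_le_of_le {t : ℝ} (hs : IsSymbol h h' γ H) (hγ : 0 ≤ γ) (ht : 0 ≤ t)
    (htT : t ≤ T) : |h t| ≤ H * T ^ γ :=
  (hs.abs_le t ht).trans
    (mul_le_mul_of_nonneg_left (Real.rpow_le_rpow ht htT hγ) hs.nonneg)

theorem IsSymbol.abs_initialMean_le (hs : IsSymbol h h' γ H) (hγ : 0 ≤ γ) (hT : 0 < T) :
    |initialMean h T| ≤ H * T ^ γ := by
  have hle : ‖∫ t in 0..T, h t‖ ≤ H * T ^ γ * |T - 0| := by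
    refine intervalIntegral.norm_integral_le_of_norm_le_const fun t ht ↦ ?_
    rw [Set.uIoc_of_le hT.le] at ht
    exact hs.abs_le_of_le hγ ht.1.le ht.2
  rw [initialMean, abs_div, abs_of_pos hT, div_le_iff₀ hT]
  rwa [sub_zero, abs_of_pos hT] at hle

theorem integrableOn_lowPart (T : ℝ) (hi : IntegrableOn h (Set.Ioi 0)) :
    IntegrableOn (lowPart h T) (Set.Ioi 0) := by
  refine (hi.indicator measurableSet_Ioc).sub
    (IntegrableOn.integrable_indicator (integrableOn_const (ne_of_lt ?_)) measurableSet_Ioc)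
  exact (Measure.restrict_apply_le _ _).trans_lt (by simp)

theorem integrableOn_highPart (T : ℝ) (hi : IntegrableOn h (Set.Ioi 0)) :
    IntegrableOn (highPart h T) (Set.Ioi 0) :=
  hi.sub (integrableOn_lowPart T hi)

theorem integrableOn_ofReal_mul_gaussKernel (hd : 0 ≤ d) (r : ℝ)
    (hi : IntegrableOn h (Set.Ioi 0)) :
    IntegrableOn (fun t ↦ h t * gaussKernel d t r) (Set.Ioi 0) :=
  hi.ofReal.mul_bdd (continuous_gaussKernel d r).aestronglyMeasurable
    (Eventually.of_forall fun t ↦ norm_gaussKernel_le hd t r)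

theorem integral_lowPart_mul (hh : Continuous h) (hT : 0 < T) {e : ℝ → ℂ} (he : Continuous e) :
    ∫ t in Set.Ioi (0 : ℝ), lowPart h T t * e t =
      (∫ t in 0..T, h t * e t) - initialMean h T * ∫ t in T..(2 * T), e t := by
  set c := initialMean h T with hc
  have hleft : Set.Ioc 0 T ⊆ Set.Ioi (0 : ℝ) := fun t ht ↦ ht.1
  have hright : Set.Ioc T (2 * T) ⊆ Set.Ioi (0 : ℝ) := fun t ht ↦ hT.trans ht.1
  have hsplit : (fun t ↦ lowPart h T t * e t) = fun t ↦
      (Set.Ioc 0 T).indicator (fun t ↦ h t * e t) t -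
        (Set.Ioc T (2 * T)).indicator (fun t ↦ c * e t) t := by
    funext t
    simp only [lowPart, ← hc, Set.indicator_apply]
    split_ifs <;> push_cast <;> ring
  have hint : IntegrableOn (fun t ↦ h t * e t) (Set.Ioc 0 T) :=
    ((Complex.continuous_ofReal.comp hh).mul he).integrableOn_Ioc
  have hint' : IntegrableOn (fun t ↦ c * e t) (Set.Ioc T (2 * T)) :=
    (continuous_const.mul he).integrableOn_Ioc
  rw [hsplit, integral_sub (hint.integrable_indicator measurableSet_Ioc).integrableOn
    (hint'.integrable_indicator measurableSet_Ioc).integrableOn,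
    setIntegral_indicator measurableSet_Ioc, setIntegral_indicator measurableSet_Ioc,
    Set.inter_eq_right.2 hleft, Set.inter_eq_right.2 hright,
    intervalIntegral.integral_of_le hT.le, intervalIntegral.integral_of_le (by linarith),
    integral_const_mul]

theorem integral_lowPart_mul_eq_sub_one (hh : Continuous h) (hT : 0 < T) {e : ℝ → ℂ}
    (he : Continuous e) :
    ∫ t in Set.Ioi (0 : ℝ), lowPart h T t * e t =
      (∫ t in 0..T, h t * (e t - 1)) - initialMean h T * ∫ t in T..(2 * T), (e t - 1) := by
  have hh' : Continuous fun t ↦ (h t : ℂ) := Complex.continuous_ofReal.comp hh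
  have hhe : Continuous fun t ↦ (h t : ℂ) * e t := hh'.mul he
  have hmean : ∫ t in 0..T, (h t : ℂ) = (initialMean h T : ℂ) * T := by
    rw [intervalIntegral.integral_ofReal, initialMean, ← Complex.ofReal_mul,
      div_mul_cancel₀ _ hT.ne']
  rw [integral_lowPart_mul hh hT he,
    intervalIntegral.integral_sub (he.intervalIntegrable _ _) (by simp)]
  simp only [mul_sub, mul_one]
  rw [intervalIntegral.integral_sub (hhe.intervalIntegrable _ _)
    (hh'.intervalIntegrable _ _), hmean]
  simp only [intervalIntegral.integral_const, Complex.real_smul, mul_one]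
  push_cast
  ring

theorem continuous_cexp_mul_I (s : ℝ) :
    Continuous fun t : ℝ ↦ Complex.exp ((t * s : ℝ) * I) := by fun_prop

theorem norm_cexp_mul_I_sub_one_le (x : ℝ) : ‖Complex.exp (x * I) - 1‖ ≤ |x| := by
  rw [mul_comm]
  exact Real.norm_exp_I_mul_ofReal_sub_one_le

theorem IsSymbol.norm_halfMultiplier_lowPart_le (hs : IsSymbol h h' γ H) (hγ : 0 ≤ γ)
    (hT : 0 < T) (s : ℝ) :
    ‖halfMultiplier (lowPart h T) s‖ ≤ 3 * H * T ^ (γ + 1) * (T * |s|) := by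
  have hHT : 0 ≤ H * T ^ γ := mul_nonneg hs.nonneg (Real.rpow_nonneg hT.le _)
  have hosc : ∀ a t : ℝ, 0 < t → t ≤ a → ‖Complex.exp ((t * s : ℝ) * I) - 1‖ ≤ a * |s| := by
    intro a t ht hta
    refine (norm_cexp_mul_I_sub_one_le _).trans ?_
    rw [abs_mul, abs_of_pos ht]
    exact mul_le_mul_of_nonneg_right hta (abs_nonneg _)
  have hleft : ‖∫ t in 0..T, h t * (Complex.exp ((t * s : ℝ) * I) - 1)‖ ≤
      H * T ^ γ * (T * |s|) * |T - 0| := by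
    refine intervalIntegral.norm_integral_le_of_norm_le_const fun t ht ↦ ?_
    rw [Set.uIoc_of_le hT.le] at ht
    rw [norm_mul, Complex.norm_real]
    exact mul_le_mul (hs.abs_le_of_le hγ ht.1.le ht.2) (hosc T t ht.1 ht.2) (norm_nonneg _) hHT
  have hright : ‖∫ t in T..(2 * T), (Complex.exp ((t * s : ℝ) * I) - 1)‖ ≤
      2 * T * |s| * |2 * T - T| := by
    refine intervalIntegral.norm_integral_le_of_norm_le_const fun t ht ↦ ?_
    rw [Set.uIoc_of_le (by linarith)] at ht
    exact hosc _ t (hT.trans ht.1) ht.2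
  rw [sub_zero, abs_of_pos hT] at hleft
  rw [show 2 * T - T = T by ring, abs_of_pos hT] at hright
  rw [halfMultiplier,
    integral_lowPart_mul_eq_sub_one hs.continuous hT (continuous_cexp_mul_I s)]
  calc _ ≤ H * T ^ γ * (T * |s|) * T + H * T ^ γ * (2 * T * |s| * T) := by
        refine (norm_sub_le _ _).trans (add_le_add hleft ?_)
        rw [norm_mul, Complex.norm_real]
        exact mul_le_mul (hs.abs_initialMean_le hγ hT) hright (norm_nonneg _) hHT
    _ = _ := by
        rw [Real.rpow_add_one hT.ne']
        ring

theorem abs_mul_norm_integral_mul_cexp_le {a b : ℝ} (hab : a ≤ b)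
    (hh : ∀ t ∈ Set.uIcc a b, HasDerivAt h (h' t) t) (hint : IntervalIntegrable h' volume a b) :
    |s| * ‖∫ t in a..b, h t * Complex.exp ((t * s : ℝ) * I)‖ ≤
      |h a| + |h b| + ∫ t in a..b, |h' t| := by
  have hexp : ∀ t : ℝ, HasDerivAt (fun t : ℝ ↦ Complex.exp ((t * s : ℝ) * I))
      (Complex.exp ((t * s : ℝ) * I) * (s * I)) t := fun t ↦
    hasDerivAt_cexp_mul_I (by simpa using (hasDerivAt_id t).mul_const s)
  have hparts := intervalIntegral.integral_mul_deriv_eq_deriv_mul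
    (fun t ht ↦ (hh t ht).ofReal_comp) (fun t _ ↦ hexp t) ⟨hint.1.ofReal, hint.2.ofReal⟩
    (((continuous_cexp_mul_I s).mul continuous_const).intervalIntegrable a b)
  have hnorm : ∀ x t : ℝ, ‖(x : ℂ) * Complex.exp ((t * s : ℝ) * I)‖ = |x| := fun x t ↦ by
    rw [norm_mul, Complex.norm_exp_ofReal_mul_I, mul_one, Complex.norm_real, Real.norm_eq_abs]
  have hrest : ‖∫ t in a..b, h' t * Complex.exp ((t * s : ℝ) * I)‖ ≤ ∫ t in a..b, |h' t| :=
    intervalIntegral.norm_integral_le_of_norm_le hab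
      (Eventually.of_forall fun t _ ↦ (hnorm _ t).le) hint.abs
  calc _ = ‖∫ t in a..b, h t * (Complex.exp ((t * s : ℝ) * I) * (s * I))‖ := by
        simp only [← mul_assoc]
        rw [intervalIntegral.integral_mul_const, intervalIntegral.integral_mul_const, norm_mul,
          norm_mul, Complex.norm_I, mul_one, Complex.norm_real, Real.norm_eq_abs, mul_comm]
    _ ≤ |h b| + |h a| + ∫ t in a..b, |h' t| := by
        rw [hparts, ← hnorm (h b) b, ← hnorm (h a) a]
        exact (norm_sub_le _ _).trans (add_le_add (norm_sub_le _ _) hrest)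
    _ = _ := by rw [add_comm |h b|]

theorem IsSymbol.abs_mul_norm_integral_mul_cexp_le (hs : IsSymbol h h' γ H) (hγ : 0 < γ)
    (hT : 0 < T) (s : ℝ) :
    |s| * ‖∫ t in 0..T, h t * Complex.exp ((t * s : ℝ) * I)‖ ≤ H * T ^ γ * (1 + 1 / γ) := by
  have hzero : h 0 = 0 := by
    have hle := hs.abs_le 0 le_rfl
    rwa [Real.zero_rpow hγ.ne', mul_zero, abs_nonpos_iff] at hle
  have hvar : ∫ t in 0..T, |h' t| ≤ H * (T ^ γ / γ) := by
    calc _ ≤ ∫ t in 0..T, H * t ^ (γ - 1) :=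
          intervalIntegral.integral_mono_on_of_le_Ioo hT.le
            (hs.continuous_deriv.abs.intervalIntegrable _ _)
            ((intervalIntegral.intervalIntegrable_rpow' (by linarith)).const_mul H)
            fun t ht ↦ hs.abs_deriv_le t ht.1
      _ = _ := by
          rw [intervalIntegral.integral_const_mul, integral_rpow (Or.inl (by linarith)),
            sub_add_cancel, Real.zero_rpow hγ.ne', sub_zero]
  calc _ ≤ |h 0| + |h T| + ∫ t in 0..T, |h' t| :=
        BochnerRiesz.abs_mul_norm_integral_mul_cexp_le hT.le (fun t _ ↦ hs.hasDerivAt t)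
          (hs.continuous_deriv.intervalIntegrable _ _)
    _ ≤ 0 + H * T ^ γ + H * (T ^ γ / γ) := by
        rw [hzero, abs_zero]
        gcongr
        exact hs.abs_le T hT.le
    _ = _ := by ring

theorem IsSymbol.mul_norm_halfMultiplier_lowPart_le (hs : IsSymbol h h' γ H) (hγ : 0 < γ)
    (hT : 0 < T) (s : ℝ) :
    T * |s| * ‖halfMultiplier (lowPart h T) s‖ ≤ (3 + 1 / γ) * H * T ^ (γ + 1) := by
  have hleft := hs.abs_mul_norm_integral_mul_cexp_le hγ hT s
  have hright : |s| * ‖∫ t in T..(2 * T), Complex.exp ((t * s : ℝ) * I)‖ ≤ 2 := by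
    have hle := BochnerRiesz.abs_mul_norm_integral_mul_cexp_le (s := s)
      (by linarith : T ≤ 2 * T) (fun t _ ↦ hasDerivAt_const t (1 : ℝ)) (by simp)
    norm_num at hle
    simpa using hle
  have hsum : |s| * ‖halfMultiplier (lowPart h T) s‖ ≤ H * T ^ γ * (3 + 1 / γ) := by
    rw [halfMultiplier, integral_lowPart_mul hs.continuous hT (continuous_cexp_mul_I s)]
    calc _ ≤ |s| * ‖∫ t in 0..T, h t * Complex.exp ((t * s : ℝ) * I)‖ + |initialMean h T| *
          (|s| * ‖∫ t in T..(2 * T), Complex.exp ((t * s : ℝ) * I)‖) := by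
          refine (mul_le_mul_of_nonneg_left (norm_sub_le _ _) (abs_nonneg s)).trans_eq ?_
          rw [norm_mul, Complex.norm_real, Real.norm_eq_abs]
          ring
      _ ≤ H * T ^ γ * (1 + 1 / γ) + H * T ^ γ * 2 :=
          add_le_add hleft (mul_le_mul (hs.abs_initialMean_le hγ.le hT) hright (by positivity)
            (mul_nonneg hs.nonneg (Real.rpow_nonneg hT.le _)))
      _ = _ := by ring
  calc _ = T * (|s| * ‖halfMultiplier (lowPart h T) s‖) := by ring
    _ ≤ T * (H * T ^ γ * (3 + 1 / γ)) := mul_le_mul_of_nonneg_left hsum hT.le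
    _ = _ := by
        rw [Real.rpow_add_one hT.ne']
        ring

theorem IsSymbol.exists_norm_setIntegral_Ioi_gaussKernel_le (hd : 0 ≤ d) (hb : 1 / 2 ≤ d - γ) :
    ∃ C : ℝ, 0 ≤ C ∧ ∀ (h h' : ℝ → ℝ) (H r T : ℝ), 0 ≤ r → 2 ≤ T → IsSymbol h h' γ H →
      ‖∫ t in Set.Ioi T, h t * gaussKernel d t r‖ ≤ C * H * T ^ (1 / 2 - (d - γ)) := by
  obtain ⟨C, hC, hle⟩ := IsSymbolOn.exists_norm_integral_gaussKernel_le hd hb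
  refine ⟨C, hC, fun h h' H r T hr hT hs ↦ ?_⟩
  have hT0 : 0 < T := by linarith
  refine le_of_tendsto (intervalIntegral_tendsto_integral_Ioi T
    ((integrableOn_ofReal_mul_gaussKernel hd r hs.integrableOn).mono_set
      (Set.Ioi_subset_Ioi hT0.le)) tendsto_id).norm ?_
  filter_upwards [eventually_ge_atTop T] with T' hT'
  exact hle h h' H r T T' hr hT hT' (hs.isSymbolOn fun t ht ↦ hT0.trans_le ht.1)

theorem halfKernel_highPart_eq (hd : 0 ≤ d) (hh : Continuous h) (hi : IntegrableOn h (Set.Ioi 0))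
    (hT : 0 < T) :
    halfKernel d (highPart h T) r = (∫ t in Set.Ioi T, h t * gaussKernel d t r) +
      ∫ t in T..(2 * T), initialMean h T * gaussKernel d t r := by
  have hint := integrableOn_ofReal_mul_gaussKernel hd r hi
  have hsub : halfKernel d (highPart h T) r = (∫ t in Set.Ioi (0 : ℝ), h t * gaussKernel d t r) -
      ∫ t in Set.Ioi (0 : ℝ), lowPart h T t * gaussKernel d t r := by
    rw [← integral_sub hint (integrableOn_ofReal_mul_gaussKernel hd r (integrableOn_lowPart T hi)),
      halfKernel]
    simp only [highPart, Complex.ofReal_sub, sub_mul]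
  rw [hsub, integral_lowPart_mul hh hT (continuous_gaussKernel d r),
    ← intervalIntegral.integral_interval_add_Ioi hint (hint.mono_set (Set.Ioi_subset_Ioi hT.le)),
    intervalIntegral.integral_const_mul]
  ring

theorem IsSymbol.exists_norm_halfKernel_highPart_le (hd : 0 ≤ d) (hγ : 0 ≤ γ)
    (hb : 1 / 2 ≤ d - γ) :
    ∃ C : ℝ, 0 ≤ C ∧ ∀ (h h' : ℝ → ℝ) (H r T : ℝ), 0 ≤ r → 2 ≤ T → IsSymbol h h' γ H →
      ‖halfKernel d (highPart h T) r‖ ≤ C * H * T ^ (1 / 2 - (d - γ)) := by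
  obtain ⟨C₁, hC₁, htail⟩ := exists_norm_setIntegral_Ioi_gaussKernel_le hd hb
  obtain ⟨C₂, hC₂, hmean⟩ := IsSymbolOn.exists_norm_integral_gaussKernel_le hd hb
  refine ⟨C₁ + C₂, by positivity, fun h h' H r T hr hT hs ↦ ?_⟩
  have hT0 : 0 < T := by linarith
  have hconst : IsSymbolOn (fun _ ↦ initialMean h T) (fun _ ↦ 0) γ H (Set.Icc T (2 * T)) := by
    refine ⟨fun t _ ↦ hasDerivAt_const t _, continuousOn_const, fun t ht ↦ ?_, fun t ht ↦ ?_⟩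
    · exact (hs.abs_initialMean_le hγ hT0).trans
        (mul_le_mul_of_nonneg_left (Real.rpow_le_rpow hT0.le ht.1 hγ) hs.nonneg)
    · rw [abs_zero]
      exact mul_nonneg hs.nonneg (Real.rpow_nonneg (hT0.le.trans ht.1) _)
  rw [halfKernel_highPart_eq hd hs.continuous hs.integrableOn hT0]
  refine (norm_add_le _ _).trans ((add_le_add (htail h h' H r T hr hT hs)
    (hmean _ _ H r T (2 * T) hr hT (by linarith) hconst)).trans_eq ?_)
  ring

theorem IsSymbol.exists_norm_halfKernel_le (hd : 0 ≤ d) (hγ : 0 ≤ γ) (hb : 1 / 2 ≤ d - γ) :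
    ∃ C : ℝ, 0 ≤ C ∧ ∀ (h h' : ℝ → ℝ) (H r : ℝ), 0 ≤ r → IsSymbol h h' γ H →
      ‖halfKernel d h r‖ ≤ C * H := by
  obtain ⟨C, hC, htail⟩ := exists_norm_setIntegral_Ioi_gaussKernel_le hd hb
  refine ⟨2 ^ γ * Real.pi ^ d * 2 + C * 2 ^ (1 / 2 - (d - γ)), by positivity,
    fun h h' H r hr hs ↦ ?_⟩
  have hint := integrableOn_ofReal_mul_gaussKernel hd r hs.integrableOn
  have hinitial : ‖∫ t in (0 : ℝ)..2, h t * gaussKernel d t r‖ ≤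
      H * 2 ^ γ * Real.pi ^ d * |2 - 0| := by
    refine intervalIntegral.norm_integral_le_of_norm_le_const fun t ht ↦ ?_
    rw [Set.uIoc_of_le zero_le_two] at ht
    rw [norm_mul, Complex.norm_real]
    exact mul_le_mul (hs.abs_le_of_le hγ ht.1.le ht.2) (norm_gaussKernel_le hd t r)
      (norm_nonneg _) (mul_nonneg hs.nonneg (by positivity))
  rw [sub_zero, abs_of_pos two_pos] at hinitial
  rw [halfKernel, ← intervalIntegral.integral_interval_add_Ioi hint
    (hint.mono_set (Set.Ioi_subset_Ioi zero_le_two))]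
  refine (norm_add_le _ _).trans
    ((add_le_add hinitial (htail h h' H r 2 hr le_rfl hs)).trans_eq ?_)
  ring

end Splitting

noncomputable section FourierTheory

open scoped FourierTransform

variable {n : ℕ}

/-- The pairing `(2π)⁻¹ ⟪·, ·⟫`, with respect to which `fourierInt` is one of Mathlib's
`VectorFourier.fourierIntegral`s. -/
def fourierPairing (n : ℕ) : E n →ₗ[ℝ] E n →ₗ[ℝ] ℝ := (2 * Real.pi)⁻¹ • innerₗ (E n)

theorem continuous_fourierPairing : Continuous fun p : E n × E n ↦ fourierPairing n p.1 p.2 := by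
  simp only [fourierPairing, LinearMap.smul_apply, innerₗ_apply_apply]
  fun_prop

theorem flip_fourierPairing : (fourierPairing n).flip = fourierPairing n := by
  ext v w
  simp [fourierPairing, real_inner_comm]

theorem fourierInt_eq_fourierIntegral (f : E n → ℂ) :
    fourierInt f =
      VectorFourier.fourierIntegral Real.fourierChar volume (fourierPairing n) f := by
  funext ξ
  refine integral_congr_ae (Eventually.of_forall fun x ↦ ?_)
  simp only [Circle.smul_def, smul_eq_mul, Real.fourierChar_apply, fourierPairing,
    LinearMap.smul_apply, innerₗ_apply_apply]
  congr 2
  rw [real_inner_comm]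
  push_cast
  field_simp

theorem continuous_fourierInt {f : E n → ℂ} (hf : Integrable f) : Continuous (fourierInt f) := by
  rw [fourierInt_eq_fourierIntegral]
  exact VectorFourier.fourierIntegral_continuous Real.continuous_fourierChar
    continuous_fourierPairing hf

theorem norm_fourierInt_le (f : E n → ℂ) (ξ : E n) : ‖fourierInt f ξ‖ ≤ ∫ x, ‖f x‖ := by
  rw [fourierInt_eq_fourierIntegral]
  exact VectorFourier.norm_fourierIntegral_le_integral_norm _ _ _ _ _

theorem integral_fourierInt_mul {f g : E n → ℂ} (hf : Integrable f) (hg : Integrable g) :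
    ∫ ξ, fourierInt f ξ * g ξ = ∫ x, f x * fourierInt g x := by
  have := VectorFourier.integral_fourierIntegral_smul_eq_flip (L := fourierPairing n)
    Real.continuous_fourierChar continuous_fourierPairing hf hg
  rwa [flip_fourierPairing, ← fourierInt_eq_fourierIntegral,
    ← fourierInt_eq_fourierIntegral] at this

/-- The function `x ↦ φ (c • x)`, as a Schwartz function. -/
def dilate {c : ℝ} (hc : c ≠ 0) (φ : 𝓢(E n, ℂ)) : 𝓢(E n, ℂ) :=
  SchwartzMap.compCLMOfContinuousLinearEquiv ℂ
    (LinearEquiv.smulOfNeZero ℝ (E n) c hc).toContinuousLinearEquiv φ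

theorem dilate_apply {c : ℝ} (hc : c ≠ 0) (φ : 𝓢(E n, ℂ)) (x : E n) :
    dilate hc φ x = φ (c • x) := rfl

/-- The Fourier transform `fourierInt φ` of a Schwartz function, as a Schwartz function. -/
def schwartzFourier (φ : 𝓢(E n, ℂ)) : 𝓢(E n, ℂ) :=
  dilate (inv_ne_zero Real.two_pi_pos.ne') (𝓕 φ)

theorem schwartzFourier_apply (φ : 𝓢(E n, ℂ)) (ξ : E n) :
    schwartzFourier φ ξ = fourierInt φ ξ := by
  rw [schwartzFourier, dilate_apply, fourierInt_eq_fourier, SchwartzMap.fourier_coe]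

theorem isFourierTransform_of_integrable {f : E n → ℂ} (hf : Integrable f) :
    IsFourierTransform f (fourierInt f) := fun φ ↦
  ⟨φ.integrable.bdd_mul (continuous_fourierInt hf).aestronglyMeasurable
      (Eventually.of_forall (norm_fourierInt_le f)),
    hf.mul_bdd (continuous_fourierInt φ.integrable).aestronglyMeasurable
      (Eventually.of_forall (norm_fourierInt_le φ)),
    integral_fourierInt_mul hf φ.integrable⟩

theorem IsFourierTransform.add {f f' g g' : E n → ℂ} (h : IsFourierTransform f g)
    (h' : IsFourierTransform f' g') :
    IsFourierTransform (fun x ↦ f x + f' x) (fun ξ ↦ g ξ + g' ξ) := by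
  intro φ
  obtain ⟨hg, hf, heq⟩ := h φ
  obtain ⟨hg', hf', heq'⟩ := h' φ
  simp only [add_mul]
  exact ⟨hg.add hg', hf.add hf', by rw [integral_add hg hg', integral_add hf hf', heq, heq']⟩

theorem IsFourierTransform.sub {f f' g g' : E n → ℂ} (h : IsFourierTransform f g)
    (h' : IsFourierTransform f' g') :
    IsFourierTransform (fun x ↦ f x - f' x) (fun ξ ↦ g ξ - g' ξ) := by
  intro φ
  obtain ⟨hg, hf, heq⟩ := h φ
  obtain ⟨hg', hf', heq'⟩ := h' φ
  simp only [sub_mul]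
  exact ⟨hg.sub hg', hf.sub hf', by rw [integral_sub hg hg', integral_sub hf hf', heq, heq']⟩

theorem IsFourierTransform.congr_ae {f f' g g' : E n → ℂ} (h : IsFourierTransform f g)
    (hf : f =ᵐ[volume] f') (hg : g =ᵐ[volume] g') : IsFourierTransform f' g' := by
  intro φ
  obtain ⟨hgφ, hfφ, heq⟩ := h φ
  have hg' : (fun ξ ↦ g ξ * φ ξ) =ᵐ[volume] fun ξ ↦ g' ξ * φ ξ :=
    hg.mono fun ξ hξ ↦ congrArg (· * φ ξ) hξ
  have hf' : (fun x ↦ f x * fourierInt φ x) =ᵐ[volume] fun x ↦ f' x * fourierInt φ x :=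
    hf.mono fun x hx ↦ congrArg (· * fourierInt φ x) hx
  exact ⟨hgφ.congr hg', hfφ.congr hf',
    by rw [← integral_congr_ae hg', ← integral_congr_ae hf', heq]⟩

theorem locallyIntegrable_of_integrable_mul_schwartz {g : E n → ℂ}
    (hg : ∀ φ : 𝓢(E n, ℂ), Integrable fun ξ ↦ g ξ * φ ξ) : LocallyIntegrable g := by
  intro x
  let b : ContDiffBump x := ⟨1, 2, one_pos, one_lt_two⟩
  have hsupp : HasCompactSupport fun y ↦ (b y : ℂ) :=
    b.hasCompactSupport.comp_left (g := fun r : ℝ ↦ (r : ℂ)) rfl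
  have hsmooth : ContDiff ℝ (⊤ : ℕ∞) fun y ↦ (b y : ℂ) :=
    Complex.ofRealCLM.contDiff.comp b.contDiff
  refine ⟨Metric.closedBall x 1, Metric.closedBall_mem_nhds x one_pos, ?_⟩
  have hint : IntegrableOn (fun ξ ↦ g ξ * (hsupp.toSchwartzMap hsmooth) ξ)
      (Metric.closedBall x 1) := (hg _).integrableOn
  refine hint.congr_fun (fun y hy ↦ ?_) Metric.isClosed_closedBall.measurableSet
  change g y * (b y : ℂ) = g y
  rw [b.one_of_mem_closedBall hy, Complex.ofReal_one, mul_one]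

theorem IsFourierTransform.ae_eq {f g g' : E n → ℂ} (h : IsFourierTransform f g)
    (h' : IsFourierTransform f g') : g =ᵐ[volume] g' := by
  refine ae_eq_of_integral_contDiff_smul_eq
    (locallyIntegrable_of_integrable_mul_schwartz fun φ ↦ (h φ).1)
    (locallyIntegrable_of_integrable_mul_schwartz fun φ ↦ (h' φ).1) fun k hk hks ↦ ?_
  have hsupp : HasCompactSupport fun y ↦ (k y : ℂ) :=
    hks.comp_left (g := fun r : ℝ ↦ (r : ℂ)) rfl
  have hsmooth : ContDiff ℝ (⊤ : ℕ∞) fun y ↦ (k y : ℂ) := Complex.ofRealCLM.contDiff.comp hk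
  set φ : 𝓢(E n, ℂ) := hsupp.toSchwartzMap hsmooth
  have hφ : ∀ u : E n → ℂ, ∫ x, k x • u x = ∫ x, u x * φ x := fun u ↦ by
    refine integral_congr_ae (Eventually.of_forall fun x ↦ ?_)
    change k x • u x = u x * (k x : ℂ)
    rw [Complex.real_smul, mul_comm]
  rw [hφ, hφ, (h φ).2.2, (h' φ).2.2]

theorem eLpNorm_comp_smul {c : ℝ} (hc : c ≠ 0) (p : ℝ≥0∞) (f : E n → ℂ) :
    eLpNorm (fun x ↦ f (c • x)) p volume =
      ENNReal.ofReal |(c ^ n)⁻¹| ^ (1 / p).toReal * eLpNorm f p volume := by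
  have hemb : MeasurableEmbedding (fun x : E n ↦ c • x) :=
    (Homeomorph.smulOfNeZero c hc).measurableEmbedding
  have hne : ENNReal.ofReal |(c ^ n)⁻¹| ≠ 0 :=
    (ENNReal.ofReal_pos.2 (abs_pos.2 (inv_ne_zero (pow_ne_zero n hc)))).ne'
  change eLpNorm (f ∘ fun x ↦ c • x) p volume = _
  rw [← hemb.eLpNorm_map_measure, Measure.map_addHaar_smul volume hc, finrank_euclideanSpace,
    Fintype.card_fin, eLpNorm_smul_measure_of_ne_zero hne, smul_eq_mul]

theorem exists_eLpNorm_comp_smul_le (n : ℕ) {c : ℝ} (hc : c ≠ 0) (p : ℝ≥0∞) :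
    ∃ C : ℝ≥0, ∀ f : E n → ℂ, MemLp f p volume →
      MemLp (fun x ↦ f (c • x)) p volume ∧
        eLpNorm (fun x ↦ f (c • x)) p volume ≤ C * eLpNorm f p volume := by
  have hfin : ENNReal.ofReal |(c ^ n)⁻¹| ^ (1 / p).toReal ≠ ⊤ :=
    ENNReal.rpow_ne_top_of_nonneg ENNReal.toReal_nonneg ENNReal.ofReal_ne_top
  refine ⟨(ENNReal.ofReal |(c ^ n)⁻¹| ^ (1 / p).toReal).toNNReal, fun f hf ↦ ?_⟩
  rw [ENNReal.coe_toNNReal hfin, eLpNorm_comp_smul hc]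
  refine ⟨⟨hf.1.comp_quasiMeasurePreserving (Measure.quasiMeasurePreserving_smul volume hc), ?_⟩,
    le_rfl⟩
  rw [eLpNorm_comp_smul hc]
  exact ENNReal.mul_lt_top hfin.lt_top hf.2

theorem fourier_dilate (φ : 𝓢(E n, ℂ)) (x : E n) :
    𝓕 (dilate Real.two_pi_pos.ne' φ) x = (|((2 * Real.pi) ^ n)⁻¹| : ℝ) * fourierInt φ x := by
  rw [SchwartzMap.fourier_coe, fourierInt_eq_fourier, Real.fourier_eq', Real.fourier_eq']
  have hscale := Measure.integral_comp_smul (volume : Measure (E n)) (fun v : E n ↦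
    Complex.exp (↑(-2 * Real.pi * inner ℝ v ((2 * Real.pi)⁻¹ • x)) * I) • φ v) (2 * Real.pi)
  rw [finrank_euclideanSpace, Fintype.card_fin, Complex.real_smul] at hscale
  rw [← hscale]
  refine integral_congr_ae (Eventually.of_forall fun v ↦ ?_)
  simp only [dilate_apply, inner_smul_left, inner_smul_right, RCLike.conj_to_real,
    inv_mul_cancel_left₀ Real.two_pi_pos.ne']

theorem integral_Lp_fourier_mul (f : Lp ℂ 2 (volume : Measure (E n))) (φ : 𝓢(E n, ℂ)) :
    ∫ ξ, (𝓕 f : Lp ℂ 2 (volume : Measure (E n))) ξ * φ ξ = ∫ x, f x * 𝓕 φ x := by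
  have h := DFunLike.congr_fun (Lp.fourier_toTemperedDistribution_eq f) φ
  simp only [TemperedDistribution.fourier_apply, Lp.toTemperedDistribution_apply,
    smul_eq_mul] at h
  simpa only [mul_comm] using h.symm

theorem isFourierTransform_Lp (f : Lp ℂ 2 (volume : Measure (E n))) :
    IsFourierTransform f fun ξ ↦
      (𝓕 f : Lp ℂ 2 (volume : Measure (E n))) ((2 * Real.pi)⁻¹ • ξ) := by
  intro φ
  set g : E n → ℂ := ⇑(𝓕 f : Lp ℂ 2 (volume : Measure (E n))) with hg
  set κ : ℂ := ((|((2 * Real.pi) ^ n)⁻¹| : ℝ) : ℂ)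
  have hκ : κ ≠ 0 := Complex.ofReal_ne_zero.2 (by positivity)
  obtain ⟨_, hdil⟩ := exists_eLpNorm_comp_smul_le n (inv_ne_zero Real.two_pi_pos.ne') 2
  have hfφ : Integrable fun x ↦ f x * fourierInt φ x := by
    simp only [← schwartzFourier_apply]
    exact (Lp.memLp f).integrable_mul (q := 2) ((schwartzFourier φ).memLp 2)
  refine ⟨(hdil g (Lp.memLp _)).1.integrable_mul (q := 2) (φ.memLp 2), hfφ,
    mul_left_cancel₀ hκ ?_⟩
  calc κ * ∫ ξ, g ((2 * Real.pi)⁻¹ • ξ) * φ ξ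
      = ∫ x, g x * dilate Real.two_pi_pos.ne' φ x := by
        have hscale := Measure.integral_comp_smul (volume : Measure (E n))
          (fun ξ ↦ g ((2 * Real.pi)⁻¹ • ξ) * φ ξ) (2 * Real.pi)
        simp only [inv_smul_smul₀ Real.two_pi_pos.ne', finrank_euclideanSpace, Fintype.card_fin,
          Complex.real_smul] at hscale
        exact hscale.symm
    _ = ∫ x, κ * (f x * fourierInt φ x) := by
        simp only [hg, integral_Lp_fourier_mul, fourier_dilate, mul_left_comm, κ]
    _ = κ * ∫ x, f x * fourierInt φ x := integral_const_mul _ _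

theorem eLpNorm_fourier_Lp (f : Lp ℂ 2 (volume : Measure (E n))) :
    eLpNorm (𝓕 f : Lp ℂ 2 (volume : Measure (E n))) 2 volume = eLpNorm f 2 volume := by
  rw [← Lp.enorm_def, ← Lp.enorm_def, ← ofReal_norm, ← ofReal_norm, Lp.norm_fourier_eq]

theorem exists_isFourierTransform_of_memLp_two (n : ℕ) :
    ∃ C : ℝ≥0, ∀ f : E n → ℂ, MemLp f 2 volume → ∃ g : E n → ℂ, IsFourierTransform f g ∧
      MemLp g 2 volume ∧ eLpNorm g 2 volume ≤ C * eLpNorm f 2 volume := by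
  obtain ⟨C, hC⟩ := exists_eLpNorm_comp_smul_le n (inv_ne_zero Real.two_pi_pos.ne') 2
  refine ⟨C, fun f hf ↦ ?_⟩
  obtain ⟨hmem, hle⟩ := hC _ (Lp.memLp (𝓕 (hf.toLp f) : Lp ℂ 2 (volume : Measure (E n))))
  refine ⟨_, (isFourierTransform_Lp _).congr_ae hf.coeFn_toLp ae_eq_rfl, hmem, ?_⟩
  rwa [eLpNorm_fourier_Lp, eLpNorm_congr_ae hf.coeFn_toLp] at hle

theorem exists_isFourierTransform_inverse (n : ℕ) :
    ∃ C : ℝ≥0, ∀ g : E n → ℂ, MemLp g 2 volume → ∃ f : E n → ℂ, IsFourierTransform f g ∧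
      MemLp f 2 volume ∧ eLpNorm f 2 volume ≤ C * eLpNorm g 2 volume := by
  obtain ⟨C, hC⟩ := exists_eLpNorm_comp_smul_le n Real.two_pi_pos.ne' 2
  refine ⟨C, fun g hg ↦ ?_⟩
  obtain ⟨hmem, hle⟩ := hC g hg
  set G : Lp ℂ 2 (volume : Measure (E n)) := hmem.toLp _
  have hG : (G : E n → ℂ) =ᵐ[volume] fun x ↦ g ((2 * Real.pi) • x) := hmem.coeFn_toLp
  set F : Lp ℂ 2 (volume : Measure (E n)) := 𝓕⁻ G
  have hF : 𝓕 F = G := FourierTransform.fourier_fourierInv_eq G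
  refine ⟨F, (isFourierTransform_Lp F).congr_ae ae_eq_rfl ?_, Lp.memLp F, ?_⟩
  · have hdil := Measure.quasiMeasurePreserving_smul (volume : Measure (E n))
      (inv_ne_zero Real.two_pi_pos.ne')
    filter_upwards [hdil.ae hG] with ξ hξ
    rw [hF, hξ, smul_inv_smul₀ Real.two_pi_pos.ne']
  · rwa [← eLpNorm_fourier_Lp, hF, eLpNorm_congr_ae hG]

theorem exists_eLpNorm_fourierInt_le (n : ℕ) :
    ∃ C : ℝ≥0, ∀ f : E n → ℂ, Integrable f → MemLp f 2 volume →
      MemLp (fourierInt f) 2 volume ∧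
        eLpNorm (fourierInt f) 2 volume ≤ C * eLpNorm f 2 volume := by
  obtain ⟨C, hC⟩ := exists_isFourierTransform_of_memLp_two n
  refine ⟨C, fun f hf hf2 ↦ ?_⟩
  obtain ⟨g, hfg, hg, hle⟩ := hC f hf2
  have hae : g =ᵐ[volume] fourierInt f := hfg.ae_eq (isFourierTransform_of_integrable hf)
  exact ⟨(memLp_congr_ae hae).1 hg, by rwa [← eLpNorm_congr_ae hae]⟩

end FourierTheory

noncomputable section Form

open scoped ComplexConjugate

variable {n : ℕ}

theorem norm_halfMultiplier_le (h : ℝ → ℝ) (s : ℝ) :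
    ‖halfMultiplier h s‖ ≤ ∫ t in Set.Ioi (0 : ℝ), |h t| := by
  refine (norm_integral_le_integral_norm _).trans_eq ?_
  simp only [norm_mul, Complex.norm_exp_ofReal_mul_I, mul_one, Complex.norm_real,
    Real.norm_eq_abs]

theorem integrableOn_mul_cexp_mul_I {h : ℝ → ℝ} (hi : IntegrableOn h (Set.Ioi 0)) (s : ℝ) :
    IntegrableOn (fun t ↦ h t * Complex.exp ((t * s : ℝ) * I)) (Set.Ioi 0) :=
  hi.ofReal.mul_bdd (continuous_cexp_mul_I s).aestronglyMeasurable
    (Eventually.of_forall fun _ ↦ (Complex.norm_exp_ofReal_mul_I _).le)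

theorem continuous_halfMultiplier {h : ℝ → ℝ} (hi : IntegrableOn h (Set.Ioi 0)) :
    Continuous (halfMultiplier h) := by
  refine continuous_of_dominated (bound := fun t ↦ |h t|)
    (fun s ↦ (integrableOn_mul_cexp_mul_I hi s).aestronglyMeasurable)
    (fun s ↦ Eventually.of_forall fun t ↦ ?_) hi.abs
    (Eventually.of_forall fun t ↦ by fun_prop)
  rw [norm_mul, Complex.norm_exp_ofReal_mul_I, mul_one, Complex.norm_real, Real.norm_eq_abs]

theorem integrable_exp_neg_norm_sq : Integrable fun ξ : E n ↦ Real.exp (-‖ξ‖ ^ 2) := by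
  have := GaussianFourier.integrable_cexp_neg_mul_sq_norm_add (V := E n) (b := 1) (by simp) 0 0
  refine this.norm.congr (Eventually.of_forall fun ξ ↦ ?_)
  simp [Complex.norm_exp, ← Complex.ofReal_pow]

/-- The radial function `halfMultiplier h (1 - |ξ|²) e^{-|ξ|²}`. The Gaussian factor makes it
integrable and is bounded below on the unit ball, where it will be removed. -/
def formSymbol (n : ℕ) (h : ℝ → ℝ) (ξ : E n) : ℂ :=
  halfMultiplier h (1 - ‖ξ‖ ^ 2) * (Real.exp (-‖ξ‖ ^ 2) : ℂ)

theorem norm_formSymbol (h : ℝ → ℝ) (ξ : E n) :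
    ‖formSymbol n h ξ‖ = ‖halfMultiplier h (1 - ‖ξ‖ ^ 2)‖ * Real.exp (-‖ξ‖ ^ 2) := by
  rw [formSymbol, norm_mul, Complex.norm_real, Real.norm_eq_abs, abs_of_pos (Real.exp_pos _)]

theorem norm_formSymbol_le (h : ℝ → ℝ) (ξ : E n) :
    ‖formSymbol n h ξ‖ ≤ ‖halfMultiplier h (1 - ‖ξ‖ ^ 2)‖ := by
  rw [norm_formSymbol]
  exact mul_le_of_le_one_right (norm_nonneg _)
    (Real.exp_le_one_iff.2 (neg_nonpos.2 (sq_nonneg ‖ξ‖)))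

theorem continuous_formSymbol {h : ℝ → ℝ} (hi : IntegrableOn h (Set.Ioi 0)) :
    Continuous (formSymbol n h) :=
  ((continuous_halfMultiplier hi).comp (by fun_prop)).mul (by fun_prop)

theorem integrable_formSymbol {h : ℝ → ℝ} (hi : IntegrableOn h (Set.Ioi 0)) :
    Integrable (formSymbol n h) := by
  refine (integrable_exp_neg_norm_sq.const_mul (∫ t in Set.Ioi (0 : ℝ), |h t|)).mono'
    (continuous_formSymbol hi).aestronglyMeasurable (Eventually.of_forall fun ξ ↦ ?_)
  rw [norm_formSymbol]
  exact mul_le_mul_of_nonneg_right (norm_halfMultiplier_le h _) (Real.exp_pos _).le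

theorem formSymbol_eq_lowPart_add_highPart {h : ℝ → ℝ} (hi : IntegrableOn h (Set.Ioi 0)) (T : ℝ)
    (ξ : E n) :
    formSymbol n h ξ = formSymbol n (lowPart h T) ξ + formSymbol n (highPart h T) ξ := by
  simp only [formSymbol, ← add_mul, halfMultiplier]
  rw [← integral_add (integrableOn_mul_cexp_mul_I (integrableOn_lowPart T hi) _)
    (integrableOn_mul_cexp_mul_I (integrableOn_highPart T hi) _)]
  simp only [← add_mul, ← Complex.ofReal_add, highPart, add_sub_cancel]

theorem norm_fourierChar_eq_one (x ξ : E n) :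
    ‖Complex.exp (-I * ((inner ℝ x ξ : ℝ) : ℂ))‖ = 1 := by
  rw [neg_mul, ← mul_neg, ← Complex.ofReal_neg, Complex.norm_exp_I_mul_ofReal]

theorem integrable_fourierChar_mul {f : E n → ℂ} (hf : Integrable f) (x : E n) :
    Integrable fun ξ ↦ Complex.exp (-I * ((inner ℝ x ξ : ℝ) : ℂ)) * f ξ :=
  hf.bdd_mul (by fun_prop : Continuous fun ξ : E n ↦
    Complex.exp (-I * ((inner ℝ x ξ : ℝ) : ℂ))).aestronglyMeasurable
    (Eventually.of_forall fun ξ ↦ (norm_fourierChar_eq_one x ξ).le)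

theorem fourierInt_gaussian (t : ℝ) (x : E n) :
    fourierInt (fun ξ : E n ↦ Complex.exp ((t * (1 - ‖ξ‖ ^ 2) : ℝ) * I) *
      (Real.exp (-‖ξ‖ ^ 2) : ℂ)) x = gaussKernel (n / 2) t ‖x‖ := by
  have hre : 0 < (1 + t * I).re := by simp
  have hgauss := GaussianFourier.integral_cexp_neg_mul_sq_norm_add hre (-I) x
  rw [finrank_euclideanSpace, Fintype.card_fin, neg_sq, Complex.I_sq, neg_one_mul] at hgauss
  rw [gaussKernel, mul_assoc]
  push_cast
  rw [← hgauss, ← integral_const_mul, fourierInt]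
  refine integral_congr_ae (Eventually.of_forall fun ξ ↦ ?_)
  simp only [← Complex.exp_add]
  congr 1
  ring

theorem integrable_prod_gaussian {h : ℝ → ℝ} (hi : IntegrableOn h (Set.Ioi 0)) (x : E n) :
    Integrable (Function.uncurry fun (ξ : E n) (t : ℝ) ↦
      Complex.exp (-I * ((inner ℝ x ξ : ℝ) : ℂ)) * (h t *
        (Complex.exp ((t * (1 - ‖ξ‖ ^ 2) : ℝ) * I) * (Real.exp (-‖ξ‖ ^ 2) : ℂ))))
      (volume.prod (volume.restrict (Set.Ioi 0))) := by
  have hprod : Integrable (fun z : E n × ℝ ↦ (Real.exp (-‖z.1‖ ^ 2) : ℂ) * h z.2)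
      (volume.prod (volume.restrict (Set.Ioi 0))) :=
    Integrable.mul_prod integrable_exp_neg_norm_sq.ofReal hi.ofReal
  have hcont : Continuous fun z : E n × ℝ ↦ Complex.exp (-I * ((inner ℝ x z.1 : ℝ) : ℂ)) *
      Complex.exp ((z.2 * (1 - ‖z.1‖ ^ 2) : ℝ) * I) := by fun_prop
  refine (hprod.bdd_mul (c := 1) hcont.aestronglyMeasurable
    (Eventually.of_forall fun z ↦ ?_)).congr (Eventually.of_forall fun z ↦ ?_)
  · rw [norm_mul, Complex.norm_exp_ofReal_mul_I, mul_one, norm_fourierChar_eq_one]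
  · simp only [Function.uncurry]
    ring

theorem fourierInt_formSymbol {h : ℝ → ℝ} (hi : IntegrableOn h (Set.Ioi 0)) (x : E n) :
    fourierInt (formSymbol n h) x = halfKernel (n / 2) h ‖x‖ := by
  calc fourierInt (formSymbol n h) x
      = ∫ ξ, ∫ t in Set.Ioi (0 : ℝ), Complex.exp (-I * ((inner ℝ x ξ : ℝ) : ℂ)) * (h t *
          (Complex.exp ((t * (1 - ‖ξ‖ ^ 2) : ℝ) * I) * (Real.exp (-‖ξ‖ ^ 2) : ℂ))) := by
        simp only [fourierInt, formSymbol, halfMultiplier, integral_const_mul,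
          ← integral_mul_const, mul_assoc]
    _ = ∫ t in Set.Ioi (0 : ℝ), ∫ ξ, Complex.exp (-I * ((inner ℝ x ξ : ℝ) : ℂ)) * (h t *
          (Complex.exp ((t * (1 - ‖ξ‖ ^ 2) : ℝ) * I) * (Real.exp (-‖ξ‖ ^ 2) : ℂ))) :=
        integral_integral_swap (integrable_prod_gaussian hi x)
    _ = halfKernel (n / 2) h ‖x‖ := by
        simp only [halfKernel, ← fourierInt_gaussian, fourierInt, ← integral_const_mul,
          mul_left_comm]

theorem conj_fourierInt (f : E n → ℂ) (ξ : E n) :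
    conj (fourierInt f ξ) = fourierInt (fun x ↦ conj (f (-x))) ξ := by
  rw [fourierInt, ← integral_conj, ← integral_neg_eq_self, fourierInt]
  refine integral_congr_ae (Eventually.of_forall fun x ↦ ?_)
  simp only [map_mul, ← Complex.exp_conj, Complex.conj_I, Complex.conj_ofReal,
    inner_neg_right, Complex.ofReal_neg, neg_neg, neg_mul, mul_neg]

theorem fourierInt_fourierChar_mul (f : E n → ℂ) (x y : E n) :
    fourierInt (fun ξ ↦ Complex.exp (-I * ((inner ℝ x ξ : ℝ) : ℂ)) * f ξ) y =
      fourierInt f (x + y) := by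
  refine integral_congr_ae (Eventually.of_forall fun ξ ↦ ?_)
  simp only
  rw [← mul_assoc, ← Complex.exp_add, inner_add_left, Complex.ofReal_add, mul_add,
    add_comm (-I * _)]

theorem norm_fourierInt_mul_fourierInt_le {W g : E n → ℂ} {M : ℝ} (hW : Integrable W)
    (hg : Integrable g) (hM : ∀ x, ‖fourierInt W x‖ ≤ M) (x : E n) :
    ‖fourierInt (fun ξ ↦ W ξ * fourierInt g ξ) x‖ ≤ M * ∫ y, ‖g y‖ := by
  have hconv : fourierInt (fun ξ ↦ W ξ * fourierInt g ξ) x =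
      ∫ y, fourierInt W (x + y) * g y := by
    simp only [← fourierInt_fourierChar_mul]
    rw [integral_fourierInt_mul (integrable_fourierChar_mul hW x) hg]
    simp only [mul_assoc, fourierInt]
  rw [hconv, ← integral_const_mul]
  refine norm_integral_le_of_norm_le (hg.norm.const_mul M) (Eventually.of_forall fun y ↦ ?_)
  rw [norm_mul]
  exact mul_le_mul_of_nonneg_right (hM _) (norm_nonneg _)

/-- The form `⟨W(D) f, g⟩`, written on the Fourier side. -/
def fourierForm (W f g : E n → ℂ) : ℂ := ∫ ξ, W ξ * (fourierInt f ξ * conj (fourierInt g ξ))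

theorem integrable_fourierForm {W f g : E n → ℂ} (hW : Integrable W) (hf : Integrable f)
    (hg : Integrable g) :
    Integrable fun ξ ↦ W ξ * (fourierInt f ξ * conj (fourierInt g ξ)) := by
  refine hW.mul_bdd (c := (∫ x, ‖f x‖) * ∫ x, ‖g x‖) ((continuous_fourierInt hf).mul
    (Complex.continuous_conj.comp (continuous_fourierInt hg))).aestronglyMeasurable
    (Eventually.of_forall fun ξ ↦ ?_)
  rw [norm_mul, RCLike.norm_conj]
  exact mul_le_mul (norm_fourierInt_le f ξ) (norm_fourierInt_le g ξ) (norm_nonneg _)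
    (integral_nonneg fun _ ↦ norm_nonneg _)

theorem norm_fourierForm_le {W f g : E n → ℂ} {M : ℝ} (hW : Integrable W) (hf : Integrable f)
    (hg : Integrable g) (hM : ∀ x, ‖fourierInt W x‖ ≤ M) :
    ‖fourierForm W f g‖ ≤ M * ((∫ x, ‖f x‖) * ∫ x, ‖g x‖) := by
  set g' : E n → ℂ := fun x ↦ conj (g (-x))
  have hg' : Integrable g' :=
    (Complex.conjCLE : ℂ →L[ℝ] ℂ).integrable_comp hg.comp_neg
  have hnorm : ∫ x, ‖g' x‖ = ∫ x, ‖g x‖ := by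
    simp only [g', RCLike.norm_conj]
    exact integral_neg_eq_self (fun x ↦ ‖g x‖) volume
  have hWg : Integrable fun ξ ↦ W ξ * fourierInt g' ξ :=
    hW.mul_bdd (continuous_fourierInt hg').aestronglyMeasurable
      (Eventually.of_forall (norm_fourierInt_le g'))
  have hform : fourierForm W f g = ∫ x, f x * fourierInt (fun ξ ↦ W ξ * fourierInt g' ξ) x := by
    rw [← integral_fourierInt_mul hf hWg]
    simp only [fourierForm, conj_fourierInt, g', mul_left_comm]
  rw [hform, ← hnorm, mul_left_comm, ← integral_mul_const]
  refine norm_integral_le_of_norm_le (hf.norm.mul_const _) (Eventually.of_forall fun x ↦ ?_)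
  rw [norm_mul]
  exact mul_le_mul_of_nonneg_left (norm_fourierInt_mul_fourierInt_le hW hg' hM x) (norm_nonneg _)

theorem norm_fourierForm_formSymbol_le {h : ℝ → ℝ} {f g : E n → ℂ} {M : ℝ}
    (hi : IntegrableOn h (Set.Ioi 0)) (hf : Integrable f) (hg : Integrable g)
    (hM : ∀ r, 0 ≤ r → ‖halfKernel (n / 2) h r‖ ≤ M) :
    ‖fourierForm (formSymbol n h) f g‖ ≤ M * ((∫ x, ‖f x‖) * ∫ x, ‖g x‖) :=
  norm_fourierForm_le (integrable_formSymbol hi) hf hg fun x ↦ by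
    rw [fourierInt_formSymbol hi]
    exact hM _ (norm_nonneg _)

theorem fourierInt_finsetSum {ι : Type*} (S : Finset ι) {f : ι → E n → ℂ}
    (hf : ∀ i ∈ S, Integrable (f i)) (ξ : E n) :
    fourierInt (fun x ↦ ∑ i ∈ S, f i x) ξ = ∑ i ∈ S, fourierInt (f i) ξ := by
  simp only [fourierInt, Finset.mul_sum]
  exact integral_finsetSum S fun i hi ↦ integrable_fourierChar_mul (hf i hi) ξ

theorem fourierForm_finsetSum {ι : Type*} (S : Finset ι) {W : E n → ℂ} {f : ι → E n → ℂ}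
    (hW : Integrable W) (hf : ∀ i ∈ S, Integrable (f i)) :
    fourierForm W (fun x ↦ ∑ i ∈ S, f i x) (fun x ↦ ∑ i ∈ S, f i x) =
      ∑ i ∈ S, ∑ j ∈ S, fourierForm W (f i) (f j) := by
  simp only [fourierForm, fourierInt_finsetSum S hf, map_sum, Finset.sum_mul_sum]
  simp only [Finset.mul_sum]
  rw [integral_finsetSum _ fun i hi ↦ integrable_finsetSum _ fun j hj ↦
    integrable_fourierForm hW (hf i hi) (hf j hj)]
  exact Finset.sum_congr rfl fun i hi ↦ integral_finsetSum _ fun j hj ↦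
    integrable_fourierForm hW (hf i hi) (hf j hj)

end Form

noncomputable section Schur

theorem summable_exp_neg_mul_abs_int {δ : ℝ} (hδ : 0 < δ) :
    Summable fun j : ℤ ↦ Real.exp (-(δ * |(j : ℝ)|)) := by
  have hnat : Summable fun j : ℕ ↦ Real.exp (-(δ * (j : ℝ))) := by
    simpa only [mul_comm δ, mul_neg] using Real.summable_exp_nat_mul_iff.2 (neg_lt_zero.2 hδ)
  refine Summable.of_nat_of_neg (hnat.congr fun j ↦ ?_) (hnat.congr fun j ↦ ?_) <;> simp

theorem exp_neg_abs_sub_le {δ : ℝ} (hδ : 0 < δ) (c : ℝ) (k : ℤ) :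
    Real.exp (-|δ * (k : ℝ) - c|) ≤
      Real.exp δ * Real.exp (-(δ * |((k - ⌊c / δ⌋ : ℤ) : ℝ)|)) := by
  have hfloor : |c / δ - ⌊c / δ⌋| ≤ 1 := by
    rw [Int.self_sub_floor, Int.abs_fract]
    exact (Int.fract_lt_one _).le
  have hdist : |(k : ℝ) - ⌊c / δ⌋| ≤ |(k : ℝ) - c / δ| + 1 :=
    (abs_sub_le _ (c / δ) _).trans (add_le_add_right hfloor _)
  have hscale : |δ * (k : ℝ) - c| = δ * |(k : ℝ) - c / δ| := by
    rw [← abs_of_pos hδ, ← abs_mul, abs_of_pos hδ, mul_sub, mul_div_cancel₀ _ hδ.ne']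
  rw [← Real.exp_add, Real.exp_le_exp, hscale, Int.cast_sub]
  nlinarith

theorem exists_sum_exp_neg_abs_le {δ : ℝ} (hδ : 0 < δ) :
    ∃ C : ℝ, 0 ≤ C ∧ ∀ (S : Finset ℤ) (c : ℝ),
      ∑ k ∈ S, Real.exp (-|δ * (k : ℝ) - c|) ≤ C := by
  set F : ℤ → ℝ := fun j ↦ Real.exp (-(δ * |(j : ℝ)|))
  refine ⟨Real.exp δ * ∑' j, F j, by positivity, fun S c ↦ ?_⟩
  set k₀ : ℤ := ⌊c / δ⌋
  have hshift : Summable fun k ↦ F (k - k₀) :=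
    (Equiv.subRight k₀).summable_iff.2 (summable_exp_neg_mul_abs_int hδ)
  calc ∑ k ∈ S, Real.exp (-|δ * (k : ℝ) - c|)
      ≤ ∑ k ∈ S, Real.exp δ * F (k - k₀) :=
        Finset.sum_le_sum fun k _ ↦ exp_neg_abs_sub_le hδ c k
    _ = Real.exp δ * ∑ k ∈ S, F (k - k₀) := (Finset.mul_sum _ _ _).symm
    _ ≤ Real.exp δ * ∑' k, F (k - k₀) :=
        mul_le_mul_of_nonneg_left (hshift.sum_le_tsum S fun _ _ ↦ (Real.exp_pos _).le)
          (Real.exp_pos _).le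
    _ = Real.exp δ * ∑' j, F j := by rw [(Equiv.subRight k₀).tsum_eq F |>.symm]; rfl

/-- The profile `min(x, 1/x)`, at most `1` and decaying both for `x → 0` and for `x → ∞`. -/
def minInv (x : ℝ) : ℝ := min x x⁻¹

theorem minInv_nonneg {x : ℝ} (hx : 0 ≤ x) : 0 ≤ minInv x := le_min hx (inv_nonneg.2 hx)

theorem minInv_le_one (x : ℝ) : minInv x ≤ 1 := by
  rcases le_total x 1 with h | h
  · exact (min_le_left _ _).trans h
  · exact (min_le_right _ _).trans (inv_le_one_of_one_le₀ h)

theorem measurable_minInv : Measurable minInv := measurable_id.min measurable_inv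

theorem minInv_exp (u : ℝ) : minInv (Real.exp u) = Real.exp (-|u|) := by
  rw [minInv, ← Real.exp_neg, ← Real.exp_monotone.map_min, abs_eq_max_neg,
    ← min_neg_neg, neg_neg, min_comm]

theorem exists_sum_minInv_le {δ : ℝ} (hδ : 0 < δ) :
    ∃ C : ℝ, 0 ≤ C ∧ ∀ (S : Finset ℤ) (y : ℝ), 0 ≤ y →
      ∑ k ∈ S, minInv ((2 : ℝ) ^ (-(δ * k)) * y) ≤ C := by
  obtain ⟨C, hC, hsum⟩ := exists_sum_exp_neg_abs_le (mul_pos (Real.log_pos one_lt_two) hδ)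
  refine ⟨C, hC, fun S y hy ↦ ?_⟩
  rcases hy.eq_or_lt with rfl | hy
  · simpa [minInv] using hC
  refine (Finset.sum_congr rfl fun k _ ↦ ?_).trans_le (hsum S (Real.log y))
  have hexp : (2 : ℝ) ^ (-(δ * k)) * y = Real.exp (-(Real.log 2 * δ * k - Real.log y)) := by
    rw [neg_sub, sub_eq_neg_add, Real.exp_add, Real.exp_log hy, Real.rpow_def_of_pos two_pos]
    ring_nf
  rw [hexp, minInv_exp, abs_neg]

theorem sum_mul_mul_le_of_sum_le {κ : ℤ → ℝ} {C : ℝ} (hκ : ∀ k, 0 ≤ κ k)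
    (hC : ∀ S : Finset ℤ, ∑ k ∈ S, κ k ≤ C) (S : Finset ℤ) (x : ℤ → ℝ) :
    ∑ k ∈ S, ∑ l ∈ S, κ (k + l) * (x k * x l) ≤ C * ∑ k ∈ S, x k ^ 2 := by
  have hrow : ∀ k, ∑ l ∈ S, κ (k + l) ≤ C := fun k ↦ by
    simpa using hC (S.map (addLeftEmbedding k))
  have hleft : ∑ k ∈ S, ∑ l ∈ S, κ (k + l) * x k ^ 2 ≤ C * ∑ k ∈ S, x k ^ 2 := by
    rw [Finset.mul_sum]
    refine Finset.sum_le_sum fun k _ ↦ ?_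
    rw [← Finset.sum_mul]
    exact mul_le_mul_of_nonneg_right (hrow k) (sq_nonneg _)
  have hright : ∑ k ∈ S, ∑ l ∈ S, κ (k + l) * x l ^ 2 ≤ C * ∑ k ∈ S, x k ^ 2 := by
    rw [Finset.sum_comm]
    simpa only [add_comm] using hleft
  have hsplit : ∑ k ∈ S, ∑ l ∈ S, κ (k + l) * (x k * x l) ≤
      ∑ k ∈ S, ∑ l ∈ S, (κ (k + l) * x k ^ 2 + κ (k + l) * x l ^ 2) / 2 := by
    refine Finset.sum_le_sum fun k _ ↦ Finset.sum_le_sum fun l _ ↦ ?_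
    nlinarith [mul_nonneg (hκ (k + l)) (sq_nonneg (x k - x l))]
  simp only [add_div, Finset.sum_add_distrib, ← Finset.sum_div] at hsplit
  linarith

end Schur

noncomputable section PairBound

open scoped ComplexConjugate

variable {n : ℕ}

theorem integral_norm_rpow_eq_of_memLp {X F : Type*} [MeasurableSpace X] [NormedAddCommGroup F]
    {μ : Measure X} {p : ℝ} (hp : 0 < p) {f : X → F} (hf : MemLp f (ENNReal.ofReal p) μ) :
    ∫ x, ‖f x‖ ^ p ∂μ = (eLpNorm f (ENNReal.ofReal p) μ).toReal ^ p := by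
  have hnonneg : 0 ≤ ∫ x, ‖f x‖ ^ p ∂μ := integral_nonneg fun _ ↦ by positivity
  rw [hf.eLpNorm_eq_integral_rpow_norm (by simpa using hp) ENNReal.ofReal_ne_top,
    ENNReal.toReal_ofReal hp.le, ENNReal.toReal_ofReal (by positivity),
    Real.rpow_inv_rpow hnonneg hp.ne']

theorem integral_norm_sq_eq_of_memLp {X F : Type*} [MeasurableSpace X] [NormedAddCommGroup F]
    {μ : Measure X} {f : X → F} (hf : MemLp f 2 μ) :
    ∫ x, ‖f x‖ ^ 2 ∂μ = (eLpNorm f 2 μ).toReal ^ 2 := by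
  simpa using integral_norm_rpow_eq_of_memLp two_pos (by simpa using hf)

theorem exists_integral_fourierInt_sq_le (n : ℕ) :
    ∃ C : ℝ, 0 ≤ C ∧ ∀ f : E n → ℂ, Integrable f → MemLp f 2 volume →
      MemLp (fourierInt f) 2 volume ∧
        ∫ ξ, ‖fourierInt f ξ‖ ^ 2 ≤ C * ∫ x, ‖f x‖ ^ 2 := by
  obtain ⟨C, hC⟩ := exists_eLpNorm_fourierInt_le n
  refine ⟨(C : ℝ) ^ 2, by positivity, fun f hf hf2 ↦ ?_⟩
  obtain ⟨hmem, hle⟩ := hC f hf hf2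
  refine ⟨hmem, ?_⟩
  rw [integral_norm_sq_eq_of_memLp hmem, integral_norm_sq_eq_of_memLp hf2, ← mul_pow]
  refine pow_le_pow_left₀ ENNReal.toReal_nonneg ?_ 2
  simpa using ENNReal.toReal_mono (ENNReal.mul_ne_top ENNReal.coe_ne_top hf2.2.ne) hle

/-- The integral against `min(T|1 - |ξ|²|, 1/(T|1 - |ξ|²|))`, a weight concentrated where
`|1 - |ξ|²| ≈ 1/T`, of `|f̂ ĝ|`. -/
def shellIntegral (T : ℝ) (f g : E n → ℂ) : ℝ :=
  ∫ ξ, minInv (T * |1 - ‖ξ‖ ^ 2|) * (‖fourierInt f ξ‖ * ‖fourierInt g ξ‖)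

theorem shellWeight_nonneg {T : ℝ} (hT : 0 ≤ T) (ξ : E n) : 0 ≤ minInv (T * |1 - ‖ξ‖ ^ 2|) :=
  minInv_nonneg (by positivity)

theorem shellIntegral_nonneg {T : ℝ} (hT : 0 ≤ T) (f g : E n → ℂ) : 0 ≤ shellIntegral T f g :=
  integral_nonneg fun ξ ↦ mul_nonneg (shellWeight_nonneg hT ξ) (by positivity)

theorem integrable_shellIntegral {T : ℝ} (hT : 0 ≤ T) {f g : E n → ℂ}
    (hf : MemLp (fourierInt f) 2 volume) (hg : MemLp (fourierInt g) 2 volume) :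
    Integrable fun ξ ↦ minInv (T * |1 - ‖ξ‖ ^ 2|) * (‖fourierInt f ξ‖ * ‖fourierInt g ξ‖) := by
  have hfg : Integrable fun ξ ↦ ‖fourierInt f ξ‖ * ‖fourierInt g ξ‖ :=
    hf.norm.integrable_mul (q := 2) hg.norm
  refine hfg.bdd_mul (c := 1) (measurable_minInv.comp (by fun_prop)).aestronglyMeasurable
    (Eventually.of_forall fun ξ ↦ ?_)
  rw [Real.norm_eq_abs, abs_of_nonneg (shellWeight_nonneg hT ξ)]
  exact minInv_le_one _

theorem IsSymbol.norm_halfMultiplier_lowPart_le_minInv {h h' : ℝ → ℝ} {γ H T : ℝ}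
    (hs : IsSymbol h h' γ H) (hγ : 0 < γ) (hT : 0 < T) (s : ℝ) :
    ‖halfMultiplier (lowPart h T) s‖ ≤ (3 + 1 / γ) * H * T ^ (γ + 1) * minInv (T * |s|) := by
  have hnear := hs.norm_halfMultiplier_lowPart_le hγ.le hT s
  have hfar := hs.mul_norm_halfMultiplier_lowPart_le hγ hT s
  have hH := hs.nonneg
  have hx : 0 ≤ T * |s| := by positivity
  have hconst : 3 * H * T ^ (γ + 1) ≤ (3 + 1 / γ) * H * T ^ (γ + 1) := by
    gcongr
    exact le_add_of_nonneg_right (by positivity)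
  rw [minInv, mul_min_of_nonneg _ _ (by positivity)]
  refine le_min (hnear.trans (mul_le_mul_of_nonneg_right hconst hx)) ?_
  rcases hx.eq_or_lt with hx | hx
  · rw [← hx] at hnear ⊢
    simpa using hnear
  · rwa [← div_eq_mul_inv, le_div_iff₀ hx, mul_comm]

theorem IsSymbol.norm_fourierForm_lowPart_le {h h' : ℝ → ℝ} {γ H T : ℝ} {f g : E n → ℂ}
    (hs : IsSymbol h h' γ H) (hγ : 0 < γ) (hT : 0 < T)
    (hf : MemLp (fourierInt f) 2 volume) (hg : MemLp (fourierInt g) 2 volume) :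
    ‖fourierForm (formSymbol n (lowPart h T)) f g‖ ≤
      (3 + 1 / γ) * H * T ^ (γ + 1) * shellIntegral T f g := by
  rw [shellIntegral, ← integral_const_mul]
  refine norm_integral_le_of_norm_le ((integrable_shellIntegral hT.le hf hg).const_mul _)
    (Eventually.of_forall fun ξ ↦ ?_)
  rw [norm_mul, norm_mul, RCLike.norm_conj, ← mul_assoc (_ * _ * _)]
  exact mul_le_mul_of_nonneg_right ((norm_formSymbol_le _ _).trans
    (hs.norm_halfMultiplier_lowPart_le_minInv hγ hT _)) (by positivity)

theorem fourierForm_eq_lowPart_add_highPart {h : ℝ → ℝ} {f g : E n → ℂ}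
    (hi : IntegrableOn h (Set.Ioi 0)) (hf : Integrable f) (hg : Integrable g) (T : ℝ) :
    fourierForm (formSymbol n h) f g = fourierForm (formSymbol n (lowPart h T)) f g +
      fourierForm (formSymbol n (highPart h T)) f g := by
  simp only [fourierForm, formSymbol_eq_lowPart_add_highPart hi T, add_mul]
  exact integral_add
    (integrable_fourierForm (integrable_formSymbol (integrableOn_lowPart T hi)) hf hg)
    (integrable_fourierForm (integrable_formSymbol (integrableOn_highPart T hi)) hf hg)

/- The part of the symbol below the scale `T` is bounded by its values, the part above it by the
decay of its kernel; the scale will be chosen for each pair of level sets. -/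
theorem IsSymbol.exists_norm_fourierForm_le (n : ℕ) {γ a : ℝ} (hγ : 0 < γ) (ha : 0 ≤ a)
    (han : a ≤ ((n : ℝ) - 1) / 2 - γ) :
    ∃ C : ℝ, 0 ≤ C ∧ ∀ (h h' : ℝ → ℝ) (H T : ℝ) (f g : E n → ℂ), IsSymbol h h' γ H →
      0 < T → Integrable f → Integrable g →
      MemLp (fourierInt f) 2 volume → MemLp (fourierInt g) 2 volume →
      ‖fourierForm (formSymbol n h) f g‖ ≤ C * H * (T ^ (γ + 1) * shellIntegral T f g +
        T ^ (-a) * ((∫ x, ‖f x‖) * ∫ x, ‖g x‖)) := by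
  have hd : (0 : ℝ) ≤ n / 2 := by positivity
  have hb : 1 / 2 ≤ (n : ℝ) / 2 - γ := by linarith
  obtain ⟨C₁, hC₁, hall⟩ := IsSymbol.exists_norm_halfKernel_le hd hγ.le hb
  obtain ⟨C₂, hC₂, hhigh⟩ := IsSymbol.exists_norm_halfKernel_highPart_le hd hγ.le hb
  set C₃ : ℝ := 3 + 1 / γ
  have hC₃ : 0 ≤ C₃ := by positivity
  refine ⟨C₁ * 2 ^ a + C₂ + C₃, by positivity, fun h h' H T f g hs hT hf hg hf2 hg2 ↦ ?_⟩
  have hH := hs.nonneg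
  set P := (∫ x, ‖f x‖) * ∫ x, ‖g x‖
  have : 0 ≤ P := mul_nonneg (integral_nonneg fun _ ↦ norm_nonneg _)
    (integral_nonneg fun _ ↦ norm_nonneg _)
  have hJ : 0 ≤ T ^ (γ + 1) * shellIntegral T f g :=
    mul_nonneg (by positivity) (shellIntegral_nonneg hT.le f g)
  rcases lt_or_ge T 2 with hT2 | hT2
  · have hscale : 1 ≤ 2 ^ a * T ^ (-a) := by
      rw [Real.rpow_neg hT.le, ← div_eq_mul_inv, ← Real.div_rpow zero_le_two hT.le]
      exact Real.one_le_rpow ((one_le_div hT).2 hT2.le) ha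
    calc ‖fourierForm (formSymbol n h) f g‖ ≤ C₁ * H * P :=
          norm_fourierForm_formSymbol_le hs.integrableOn hf hg fun r hr ↦ hall h h' H r hr hs
      _ ≤ C₁ * H * P * (2 ^ a * T ^ (-a)) := le_mul_of_one_le_right (by positivity) hscale
      _ = C₁ * 2 ^ a * H * (0 + T ^ (-a) * P) := by ring
      _ ≤ _ := by
          gcongr
          linarith
  · have hdecay : T ^ (1 / 2 - ((n : ℝ) / 2 - γ)) ≤ T ^ (-a) :=
      Real.rpow_le_rpow_of_exponent_le (by linarith) (by linarith)
    rw [fourierForm_eq_lowPart_add_highPart hs.integrableOn hf hg T]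
    calc _ ≤ C₃ * H * T ^ (γ + 1) * shellIntegral T f g +
            C₂ * H * T ^ (1 / 2 - ((n : ℝ) / 2 - γ)) * P :=
          (norm_add_le _ _).trans (add_le_add (hs.norm_fourierForm_lowPart_le hγ hT hf2 hg2)
            (norm_fourierForm_formSymbol_le (integrableOn_highPart T hs.integrableOn) hf hg
              fun r hr ↦ hhigh h h' H r T hr hT2 hs))
      _ ≤ C₃ * H * (T ^ (γ + 1) * shellIntegral T f g) + C₂ * H * (T ^ (-a) * P) := by
          rw [mul_assoc _ (T ^ (γ + 1)), mul_assoc _ (T ^ _) P]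
          gcongr
      _ ≤ _ := by
          rw [mul_add]
          gcongr <;> linarith [show 0 ≤ C₁ * 2 ^ a by positivity]

end PairBound

section LevelParts

variable {X F : Type*} [NormedAddCommGroup F] {f : X → F} {p : ℝ}

/-- The dyadic level set on which `2 ^ k ≤ ‖f‖ < 2 ^ (k + 1)`. -/
def levelSet (f : X → F) (k : ℤ) : Set X :=
  {x | (2 : ℝ) ^ (k : ℝ) ≤ ‖f x‖ ∧ ‖f x‖ < (2 : ℝ) ^ ((k : ℝ) + 1)}

/-- The restriction of `f` to its `k`-th dyadic level set. These pieces play the role of the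
characteristic functions of level sets in a restricted-type interpolation argument. -/
noncomputable def levelPart (f : X → F) (k : ℤ) : X → F := (levelSet f k).indicator f

theorem mem_levelSet_iff_floor_logb {x : X} (hx : f x ≠ 0) {k : ℤ} :
    x ∈ levelSet f k ↔ ⌊Real.logb 2 ‖f x‖⌋ = k := by
  rw [levelSet, Set.mem_ofPred_eq, Int.floor_eq_iff,
    Real.le_logb_iff_rpow_le one_lt_two (norm_pos_iff.2 hx),
    Real.logb_lt_iff_lt_rpow one_lt_two (norm_pos_iff.2 hx)]

theorem norm_pos_of_mem_levelSet {x : X} {k : ℤ} (hx : x ∈ levelSet f k) : 0 < ‖f x‖ :=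
  lt_of_lt_of_le (by positivity) hx.1

theorem norm_levelPart_le (f : X → F) (k : ℤ) (x : X) : ‖levelPart f k x‖ ≤ ‖f x‖ :=
  norm_indicator_le_norm_self f x

theorem levelPart_eq_ite {x : X} (hx : f x ≠ 0) (k : ℤ) :
    levelPart f k x = if ⌊Real.logb 2 ‖f x‖⌋ = k then f x else 0 := by
  classical
  simp only [levelPart, Set.indicator_apply, mem_levelSet_iff_floor_logb hx]

theorem levelPart_eq_zero {x : X} (hx : f x = 0) (k : ℤ) : levelPart f k x = 0 :=
  Set.indicator_apply_eq_zero.2 fun _ ↦ hx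

theorem sum_levelPart (f : X → F) (S : Finset ℤ) (x : X) :
    ∑ k ∈ S, levelPart f k x = if ⌊Real.logb 2 ‖f x‖⌋ ∈ S then f x else 0 := by
  by_cases hx : f x = 0
  · simp only [levelPart_eq_zero hx, hx, Finset.sum_const_zero, ite_self]
  · simp only [levelPart_eq_ite hx, Finset.sum_ite_eq]

theorem norm_sum_levelPart_le (f : X → F) (S : Finset ℤ) (x : X) :
    ‖∑ k ∈ S, levelPart f k x‖ ≤ ‖f x‖ := by
  rw [sum_levelPart]
  split_ifs
  · exact le_rfl
  · simp

theorem tendsto_sum_levelPart (f : X → F) (x : X) :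
    Tendsto (fun S : Finset ℤ ↦ ∑ k ∈ S, levelPart f k x) atTop (𝓝 (f x)) := by
  refine tendsto_const_nhds.congr' ?_
  filter_upwards [eventually_ge_atTop {⌊Real.logb 2 ‖f x‖⌋}] with S hS
  rw [sum_levelPart, if_pos (Finset.singleton_subset_iff.1 hS)]

theorem sum_norm_levelPart_rpow_le (f : X → F) (hp : 0 < p) (S : Finset ℤ) (x : X) :
    ∑ k ∈ S, ‖levelPart f k x‖ ^ p ≤ ‖f x‖ ^ p := by
  by_cases hx : f x = 0
  · simp [levelPart_eq_zero hx, hx, Real.zero_rpow hp.ne']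
  · simp only [levelPart_eq_ite hx, apply_ite (‖·‖ ^ p), norm_zero, Real.zero_rpow hp.ne',
      Finset.sum_ite_eq]
    split_ifs
    · exact le_rfl
    · positivity

theorem two_rpow_mul_norm_levelPart_le (f : X → F) (hp : 1 ≤ p) (k : ℤ) (x : X) :
    (2 : ℝ) ^ ((k : ℝ) * (p - 1)) * ‖levelPart f k x‖ ≤ ‖levelPart f k x‖ ^ p := by
  by_cases hx : x ∈ levelSet f k
  · have hpos := norm_pos_of_mem_levelSet hx
    rw [levelPart, Set.indicator_of_mem hx]
    calc (2 : ℝ) ^ ((k : ℝ) * (p - 1)) * ‖f x‖ ≤ ‖f x‖ ^ (p - 1) * ‖f x‖ := by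
          rw [Real.rpow_mul zero_le_two]
          gcongr
          exact hx.1
      _ = ‖f x‖ ^ p := by rw [Real.rpow_sub_one hpos.ne', div_mul_cancel₀ _ hpos.ne']
  · rw [levelPart, Set.indicator_of_notMem hx, norm_zero, mul_zero]
    positivity

theorem two_rpow_mul_norm_levelPart_sq_le (f : X → F) (hp : p ≤ 2) (k : ℤ) (x : X) :
    (2 : ℝ) ^ (-((k : ℝ) * (2 - p))) * ‖levelPart f k x‖ ^ 2 ≤
      2 ^ (2 - p) * ‖levelPart f k x‖ ^ p := by
  by_cases hx : x ∈ levelSet f k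
  · have hpos := norm_pos_of_mem_levelSet hx
    rw [levelPart, Set.indicator_of_mem hx]
    calc (2 : ℝ) ^ (-((k : ℝ) * (2 - p))) * ‖f x‖ ^ 2
        = 2 ^ (-((k : ℝ) * (2 - p))) * (‖f x‖ ^ (2 - p) * ‖f x‖ ^ p) := by
          rw [← Real.rpow_add hpos, sub_add_cancel, Real.rpow_two]
      _ ≤ 2 ^ (-((k : ℝ) * (2 - p))) * (((2 : ℝ) ^ ((k : ℝ) + 1)) ^ (2 - p) * ‖f x‖ ^ p) := by
          gcongr
          exact hx.2.le
      _ = 2 ^ (2 - p) * ‖f x‖ ^ p := by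
          rw [← mul_assoc, ← Real.rpow_mul zero_le_two, ← Real.rpow_add two_pos]
          ring_nf
  · rw [levelPart, Set.indicator_of_notMem hx, norm_zero, zero_pow two_ne_zero, mul_zero]
    positivity

variable [MeasurableSpace X] {μ : Measure X}

theorem aestronglyMeasurable_levelPart (hf : AEStronglyMeasurable f μ) (k : ℤ) :
    AEStronglyMeasurable (levelPart f k) μ :=
  hf.indicator₀ ((nullMeasurableSet_le aemeasurable_const hf.norm.aemeasurable).inter
    (nullMeasurableSet_lt hf.norm.aemeasurable aemeasurable_const))

theorem memLp_levelPart {q : ℝ≥0∞} (hf : MemLp f q μ) (k : ℤ) : MemLp (levelPart f k) q μ :=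
  hf.mono (aestronglyMeasurable_levelPart hf.aestronglyMeasurable k)
    (Eventually.of_forall (norm_levelPart_le f k))

theorem integrable_levelPart (hf : Integrable f μ) (k : ℤ) : Integrable (levelPart f k) μ :=
  hf.mono (aestronglyMeasurable_levelPart hf.aestronglyMeasurable k)
    (Eventually.of_forall (norm_levelPart_le f k))

theorem integrable_norm_rpow_of_memLp (hp : 0 < p) (hf : MemLp f (ENNReal.ofReal p) μ) :
    Integrable (fun x ↦ ‖f x‖ ^ p) μ := by
  simpa only [ENNReal.toReal_ofReal hp.le] using
    hf.integrable_norm_rpow (by simpa using hp) ENNReal.ofReal_ne_top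

theorem sum_integral_norm_levelPart_rpow_le (hp : 0 < p) (hf : MemLp f (ENNReal.ofReal p) μ)
    (S : Finset ℤ) : ∑ k ∈ S, ∫ x, ‖levelPart f k x‖ ^ p ∂μ ≤ ∫ x, ‖f x‖ ^ p ∂μ := by
  have hi : ∀ k ∈ S, Integrable (fun x ↦ ‖levelPart f k x‖ ^ p) μ := fun k _ ↦
    integrable_norm_rpow_of_memLp hp (memLp_levelPart hf k)
  rw [← integral_finsetSum S hi]
  exact integral_mono (integrable_finsetSum S hi) (integrable_norm_rpow_of_memLp hp hf)
    fun x ↦ sum_norm_levelPart_rpow_le f hp S x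

theorem sum_two_rpow_mul_integral_norm_levelPart_le (hp : 1 ≤ p) (hf : Integrable f μ)
    (hfp : MemLp f (ENNReal.ofReal p) μ) (S : Finset ℤ) :
    ∑ k ∈ S, (2 : ℝ) ^ ((k : ℝ) * (p - 1)) * ∫ x, ‖levelPart f k x‖ ∂μ ≤
      ∫ x, ‖f x‖ ^ p ∂μ := by
  have hp0 : 0 < p := by linarith
  refine (Finset.sum_le_sum fun k _ ↦ ?_).trans (sum_integral_norm_levelPart_rpow_le hp0 hfp S)
  rw [← integral_const_mul]
  exact integral_mono ((integrable_levelPart hf k).norm.const_mul _)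
    (integrable_norm_rpow_of_memLp hp0 (memLp_levelPart hfp k))
    fun x ↦ two_rpow_mul_norm_levelPart_le f hp k x

theorem sum_two_rpow_mul_integral_norm_levelPart_sq_le (hp : 0 < p) (hp2 : p ≤ 2)
    (hf : MemLp f 2 μ) (hfp : MemLp f (ENNReal.ofReal p) μ) (S : Finset ℤ) :
    ∑ k ∈ S, (2 : ℝ) ^ (-((k : ℝ) * (2 - p))) * ∫ x, ‖levelPart f k x‖ ^ 2 ∂μ ≤
      2 ^ (2 - p) * ∫ x, ‖f x‖ ^ p ∂μ := by
  refine le_trans ?_ (mul_le_mul_of_nonneg_left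
    (sum_integral_norm_levelPart_rpow_le hp hfp S) (by positivity))
  rw [Finset.mul_sum]
  refine Finset.sum_le_sum fun k _ ↦ ?_
  rw [← integral_const_mul, ← integral_const_mul]
  exact integral_mono (((memLp_levelPart hf k).integrable_norm_pow two_ne_zero).const_mul _)
    ((integrable_norm_rpow_of_memLp hp (memLp_levelPart hfp k)).const_mul _)
    fun x ↦ two_rpow_mul_norm_levelPart_sq_le f hp2 k x

end LevelParts

noncomputable section Interpolation

open scoped ComplexConjugate

variable {n : ℕ} {γ p : ℝ}

theorem tendsto_fourierInt_of_dominated {ι : Type*} {l : Filter ι} [l.IsCountablyGenerated]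
    {F : ι → E n → ℂ} {f : E n → ℂ} (hF : ∀ i, Integrable (F i)) (hf : Integrable f)
    (hle : ∀ i x, ‖F i x‖ ≤ ‖f x‖) (hlim : ∀ x, Tendsto (fun i ↦ F i x) l (𝓝 (f x))) (ξ : E n) :
    Tendsto (fun i ↦ fourierInt (F i) ξ) l (𝓝 (fourierInt f ξ)) := by
  refine tendsto_integral_filter_of_dominated_convergence (fun x ↦ ‖f x‖)
    (Eventually.of_forall fun i ↦ (integrable_fourierChar_mul (hF i) ξ).aestronglyMeasurable)
    (Eventually.of_forall fun i ↦ Eventually.of_forall fun x ↦ ?_) hf.norm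
    (Eventually.of_forall fun x ↦ (hlim x).const_mul _)
  rw [norm_mul, norm_fourierChar_eq_one, one_mul]
  exact hle i x

theorem tendsto_fourierForm_of_dominated {ι : Type*} {l : Filter ι} [l.IsCountablyGenerated]
    {W f : E n → ℂ} {F : ι → E n → ℂ} (hW : Integrable W) (hF : ∀ i, Integrable (F i))
    (hf : Integrable f) (hle : ∀ i x, ‖F i x‖ ≤ ‖f x‖)
    (hlim : ∀ x, Tendsto (fun i ↦ F i x) l (𝓝 (f x))) :
    Tendsto (fun i ↦ fourierForm W (F i) (F i)) l (𝓝 (fourierForm W f f)) := by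
  have hbound : ∀ i ξ, ‖fourierInt (F i) ξ‖ ≤ ∫ x, ‖f x‖ := fun i ξ ↦
    (norm_fourierInt_le _ ξ).trans (integral_mono (hF i).norm hf.norm (hle i))
  refine tendsto_integral_filter_of_dominated_convergence
    (fun ξ ↦ ‖W ξ‖ * ((∫ x, ‖f x‖) * ∫ x, ‖f x‖))
    (Eventually.of_forall fun i ↦ (integrable_fourierForm hW (hF i) (hF i)).aestronglyMeasurable)
    (Eventually.of_forall fun i ↦ Eventually.of_forall fun ξ ↦ ?_) (hW.norm.mul_const _)
    (Eventually.of_forall fun ξ ↦ ?_)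
  · rw [norm_mul, norm_mul, RCLike.norm_conj]
    gcongr
    exacts [hbound i ξ, hbound i ξ]
  · have hξ := tendsto_fourierInt_of_dominated hF hf hle hlim ξ
    exact (hξ.mul ((Complex.continuous_conj.tendsto _).comp hξ)).const_mul _

theorem exists_sum_mul_shellIntegral_le (n : ℕ) {δ : ℝ} (hδ : 0 < δ) :
    ∃ C : ℝ, 0 ≤ C ∧ ∀ (S : Finset ℤ) (w : ℤ → ℝ) (g : ℤ → E n → ℂ),
      (∀ k, Integrable (g k)) → (∀ k, MemLp (g k) 2 volume) →
      ∑ k ∈ S, ∑ l ∈ S, w k * w l *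
          shellIntegral ((2 : ℝ) ^ (-(δ * ((k + l : ℤ) : ℝ)))) (g k) (g l) ≤
        C * ∑ k ∈ S, w k ^ 2 * ∫ x, ‖g k x‖ ^ 2 := by
  obtain ⟨C₁, hC₁, hgeom⟩ := exists_sum_minInv_le hδ
  obtain ⟨C₂, hC₂, hplancherel⟩ := exists_integral_fourierInt_sq_le n
  refine ⟨C₁ * C₂, by positivity, fun S w g hg hg2 ↦ ?_⟩
  have hgF : ∀ k, MemLp (fourierInt (g k)) 2 volume := fun k ↦ (hplancherel _ (hg k) (hg2 k)).1
  set x : ℤ → E n → ℝ := fun k ξ ↦ w k * ‖fourierInt (g k) ξ‖ with hx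
  set κ : E n → ℤ → ℝ := fun ξ k ↦ minInv ((2 : ℝ) ^ (-(δ * k)) * |1 - ‖ξ‖ ^ 2|)
  have hterm : ∀ k l ξ, κ ξ (k + l) * (x k ξ * x l ξ) =
      w k * w l * (κ ξ (k + l) * (‖fourierInt (g k) ξ‖ * ‖fourierInt (g l) ξ‖)) :=
    fun k l ξ ↦ by ring
  have hint : ∀ k l, Integrable fun ξ ↦ κ ξ (k + l) * (x k ξ * x l ξ) := fun k l ↦ by
    simp only [hterm]
    exact (integrable_shellIntegral (by positivity) (hgF k) (hgF l)).const_mul _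
  have hsq : ∀ k, Integrable fun ξ ↦ x k ξ ^ 2 := fun k ↦ by
    simp only [hx, mul_pow]
    exact ((hgF k).integrable_norm_pow two_ne_zero).const_mul _
  calc _ = ∑ k ∈ S, ∑ l ∈ S, ∫ ξ, κ ξ (k + l) * (x k ξ * x l ξ) := by
        simp only [hterm, integral_const_mul]
        rfl
    _ = ∫ ξ, ∑ k ∈ S, ∑ l ∈ S, κ ξ (k + l) * (x k ξ * x l ξ) := by
        rw [integral_finsetSum S fun k _ ↦ integrable_finsetSum S fun l _ ↦ hint k l]
        exact Finset.sum_congr rfl fun k _ ↦ (integral_finsetSum S fun l _ ↦ hint k l).symm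
    _ ≤ ∫ ξ, C₁ * ∑ k ∈ S, x k ξ ^ 2 :=
        integral_mono (integrable_finsetSum S fun k _ ↦ integrable_finsetSum S fun l _ ↦ hint k l)
          ((integrable_finsetSum S fun k _ ↦ hsq k).const_mul _) fun ξ ↦
            sum_mul_mul_le_of_sum_le (fun k ↦ shellWeight_nonneg (by positivity) ξ)
              (fun S' ↦ hgeom S' _ (abs_nonneg _)) S fun k ↦ x k ξ
    _ = C₁ * ∑ k ∈ S, w k ^ 2 * ∫ ξ, ‖fourierInt (g k) ξ‖ ^ 2 := by
        rw [integral_const_mul, integral_finsetSum S fun k _ ↦ hsq k]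
        simp only [hx, mul_pow, integral_const_mul]
    _ ≤ C₁ * ∑ k ∈ S, w k ^ 2 * (C₂ * ∫ x, ‖g k x‖ ^ 2) := by
        gcongr with k _
        exact (hplancherel _ (hg k) (hg2 k)).2
    _ = C₁ * C₂ * ∑ k ∈ S, w k ^ 2 * ∫ x, ‖g k x‖ ^ 2 := by
        simp only [mul_left_comm _ C₂, ← Finset.mul_sum, mul_assoc]

theorem sum_sum_mul_integral_norm_levelPart_le {f : E n → ℂ} (hp : 1 ≤ p) (hf : Integrable f)
    (hfp : MemLp f (ENNReal.ofReal p) volume) (S : Finset ℤ) :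
    ∑ k ∈ S, ∑ l ∈ S, (2 : ℝ) ^ ((k : ℝ) * (p - 1)) * 2 ^ ((l : ℝ) * (p - 1)) *
        ((∫ x, ‖levelPart f k x‖) * ∫ x, ‖levelPart f l x‖) ≤ (∫ x, ‖f x‖ ^ p) ^ 2 := by
  simp only [mul_mul_mul_comm _ _ (∫ x, ‖levelPart f _ x‖), ← Finset.sum_mul_sum, ← sq]
  exact pow_le_pow_left₀ (Finset.sum_nonneg fun k _ ↦ mul_nonneg (by positivity)
    (integral_nonneg fun _ ↦ norm_nonneg _))
    (sum_two_rpow_mul_integral_norm_levelPart_le hp hf hfp S) 2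

theorem exists_sum_sum_mul_shellIntegral_levelPart_le (n : ℕ) {δ : ℝ} (hδ : 0 < δ) (hp : 0 < p)
    (hp2 : p ≤ 2) :
    ∃ C : ℝ, 0 ≤ C ∧ ∀ (f : E n → ℂ) (S : Finset ℤ), Integrable f → MemLp f 2 volume →
      MemLp f (ENNReal.ofReal p) volume →
      ∑ k ∈ S, ∑ l ∈ S, (2 : ℝ) ^ (-((k : ℝ) * ((2 - p) / 2))) * 2 ^ (-((l : ℝ) * ((2 - p) / 2))) *
          shellIntegral ((2 : ℝ) ^ (-(δ * ((k + l : ℤ) : ℝ)))) (levelPart f k) (levelPart f l) ≤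
        C * ∫ x, ‖f x‖ ^ p := by
  obtain ⟨C, hC, hle⟩ := exists_sum_mul_shellIntegral_le n hδ
  refine ⟨C * 2 ^ (2 - p), by positivity, fun f S hf hf2 hfp ↦ ?_⟩
  refine (hle S _ _ (integrable_levelPart hf) (memLp_levelPart hf2)).trans ?_
  rw [mul_assoc]
  refine mul_le_mul_of_nonneg_left ((Finset.sum_congr rfl fun k _ ↦ ?_).trans_le
    (sum_two_rpow_mul_integral_norm_levelPart_sq_le hp hp2 hf2 hfp S)) hC
  rw [← Real.rpow_mul_natCast zero_le_two]
  push_cast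
  ring_nf

/- In the pair bound for the `k`-th and `l`-th level parts, the scale `T = 2 ^ (-δ (k + l))` with
`2 (γ + 1) δ = 2 - p` and `δ a = p - 1` turns the two terms into `L²` and `L¹` sums that are both
controlled by `∫ ‖f‖ ^ p`; the hypothesis on `p` says exactly that this `a` is admissible. -/
theorem IsSymbol.exists_norm_fourierForm_levelPart_le (n : ℕ) (hγ : 0 < γ) (hp : 1 < p)
    (hp' : p * ((n : ℝ) + 3 + 2 * γ) ≤ 2 * n + 2) :
    ∃ C δ : ℝ, 0 ≤ C ∧ 0 < δ ∧ ∀ (h h' : ℝ → ℝ) (H : ℝ) (f : E n → ℂ) (k l : ℤ),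
      IsSymbol h h' γ H → Integrable f → MemLp f 2 volume →
      ‖fourierForm (formSymbol n h) (levelPart f k) (levelPart f l)‖ ≤
        C * H * ((2 : ℝ) ^ (-((k : ℝ) * ((2 - p) / 2))) * 2 ^ (-((l : ℝ) * ((2 - p) / 2))) *
          shellIntegral ((2 : ℝ) ^ (-(δ * ((k + l : ℤ) : ℝ)))) (levelPart f k) (levelPart f l) +
        2 ^ ((k : ℝ) * (p - 1)) * 2 ^ ((l : ℝ) * (p - 1)) *
          ((∫ x, ‖levelPart f k x‖) * ∫ x, ‖levelPart f l x‖)) := by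
  have hp2 : 0 < 2 - p := by nlinarith [Nat.cast_nonneg (α := ℝ) n]
  set a : ℝ := 2 * (γ + 1) * (p - 1) / (2 - p) with ha
  have ha0 : 0 ≤ a := div_nonneg (mul_nonneg (by linarith) (by linarith)) hp2.le
  have han : a ≤ ((n : ℝ) - 1) / 2 - γ := by
    rw [ha, div_le_iff₀ hp2]
    linarith
  set δ : ℝ := (2 - p) / (2 * (γ + 1)) with hδ
  have hδa : δ * a = p - 1 := by
    rw [hδ, ha]
    field_simp
  have hδγ : δ * (γ + 1) = (2 - p) / 2 := by
    rw [hδ]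
    field_simp
  obtain ⟨C, hC, hpair⟩ := IsSymbol.exists_norm_fourierForm_le n hγ ha0 han
  obtain ⟨_, _, hplancherel⟩ := exists_integral_fourierInt_sq_le n
  refine ⟨C, δ, hC, div_pos hp2 (by linarith), fun h h' H f k l hs hf hf2 ↦ ?_⟩
  have hg : ∀ k, Integrable (levelPart f k) := integrable_levelPart hf
  have hgF : ∀ k, MemLp (fourierInt (levelPart f k)) 2 volume := fun k ↦
    (hplancherel _ (hg k) (memLp_levelPart hf2 k)).1
  convert hpair h h' H ((2 : ℝ) ^ (-(δ * ((k + l : ℤ) : ℝ)))) _ _ hs (by positivity) (hg k) (hg l)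
    (hgF k) (hgF l) using 4
  · rw [← Real.rpow_mul zero_le_two, ← Real.rpow_add two_pos, ← hδγ]
    push_cast
    ring_nf
  · rw [← Real.rpow_mul zero_le_two, ← Real.rpow_add two_pos, ← hδa]
    push_cast
    ring_nf

theorem IsSymbol.exists_norm_fourierForm_le_add_sq (n : ℕ) (hγ : 0 < γ) (hp : 1 < p)
    (hp' : p * ((n : ℝ) + 3 + 2 * γ) ≤ 2 * n + 2) :
    ∃ C : ℝ, 0 ≤ C ∧ ∀ (h h' : ℝ → ℝ) (H : ℝ) (f : E n → ℂ),
      IsSymbol h h' γ H → Integrable f → MemLp f 2 volume → MemLp f (ENNReal.ofReal p) volume →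
      ‖fourierForm (formSymbol n h) f f‖ ≤
        C * H * ((∫ x, ‖f x‖ ^ p) + (∫ x, ‖f x‖ ^ p) ^ 2) := by
  have hp0 : 0 < p := by linarith
  have hp2 : p ≤ 2 := by nlinarith [Nat.cast_nonneg (α := ℝ) n]
  obtain ⟨C₁, δ, hC₁, hδ, hpair⟩ := IsSymbol.exists_norm_fourierForm_levelPart_le n hγ hp hp'
  obtain ⟨C₂, hC₂, hshell⟩ := exists_sum_sum_mul_shellIntegral_levelPart_le n hδ hp0 hp2
  refine ⟨C₁ * (C₂ + 1), by positivity, fun h h' H f hs hf hf2 hfp ↦ ?_⟩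
  have hH := hs.nonneg
  have hW := integrable_formSymbol (n := n) hs.integrableOn
  set P := ∫ x, ‖f x‖ ^ p
  have hP : 0 ≤ P := integral_nonneg fun _ ↦ by positivity
  refine le_of_tendsto (tendsto_fourierForm_of_dominated hW
    (fun S ↦ integrable_finsetSum S fun k _ ↦ integrable_levelPart hf k) hf
    (norm_sum_levelPart_le f) (tendsto_sum_levelPart f)).norm (Eventually.of_forall fun S ↦ ?_)
  rw [fourierForm_finsetSum S hW fun k _ ↦ integrable_levelPart hf k]
  calc _ ≤ ∑ k ∈ S, ∑ l ∈ S, ‖fourierForm (formSymbol n h) (levelPart f k) (levelPart f l)‖ :=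
        (norm_sum_le _ _).trans (Finset.sum_le_sum fun k _ ↦ norm_sum_le _ _)
    _ ≤ _ := Finset.sum_le_sum fun k _ ↦ Finset.sum_le_sum fun l _ ↦ hpair h h' H f k l hs hf hf2
    _ ≤ C₁ * H * (C₂ * P + P ^ 2) := by
        simp only [← Finset.mul_sum, Finset.sum_add_distrib]
        gcongr
        exacts [hshell f S hf hf2 hfp, sum_sum_mul_integral_norm_levelPart_le hp.le hf hfp S]
    _ ≤ C₁ * H * ((C₂ + 1) * (P + P ^ 2)) := by
        gcongr
        nlinarith [mul_nonneg hC₂ (sq_nonneg P)]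
    _ = _ := by ring

theorem fourierInt_const_mul (c : ℂ) (f : E n → ℂ) (ξ : E n) :
    fourierInt (fun x ↦ c * f x) ξ = c * fourierInt f ξ := by
  simp only [fourierInt, mul_left_comm _ c, integral_const_mul]

theorem fourierForm_const_mul (W f g : E n → ℂ) (c : ℝ) :
    fourierForm W (fun x ↦ c * f x) (fun x ↦ c * g x) =
      ((c ^ 2 : ℝ) : ℂ) * fourierForm W f g := by
  simp only [fourierForm, fourierInt_const_mul, map_mul, Complex.conj_ofReal, ← integral_const_mul]
  congr with ξ
  push_cast
  ring

theorem le_two_mul_rpow_of_forall_pos {P Q B : ℝ} (hP : 0 ≤ P) (hB : 0 ≤ B) (hp : 0 < p)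
    (hQ : ∀ c > 0, c ^ 2 * Q ≤ B * (c ^ p * P + (c ^ p * P) ^ 2)) :
    Q ≤ 2 * B * P ^ (2 / p) := by
  rcases hP.eq_or_lt with rfl | hpos
  · have := hQ 1 one_pos
    refine le_trans ?_ (show 0 ≤ 2 * B * (0 : ℝ) ^ (2 / p) by positivity)
    simpa using this
  · have hcp : (P ^ (-(1 / p))) ^ p * P = 1 := by
      rw [← Real.rpow_mul hP, show -(1 / p) * p = -1 by field_simp, Real.rpow_neg_one,
        inv_mul_cancel₀ hpos.ne']
    have hc2 : P ^ (2 / p) * (P ^ (-(1 / p))) ^ 2 = 1 := by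
      rw [← Real.rpow_mul_natCast hP, ← Real.rpow_add hpos]
      simp [div_eq_mul_inv, mul_comm]
    have := hQ (P ^ (-(1 / p))) (by positivity)
    rw [hcp] at this
    calc Q = P ^ (2 / p) * ((P ^ (-(1 / p))) ^ 2 * Q) := by rw [← mul_assoc, hc2, one_mul]
      _ ≤ P ^ (2 / p) * (B * (1 + 1 ^ 2)) := by gcongr
      _ = 2 * B * P ^ (2 / p) := by ring

/- The left side is homogeneous of degree `2` in `f`, so the inhomogeneous bound of
`IsSymbol.exists_norm_fourierForm_le_add_sq` may be applied to the multiple of `f` of norm `1`. -/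
theorem IsSymbol.exists_norm_fourierForm_le_rpow (n : ℕ) (hγ : 0 < γ) (hp : 1 ≤ p)
    (hp' : p * ((n : ℝ) + 3 + 2 * γ) ≤ 2 * n + 2) :
    ∃ C : ℝ, 0 ≤ C ∧ ∀ (h h' : ℝ → ℝ) (H : ℝ) (f : E n → ℂ),
      IsSymbol h h' γ H → Integrable f → MemLp f 2 volume → MemLp f (ENNReal.ofReal p) volume →
      ‖fourierForm (formSymbol n h) f f‖ ≤ C * H * (∫ x, ‖f x‖ ^ p) ^ (2 / p) := by
  rcases hp.eq_or_lt with rfl | hp1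
  · obtain ⟨C, hC, hle⟩ := IsSymbol.exists_norm_halfKernel_le (d := (n : ℝ) / 2) (by positivity)
      hγ.le (by linarith)
    refine ⟨C, hC, fun h h' H f hs hf _ _ ↦ ?_⟩
    convert norm_fourierForm_formSymbol_le hs.integrableOn hf hf fun r hr ↦ hle h h' H r hr hs
    simp only [Real.rpow_one, div_one, Real.rpow_ofNat, sq]
  obtain ⟨C, hC, hle⟩ := IsSymbol.exists_norm_fourierForm_le_add_sq n hγ hp1 hp'
  refine ⟨2 * C, by positivity, fun h h' H f hs hf hf2 hfp ↦ ?_⟩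
  rw [mul_assoc 2]
  refine le_two_mul_rpow_of_forall_pos (integral_nonneg fun _ ↦ by positivity)
    (mul_nonneg hC hs.nonneg) (by linarith) fun c hc ↦ ?_
  have hnorm : ∫ x, ‖(c : ℂ) * f x‖ ^ p = c ^ p * ∫ x, ‖f x‖ ^ p := by
    simp only [norm_mul, Complex.norm_real, Real.norm_of_nonneg hc.le,
      Real.mul_rpow hc.le (norm_nonneg _), integral_const_mul]
  have hform := hle h h' H (fun x ↦ c * f x) hs (hf.const_mul _) (hf2.const_mul _) (hfp.const_mul _)
  rwa [fourierForm_const_mul, norm_mul, Complex.norm_real, Real.norm_of_nonneg (by positivity),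
    hnorm] at hform

end Interpolation

noncomputable section DyadicWeights

variable {γ : ℝ}

theorem mul_exp_neg_le_min {x : ℝ} (hx : 0 ≤ x) : x * Real.exp (-x) ≤ min 1 x := by
  refine le_min ?_ (mul_le_of_le_one_right hx (Real.exp_le_one_iff.2 (by linarith)))
  rw [Real.exp_neg, ← div_eq_mul_inv, div_le_one (Real.exp_pos x)]
  linarith [Real.add_one_le_exp x]

theorem abs_exp_neg_sub_exp_neg_le_min {x y : ℝ} (hy : 0 ≤ y) (hyx : y ≤ x) :
    |Real.exp (-y) - Real.exp (-x)| ≤ min 1 x := by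
  have hle : Real.exp (-x) ≤ Real.exp (-y) := Real.exp_le_exp.2 (by linarith)
  have hone : Real.exp (-y) ≤ 1 := Real.exp_le_one_iff.2 (by linarith)
  rw [abs_of_nonneg (by linarith)]
  exact le_min (by linarith [Real.exp_pos (-x)]) (by linarith [Real.add_one_le_exp (-x)])

theorem abs_mul_exp_neg_sub_le_min {x y : ℝ} (hy : 0 ≤ y) (hyx : y ≤ x) :
    |x * Real.exp (-x) - y * Real.exp (-y)| ≤ min 1 x :=
  abs_sub_le_of_nonneg_of_le (mul_nonneg (hy.trans hyx) (Real.exp_pos _).le)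
    (mul_exp_neg_le_min (hy.trans hyx)) (mul_nonneg hy (Real.exp_pos _).le)
    ((mul_exp_neg_le_min hy).trans (min_le_min_left 1 hyx))

theorem exp_mul_min_one_exp_le (γ v : ℝ) :
    Real.exp (γ * v) * min 1 (Real.exp (-(2 * v))) ≤ Real.exp (-(min γ (2 - γ) * |v|)) := by
  rcases le_total 0 v with hv | hv
  · calc _ ≤ Real.exp (γ * v) * Real.exp (-(2 * v)) := by
          gcongr
          exact min_le_right _ _
      _ = Real.exp (-((2 - γ) * v)) := by
          rw [← Real.exp_add]
          ring_nf
      _ ≤ _ := by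
          rw [abs_of_nonneg hv]
          gcongr
          exact min_le_right _ _
  · calc _ ≤ Real.exp (γ * v) * 1 := by
          gcongr
          exact min_le_left _ _
      _ = Real.exp (-(γ * -v)) := by rw [mul_one, mul_neg, neg_neg]
      _ ≤ _ := by
          rw [abs_of_nonpos hv]
          gcongr
          · linarith
          · exact min_le_left _ _

/-- The rate `4⁻⁽ⁱ⁺¹⁾`, chosen so that the cosine transform of the Gaussian
`e^{-quarterScale i t²}` is a multiple of `2ⁱ e^{-4ⁱ s²}`. -/
def quarterScale (i : ℕ) : ℝ := ((4 : ℝ) ^ (i + 1))⁻¹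

theorem quarterScale_pos (i : ℕ) : 0 < quarterScale i := by
  unfold quarterScale
  positivity

theorem quarterScale_antitone : Antitone quarterScale := fun _ _ h ↦
  inv_anti₀ (by positivity) (pow_le_pow_right₀ (by norm_num) (by lia))

theorem quarterScale_mul_sq_le {t : ℝ} (ht : 0 < t) (i : ℕ) :
    quarterScale i * t ^ 2 ≤ Real.exp (-(2 * (Real.log 2 * i - Real.log t))) := by
  have hexp : Real.exp (-(2 * (Real.log 2 * i - Real.log t))) = ((4 : ℝ) ^ i)⁻¹ * t ^ 2 := by
    rw [show -(2 * (Real.log 2 * i - Real.log t)) = -(i * Real.log 4) + 2 * Real.log t by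
      rw [show (4 : ℝ) = 2 ^ 2 by norm_num, Real.log_pow]
      push_cast
      ring, Real.exp_add, Real.exp_neg, Real.exp_nat_mul, Real.exp_log (by norm_num),
      two_mul (Real.log t), Real.exp_add, Real.exp_log ht, ← sq]
  rw [hexp, quarterScale]
  gcongr
  · norm_num
  · lia

theorem exists_sum_min_quarterScale_le (hγ : 0 < γ) (hγ2 : γ < 2) :
    ∃ C : ℝ, 0 ≤ C ∧ ∀ (N : ℕ) (t : ℝ), 0 < t →
      ∑ i ∈ Finset.range N, (2 : ℝ) ^ (γ * i) * min 1 (quarterScale i * t ^ 2) ≤ C * t ^ γ := by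
  set κ := min γ (2 - γ)
  have hκ : 0 < κ := lt_min hγ (by linarith)
  obtain ⟨C, hC, hsum⟩ := exists_sum_exp_neg_abs_le (mul_pos hκ (Real.log_pos one_lt_two))
  refine ⟨C, hC, fun N t ht ↦ ?_⟩
  have hterm : ∀ i : ℕ, (2 : ℝ) ^ (γ * i) * min 1 (quarterScale i * t ^ 2) ≤
      Real.exp (-|κ * Real.log 2 * ((i : ℤ) : ℝ) - κ * Real.log t|) * t ^ γ := fun i ↦ by
    set v : ℝ := Real.log 2 * i - Real.log t with hv
    have hpow : (2 : ℝ) ^ (γ * i) = Real.exp (γ * v) * t ^ γ := by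
      rw [Real.rpow_def_of_pos two_pos, Real.rpow_def_of_pos ht, ← Real.exp_add, hv]
      ring_nf
    have habs : |κ * Real.log 2 * ((i : ℤ) : ℝ) - κ * Real.log t| = κ * |v| := by
      rw [Int.cast_natCast, mul_assoc, ← mul_sub, abs_mul, abs_of_pos hκ]
    calc _ ≤ Real.exp (γ * v) * t ^ γ * min 1 (Real.exp (-(2 * v))) := by
          rw [hpow]
          gcongr
          exact quarterScale_mul_sq_le ht i
      _ = Real.exp (γ * v) * min 1 (Real.exp (-(2 * v))) * t ^ γ := mul_right_comm _ _ _
      _ ≤ _ := by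
          rw [habs]
          gcongr
          exact exp_mul_min_one_exp_le γ v
  calc _ ≤ ∑ i ∈ Finset.range N,
        Real.exp (-|κ * Real.log 2 * ((i : ℤ) : ℝ) - κ * Real.log t|) * t ^ γ :=
        Finset.sum_le_sum fun i _ ↦ hterm i
    _ = (∑ k ∈ (Finset.range N).map Nat.castEmbedding,
        Real.exp (-|κ * Real.log 2 * ((k : ℤ) : ℝ) - κ * Real.log t|)) * t ^ γ := by
        simp only [Finset.sum_map, Finset.sum_mul, Nat.castEmbedding_apply]
    _ ≤ _ := by
        gcongr
        exact hsum _ _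

/-- A sum of differences of Gaussians, comparable to `t ^ γ` for `t` up to about `2 ^ N` when
`m` is large. Each term vanishes at `t = 0`, which makes the whole sum an `IsSymbol` of order `γ`
uniformly in `N ≤ m`, and its cosine transform is `-dyadicWeight γ N` up to a bump of width
`2 ^ (-m)`. -/
def gaussDiff (γ : ℝ) (N m : ℕ) (t : ℝ) : ℝ :=
  ∑ i ∈ Finset.range N, (2 : ℝ) ^ (γ * i) *
    (Real.exp (-(quarterScale m * t ^ 2)) - Real.exp (-(quarterScale i * t ^ 2)))

/-- The derivative of `gaussDiff γ N m`. -/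
def gaussDiffDeriv (γ : ℝ) (N m : ℕ) (t : ℝ) : ℝ :=
  ∑ i ∈ Finset.range N, (2 : ℝ) ^ (γ * i) *
    (2 * t * (quarterScale i * Real.exp (-(quarterScale i * t ^ 2)) -
      quarterScale m * Real.exp (-(quarterScale m * t ^ 2))))

theorem hasDerivAt_gaussDiff (γ : ℝ) (N m : ℕ) (t : ℝ) :
    HasDerivAt (gaussDiff γ N m) (gaussDiffDeriv γ N m t) t := by
  have hgauss : ∀ c : ℝ, HasDerivAt (fun t : ℝ ↦ Real.exp (-(c * t ^ 2)))
      (Real.exp (-(c * t ^ 2)) * -(c * (2 * t))) t := fun c ↦ by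
    simpa using ((hasDerivAt_pow 2 t).const_mul c).neg.exp
  refine HasDerivAt.fun_sum fun i _ ↦ ?_
  refine (((hgauss (quarterScale m)).fun_sub (hgauss (quarterScale i))).const_mul _).congr_deriv ?_
  ring

theorem abs_gaussDiff_le {N m : ℕ} (hNm : N ≤ m) (γ t : ℝ) :
    |gaussDiff γ N m t| ≤
      ∑ i ∈ Finset.range N, (2 : ℝ) ^ (γ * i) * min 1 (quarterScale i * t ^ 2) := by
  refine (Finset.abs_sum_le_sum_abs _ _).trans (Finset.sum_le_sum fun i hi ↦ ?_)
  have him : quarterScale m ≤ quarterScale i :=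
    quarterScale_antitone ((Finset.mem_range.1 hi).le.trans hNm)
  rw [abs_mul, abs_of_pos (by positivity)]
  gcongr
  exact abs_exp_neg_sub_exp_neg_le_min (mul_nonneg (quarterScale_pos m).le (sq_nonneg t))
    (by gcongr)

theorem abs_mul_gaussDiffDeriv_le {N m : ℕ} (hNm : N ≤ m) (γ t : ℝ) :
    |t * gaussDiffDeriv γ N m t| ≤
      2 * ∑ i ∈ Finset.range N, (2 : ℝ) ^ (γ * i) * min 1 (quarterScale i * t ^ 2) := by
  rw [gaussDiffDeriv, Finset.mul_sum, Finset.mul_sum]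
  refine (Finset.abs_sum_le_sum_abs _ _).trans (Finset.sum_le_sum fun i hi ↦ ?_)
  have him : quarterScale m ≤ quarterScale i :=
    quarterScale_antitone ((Finset.mem_range.1 hi).le.trans hNm)
  calc _ = |2 * 2 ^ (γ * i) *
        (quarterScale i * t ^ 2 * Real.exp (-(quarterScale i * t ^ 2)) -
          quarterScale m * t ^ 2 * Real.exp (-(quarterScale m * t ^ 2)))| := by ring_nf
    _ ≤ 2 * 2 ^ (γ * i) * min 1 (quarterScale i * t ^ 2) := by
        rw [abs_mul, abs_of_pos (by positivity)]
        gcongr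
        exact abs_mul_exp_neg_sub_le_min (mul_nonneg (quarterScale_pos m).le (sq_nonneg t))
          (by gcongr)
    _ = _ := mul_assoc _ _ _

theorem integrable_exp_neg_quarterScale_mul_sq (i : ℕ) :
    Integrable fun t : ℝ ↦ Real.exp (-(quarterScale i * t ^ 2)) := by
  simpa only [neg_mul] using integrable_exp_neg_mul_sq (quarterScale_pos i)

theorem integrable_gaussDiff (γ : ℝ) (N m : ℕ) : Integrable (gaussDiff γ N m) :=
  integrable_finsetSum _ fun i _ ↦ ((integrable_exp_neg_quarterScale_mul_sq m).sub
    (integrable_exp_neg_quarterScale_mul_sq i)).const_mul _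

theorem exists_isSymbol_gaussDiff (hγ : 0 < γ) (hγ2 : γ < 2) :
    ∃ H : ℝ, ∀ N m : ℕ, N ≤ m → IsSymbol (gaussDiff γ N m) (gaussDiffDeriv γ N m) γ H := by
  obtain ⟨C, hC, hsum⟩ := exists_sum_min_quarterScale_le hγ hγ2
  refine ⟨2 * C, fun N m hNm ↦ ⟨hasDerivAt_gaussDiff γ N m, ?_, fun t ht ↦ ?_, fun t ht ↦ ?_,
    (integrable_gaussDiff γ N m).integrableOn⟩⟩
  · unfold gaussDiffDeriv
    fun_prop
  · rcases ht.eq_or_lt with rfl | ht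
    · simp [gaussDiff, Real.zero_rpow hγ.ne']
    · calc _ ≤ C * t ^ γ := (abs_gaussDiff_le hNm γ t).trans (hsum N t ht)
        _ ≤ 2 * C * t ^ γ := by
          gcongr
          linarith
  · have hle := (abs_mul_gaussDiffDeriv_le hNm γ t).trans
      (mul_le_mul_of_nonneg_left (hsum N t ht) zero_le_two)
    rw [abs_mul, abs_of_pos ht] at hle
    rw [Real.rpow_sub_one ht.ne', mul_div_assoc', le_div_iff₀ ht]
    linarith

theorem re_halfMultiplier {h : ℝ → ℝ} (hi : IntegrableOn h (Set.Ioi 0)) (s : ℝ) :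
    (halfMultiplier h s).re = ∫ t in Set.Ioi (0 : ℝ), h t * Real.cos (t * s) := by
  rw [halfMultiplier, ← RCLike.re_eq_complex_re, ← integral_re (integrableOn_mul_cexp_mul_I hi s)]
  simp only [RCLike.re_eq_complex_re, Complex.re_ofReal_mul, Complex.exp_ofReal_mul_I_re]

theorem integral_exp_neg_mul_sq_mul_cos {c : ℝ} (hc : 0 < c) (s : ℝ) :
    ∫ t : ℝ, Real.exp (-(c * t ^ 2)) * Real.cos (t * s) =
      √(Real.pi / c) * Real.exp (-(s ^ 2 / (4 * c))) := by
  have hint : Integrable fun t : ℝ ↦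
      Complex.exp (I * s * t) * Complex.exp (-(c : ℂ) * (t : ℂ) ^ 2) := by
    refine (integrable_cexp_neg_mul_sq (b := c) (by simpa using hc)).bdd_mul (c := 1)
      (by fun_prop) (Eventually.of_forall fun t ↦ ?_)
    rw [mul_assoc, ← Complex.ofReal_mul, mul_comm, Complex.norm_exp_ofReal_mul_I]
  have hre : ∀ t : ℝ, (Complex.exp (I * s * t) * Complex.exp (-(c : ℂ) * (t : ℂ) ^ 2)).re =
      Real.exp (-(c * t ^ 2)) * Real.cos (t * s) := fun t ↦ by
    rw [show Complex.exp (-(c : ℂ) * (t : ℂ) ^ 2) = (Real.exp (-(c * t ^ 2)) : ℂ) by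
        push_cast
        ring_nf,
      show I * s * t = ((t * s : ℝ) : ℂ) * I by
        push_cast
        ring,
      mul_comm, Complex.re_ofReal_mul, Complex.exp_ofReal_mul_I_re]
  have hgauss : ((Real.pi : ℂ) / c) ^ (1 / 2 : ℂ) * Complex.exp (-(s : ℂ) ^ 2 / (4 * c)) =
      ((√(Real.pi / c) * Real.exp (-(s ^ 2 / (4 * c))) : ℝ) : ℂ) := by
    rw [Real.sqrt_eq_rpow, Complex.ofReal_mul, Complex.ofReal_cpow (by positivity), ← neg_div]
    push_cast
    rfl
  simp only [← hre, ← RCLike.re_eq_complex_re]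
  rw [integral_re hint, fourierIntegral_gaussian (by simpa using hc), hgauss,
    RCLike.re_eq_complex_re, Complex.ofReal_re]

theorem integral_Ioi_exp_neg_mul_sq_mul_cos {c : ℝ} (hc : 0 < c) (s : ℝ) :
    ∫ t in Set.Ioi (0 : ℝ), Real.exp (-(c * t ^ 2)) * Real.cos (t * s) =
      √(Real.pi / c) / 2 * Real.exp (-(s ^ 2 / (4 * c))) := by
  have heven : ∀ t : ℝ, Real.exp (-(c * |t| ^ 2)) * Real.cos (|t| * s) =
      Real.exp (-(c * t ^ 2)) * Real.cos (t * s) := fun t ↦ by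
    rcases abs_choice t with h | h <;> simp only [h, neg_sq, neg_mul, Real.cos_neg]
  have hfull := integral_comp_abs (f := fun t ↦ Real.exp (-(c * t ^ 2)) * Real.cos (t * s))
  simp only [heven, integral_exp_neg_mul_sq_mul_cos hc] at hfull
  linarith

theorem integral_Ioi_exp_neg_quarterScale_mul_sq_mul_cos (i : ℕ) (s : ℝ) :
    ∫ t in Set.Ioi (0 : ℝ), Real.exp (-(quarterScale i * t ^ 2)) * Real.cos (t * s) =
      √Real.pi * (2 ^ i * Real.exp (-(4 ^ i * s ^ 2))) := by
  have hsqrt : √(Real.pi / quarterScale i) = √Real.pi * (2 * 2 ^ i) := by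
    rw [quarterScale, div_inv_eq_mul, Real.sqrt_mul Real.pi_pos.le,
      show (4 : ℝ) ^ (i + 1) = (2 * 2 ^ i) ^ 2 by
        rw [← pow_succ', ← pow_mul, mul_comm, pow_mul]
        norm_num, Real.sqrt_sq (by positivity)]
  have hrate : s ^ 2 / (4 * quarterScale i) = 4 ^ i * s ^ 2 := by
    rw [quarterScale]
    field_simp
    ring
  rw [integral_Ioi_exp_neg_mul_sq_mul_cos (quarterScale_pos i), hsqrt, hrate]
  ring

/-- A sum of Gaussian bumps of width `2 ^ (-i)`, comparable to `|s| ^ (-(γ + 1))` for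
`2 ^ (-N) < |s| ≤ 1`. -/
def dyadicWeight (γ : ℝ) (N : ℕ) (s : ℝ) : ℝ :=
  ∑ i ∈ Finset.range N, (2 : ℝ) ^ (γ * i) * (2 ^ i * Real.exp (-(4 ^ i * s ^ 2)))

/-- The integral of `dyadicWeight γ N`, up to the factor `√π`. -/
def dyadicMass (γ : ℝ) (N : ℕ) : ℝ := ∑ i ∈ Finset.range N, (2 : ℝ) ^ (γ * i)

theorem dyadicWeight_nonneg (γ : ℝ) (N : ℕ) (s : ℝ) : 0 ≤ dyadicWeight γ N s :=
  Finset.sum_nonneg fun i _ ↦ by positivity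

theorem dyadicMass_nonneg (γ : ℝ) (N : ℕ) : 0 ≤ dyadicMass γ N :=
  Finset.sum_nonneg fun i _ ↦ by positivity

theorem continuous_dyadicWeight (γ : ℝ) (N : ℕ) : Continuous (dyadicWeight γ N) := by
  unfold dyadicWeight
  fun_prop

theorem re_halfMultiplier_gaussDiff (γ : ℝ) (N m : ℕ) (s : ℝ) :
    (halfMultiplier (gaussDiff γ N m) s).re =
      √Real.pi * (dyadicMass γ N * (2 ^ m * Real.exp (-(4 ^ m * s ^ 2))) - dyadicWeight γ N s) := by
  have hi : ∀ i, IntegrableOn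
      (fun t ↦ Real.exp (-(quarterScale i * t ^ 2)) * Real.cos (t * s)) (Set.Ioi 0) := fun i ↦
    ((integrable_exp_neg_quarterScale_mul_sq i).mul_bdd (c := 1) (by fun_prop)
      (Eventually.of_forall fun t ↦ Real.abs_cos_le_one _)).integrableOn
  rw [re_halfMultiplier (integrable_gaussDiff γ N m).integrableOn]
  simp only [gaussDiff, Finset.sum_mul, mul_assoc, sub_mul]
  rw [integral_finsetSum, dyadicMass, dyadicWeight, Finset.sum_mul, ← Finset.sum_sub_distrib,
    Finset.mul_sum]
  swap
  · exact fun i _ ↦ ((hi m).sub (hi i)).const_mul _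
  refine Finset.sum_congr rfl fun i _ ↦ ?_
  rw [integral_const_mul, integral_sub (hi m) (hi i),
    integral_Ioi_exp_neg_quarterScale_mul_sq_mul_cos,
    integral_Ioi_exp_neg_quarterScale_mul_sq_mul_cos]
  ring

/- Of the bumps in the sum, the one whose width is closest to `s` already suffices. -/
theorem rpow_neg_le_dyadicWeight {s : ℝ} {N : ℕ} (hγ : -1 ≤ γ) (hs1 : s ≤ 1)
    (hsN : (2 ^ N : ℝ)⁻¹ < s) :
    s ^ (-(γ + 1)) ≤ Real.exp 1 * 2 ^ (γ + 1) * dyadicWeight γ N s := by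
  have hs0 : 0 < s := lt_trans (by positivity) hsN
  obtain ⟨i, hi1, hi2⟩ :=
    exists_nat_pow_near ((one_le_inv₀ hs0).2 hs1) (one_lt_two (α := ℝ))
  have hiN : i < N := (pow_lt_pow_iff_right₀ (one_lt_two (α := ℝ))).1
    (hi1.trans_lt (inv_lt_of_inv_lt₀ (by positivity) hsN))
  have hexp : 1 ≤ Real.exp 1 * Real.exp (-(4 ^ i * s ^ 2)) := by
    have hle : (2 : ℝ) ^ i * s ≤ 1 := (le_mul_inv_iff₀ hs0).1 (by rwa [one_mul])
    rw [← Real.exp_add, Real.one_le_exp_iff, show (4 : ℝ) ^ i * s ^ 2 = (2 ^ i * s) ^ 2 by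
      rw [mul_pow, ← pow_mul, mul_comm i 2, pow_mul]
      norm_num]
    linarith [pow_le_one₀ (n := 2) (by positivity) hle]
  have hpow : s ^ (-(γ + 1)) ≤ 2 ^ (γ + 1) * (2 ^ (γ * i) * 2 ^ i) := by
    calc _ = s⁻¹ ^ (γ + 1) := by rw [Real.rpow_neg hs0.le, ← Real.inv_rpow hs0.le]
      _ ≤ ((2 : ℝ) * 2 ^ i) ^ (γ + 1) := by
          rw [← pow_succ']
          exact Real.rpow_le_rpow (by positivity) hi2.le (by linarith)
      _ = _ := by
          rw [Real.mul_rpow zero_le_two (by positivity), mul_comm γ,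
            Real.rpow_natCast_mul zero_le_two,
            ← Real.rpow_add_one (x := (2 : ℝ) ^ i) (by positivity)]
  calc s ^ (-(γ + 1)) ≤ s ^ (-(γ + 1)) * (Real.exp 1 * Real.exp (-(4 ^ i * s ^ 2))) :=
        le_mul_of_one_le_right (by positivity) hexp
    _ ≤ 2 ^ (γ + 1) * (2 ^ (γ * i) * 2 ^ i) * (Real.exp 1 * Real.exp (-(4 ^ i * s ^ 2))) := by
        gcongr
    _ = Real.exp 1 * 2 ^ (γ + 1) *
        (2 ^ (γ * i) * (2 ^ i * Real.exp (-(4 ^ i * s ^ 2)))) := by ring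
    _ ≤ _ := by
        gcongr
        exact Finset.single_le_sum
          (f := fun i : ℕ ↦ (2 : ℝ) ^ (γ * i) * (2 ^ i * Real.exp (-(4 ^ i * s ^ 2))))
          (fun i _ ↦ by positivity) (Finset.mem_range.2 hiN)

end DyadicWeights

noncomputable section SphereLimit

theorem integral_eq_integral_toSphere {V F : Type*} [NormedAddCommGroup V] [NormedSpace ℝ V]
    [FiniteDimensional ℝ V] [Nontrivial V] [MeasurableSpace V] [BorelSpace V]
    [NormedAddCommGroup F] [NormedSpace ℝ F] (μ : Measure V) [μ.IsAddHaarMeasure] {f : V → F}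
    (hf : Integrable f μ) :
    ∫ x, f x ∂μ = ∫ r in Set.Ioi (0 : ℝ), r ^ (Module.finrank ℝ V - 1) •
      ∫ ω : Metric.sphere (0 : V) 1, f (r • (ω : V)) ∂μ.toSphere := by
  have hmp := μ.measurePreserving_homeomorphUnitSphereProd
  have hemb := (homeomorphUnitSphereProd V).measurableEmbedding
  have hms : MeasurableSet ({0}ᶜ : Set V) := (measurableSet_singleton _).compl
  let Φ : Metric.sphere (0 : V) 1 × Set.Ioi (0 : ℝ) → F := fun z ↦ f (z.2.1 • z.1.1)
  have hΦ : ∀ x : ({0}ᶜ : Set V), Φ (homeomorphUnitSphereProd V x) = f x := fun x ↦ by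
    simp only [Φ, ← homeomorphUnitSphereProd_symm_apply_coe, Homeomorph.symm_apply_apply]
  have hint : Integrable Φ (μ.toSphere.prod (.volumeIoiPow (Module.finrank ℝ V - 1))) := by
    rw [← hmp.integrable_comp_emb hemb, show Φ ∘ homeomorphUnitSphereProd V = f ∘ Subtype.val from
      funext hΦ, ← integrableOn_iff_comap_subtypeVal hms]
    exact hf.integrableOn
  calc ∫ x, f x ∂μ = ∫ x : ({0}ᶜ : Set V), f x ∂(μ.comap (↑)) := by
        rw [integral_subtype_comap hms fun x ↦ f x, restrict_compl_singleton]
    _ = ∫ x, Φ (homeomorphUnitSphereProd V x) ∂(μ.comap (↑)) := by simp only [hΦ]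
    _ = ∫ z, Φ z ∂(μ.toSphere.prod (.volumeIoiPow (Module.finrank ℝ V - 1))) :=
        hmp.integral_comp hemb Φ
    _ = ∫ r : Set.Ioi (0 : ℝ), ∫ ω : Metric.sphere (0 : V) 1, f (r.1 • (ω : V)) ∂μ.toSphere
          ∂(.volumeIoiPow (Module.finrank ℝ V - 1)) := integral_prod_symm _ hint
    _ = _ := by
        unfold Measure.volumeIoiPow ENNReal.ofReal
        rw [integral_withDensity_eq_integral_smul
            (measurable_subtype_coe.pow_const _).real_toNNReal,
          integral_subtype_comap measurableSet_Ioi fun r ↦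
            Real.toNNReal (r ^ (Module.finrank ℝ V - 1)) •
              ∫ ω : Metric.sphere (0 : V) 1, f (r • (ω : V)) ∂μ.toSphere]
        refine setIntegral_congr_fun measurableSet_Ioi fun r hr ↦ ?_
        rw [NNReal.smul_def, Real.coe_toNNReal _ (pow_nonneg (le_of_lt hr) _)]

theorem integrable_peak_mul {G : ℝ → ℝ} {B c : ℝ} (hG : Continuous G) (hB : ∀ r, |G r| ≤ B)
    (hc : 0 < c) (a : ℝ) :
    Integrable fun r : ℝ ↦ c * Real.exp (-(c * (r - a)) ^ 2) * G r := by
  have hgauss : Integrable fun r : ℝ ↦ Real.exp (-(c * (r - a)) ^ 2) := by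
    simpa only [neg_mul, mul_pow] using
      (integrable_exp_neg_mul_sq (b := c ^ 2) (by positivity)).comp_sub_right a
  exact (hgauss.const_mul c).mul_bdd (c := B) hG.aestronglyMeasurable (Eventually.of_forall hB)

theorem integral_peak_mul (G : ℝ → ℝ) {c : ℝ} (hc : 0 < c) (a : ℝ) :
    ∫ r : ℝ, c * Real.exp (-(c * (r - a)) ^ 2) * G r =
      ∫ u : ℝ, Real.exp (-u ^ 2) * G (a + c⁻¹ * u) := by
  have hshift := integral_sub_right_eq_self (μ := volume)
    (fun r : ℝ ↦ c * Real.exp (-(c * r) ^ 2) * G (a + r)) a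
  have hscale := Measure.integral_comp_mul_left
    (fun u : ℝ ↦ Real.exp (-u ^ 2) * G (a + c⁻¹ * u)) c
  rw [abs_of_pos (by positivity), smul_eq_mul, eq_inv_mul_iff_mul_eq₀ hc.ne',
    ← integral_const_mul] at hscale
  simp only [add_sub_cancel] at hshift
  simp only [inv_mul_cancel_left₀ hc.ne', ← mul_assoc] at hscale
  rw [hshift, ← hscale]

theorem tendsto_integral_peak_mul {G : ℝ → ℝ} {B : ℝ} (hG : Continuous G) (hB : ∀ r, |G r| ≤ B)
    (a : ℝ) :
    Tendsto (fun c : ℝ ↦ ∫ r : ℝ, c * Real.exp (-(c * (r - a)) ^ 2) * G r) atTop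
      (𝓝 (√Real.pi * G a)) := by
  have hgauss : Integrable fun u : ℝ ↦ Real.exp (-u ^ 2) := by
    simpa using integrable_exp_neg_mul_sq (b := 1) one_pos
  have hlim : ∫ u : ℝ, Real.exp (-u ^ 2) * G a = √Real.pi * G a := by
    rw [integral_mul_const]
    simpa using congrArg (· * G a) (integral_gaussian 1)
  rw [← hlim]
  refine Tendsto.congr' ((eventually_gt_atTop 0).mono fun c hc ↦ (integral_peak_mul G hc a).symm) ?_
  refine tendsto_integral_filter_of_dominated_convergence (fun u ↦ Real.exp (-u ^ 2) * B)
    (Eventually.of_forall fun c ↦ by fun_prop)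
    (Eventually.of_forall fun c ↦ Eventually.of_forall fun u ↦ ?_) (hgauss.mul_const B)
    (Eventually.of_forall fun u ↦ Tendsto.const_mul _ ((hG.tendsto a).comp ?_))
  · rw [norm_mul, Real.norm_eq_abs, Real.norm_eq_abs, Real.abs_exp]
    gcongr
    exact hB _
  · simpa using (tendsto_inv_atTop_zero.mul_const u).const_add a

theorem exists_abs_pow_mul_exp_neg_sq_le (k : ℕ) :
    ∃ B : ℝ, ∀ r : ℝ, |r| ^ k * Real.exp (-r ^ 2) ≤ B := by
  refine ⟨k.factorial * Real.exp 1, fun r ↦ ?_⟩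
  have hpow : |r| ^ k ≤ k.factorial * Real.exp |r| := by
    rw [← div_le_iff₀' (by positivity)]
    exact Real.pow_div_factorial_le_exp |r| (abs_nonneg r) k
  calc |r| ^ k * Real.exp (-r ^ 2) ≤ k.factorial * Real.exp |r| * Real.exp (-r ^ 2) := by gcongr
    _ = k.factorial * Real.exp (|r| - r ^ 2) := by rw [mul_assoc, ← Real.exp_add, ← sub_eq_add_neg]
    _ ≤ _ := by
      gcongr
      nlinarith [sq_abs r, sq_nonneg (|r| - 1)]

variable {n : ℕ} {f : E n → ℂ}

theorem norm_fourierInt_sq_le (f : E n → ℂ) (ξ : E n) :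
    ‖fourierInt f ξ‖ ^ 2 ≤ (∫ x, ‖f x‖) ^ 2 := by
  gcongr
  exact norm_fourierInt_le f ξ

theorem integrable_exp_mul_fourierInt_sq (hf : Integrable f) :
    Integrable fun ξ : E n ↦ Real.exp (-‖ξ‖ ^ 2) * ‖fourierInt f ξ‖ ^ 2 := by
  refine integrable_exp_neg_norm_sq.mul_bdd (c := (∫ x, ‖f x‖) ^ 2)
    ((continuous_fourierInt hf).norm.pow 2).aestronglyMeasurable (Eventually.of_forall fun ξ ↦ ?_)
  rw [Real.norm_of_nonneg (sq_nonneg _)]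
  exact norm_fourierInt_sq_le f ξ

/-- The mass of `‖f̂‖²` in a Gaussian layer of width about `2⁻ᵐ` around the unit sphere. -/
def layerMass (f : E n → ℂ) (m : ℕ) : ℝ :=
  ∫ ξ, 2 ^ m * Real.exp (-(4 ^ m * (1 - ‖ξ‖ ^ 2) ^ 2)) *
    (Real.exp (-‖ξ‖ ^ 2) * ‖fourierInt f ξ‖ ^ 2)

theorem integrable_layer (hf : Integrable f) (m : ℕ) :
    Integrable fun ξ : E n ↦ 2 ^ m * Real.exp (-(4 ^ m * (1 - ‖ξ‖ ^ 2) ^ 2)) *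
      (Real.exp (-‖ξ‖ ^ 2) * ‖fourierInt f ξ‖ ^ 2) := by
  refine (integrable_exp_mul_fourierInt_sq hf).bdd_mul (c := 2 ^ m)
    (Continuous.aestronglyMeasurable (by fun_prop)) (Eventually.of_forall fun ξ ↦ ?_)
  rw [Real.norm_of_nonneg (by positivity)]
  exact mul_le_of_le_one_right (by positivity)
    (Real.exp_le_one_iff.2 (neg_nonpos.2 (by positivity)))

/-- The integral of `‖f̂‖²` over the sphere of radius `|r|`, in coordinates on the unit sphere. -/
def sphereMass (f : E n → ℂ) (r : ℝ) : ℝ :=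
  ∫ ω, ‖fourierInt f (r • (ω : E n))‖ ^ 2 ∂surfaceMeasure n

theorem sphereMass_nonneg (f : E n → ℂ) (r : ℝ) : 0 ≤ sphereMass f r :=
  integral_nonneg fun _ ↦ sq_nonneg _

theorem sphereMass_le (f : E n → ℂ) (r : ℝ) :
    sphereMass f r ≤ (∫ x, ‖f x‖) ^ 2 * (surfaceMeasure n).real Set.univ := by
  calc sphereMass f r ≤ ∫ _, (∫ x, ‖f x‖) ^ 2 ∂surfaceMeasure n :=
        integral_mono_of_nonneg (Eventually.of_forall fun _ ↦ sq_nonneg _) (integrable_const _)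
          (Eventually.of_forall fun _ ↦ norm_fourierInt_sq_le f _)
    _ = _ := by rw [integral_const, smul_eq_mul, mul_comm]

theorem continuous_sphereMass (hf : Integrable f) : Continuous (sphereMass f) := by
  have hcont := continuous_fourierInt hf
  refine continuous_of_dominated (bound := fun _ ↦ (∫ x, ‖f x‖) ^ 2)
    (fun r ↦ Continuous.aestronglyMeasurable (by fun_prop))
    (fun r ↦ Eventually.of_forall fun ω ↦ ?_) (integrable_const _)
    (Eventually.of_forall fun ω ↦ by fun_prop)
  rw [Real.norm_of_nonneg (sq_nonneg _)]
  exact norm_fourierInt_sq_le f _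

/-- The radial density of the measure `e^{-‖ξ‖²} ‖f̂ ξ‖² dξ`, extended evenly to `ℝ`. -/
def radialDensity (f : E n → ℂ) (r : ℝ) : ℝ :=
  |r| ^ (n - 1) * Real.exp (-r ^ 2) * sphereMass f r

theorem radialDensity_nonneg (f : E n → ℂ) (r : ℝ) : 0 ≤ radialDensity f r :=
  mul_nonneg (by positivity) (sphereMass_nonneg f r)

theorem continuous_radialDensity (hf : Integrable f) : Continuous (radialDensity f) := by
  have := continuous_sphereMass hf
  unfold radialDensity
  fun_prop

theorem exists_abs_radialDensity_le (f : E n → ℂ) : ∃ B : ℝ, ∀ r, |radialDensity f r| ≤ B := by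
  obtain ⟨B, hB⟩ := exists_abs_pow_mul_exp_neg_sq_le (n - 1)
  refine ⟨B * ((∫ x, ‖f x‖) ^ 2 * (surfaceMeasure n).real Set.univ), fun r ↦ ?_⟩
  rw [abs_of_nonneg (radialDensity_nonneg f r)]
  exact mul_le_mul (hB r) (sphereMass_le f r) (sphereMass_nonneg f r)
    ((by positivity : (0 : ℝ) ≤ _).trans (hB r))

theorem sq_two_pow_mul_sub_one_le {r : ℝ} (hr : 0 ≤ r) (m : ℕ) :
    (2 ^ m * (r - 1)) ^ 2 ≤ 4 ^ m * (1 - r ^ 2) ^ 2 := by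
  have hsq : (r - 1) ^ 2 ≤ (1 - r ^ 2) ^ 2 := by
    nlinarith [mul_nonneg (sq_nonneg (r - 1)) (by positivity : (0 : ℝ) ≤ r * (r + 2))]
  rw [mul_pow, ← pow_mul, mul_comm m 2, pow_mul, show (2 : ℝ) ^ 2 = 4 by norm_num]
  gcongr

theorem layerMass_le [NeZero n] (hf : Integrable f) (m : ℕ) :
    layerMass f m ≤ ∫ r : ℝ, 2 ^ m * Real.exp (-(2 ^ m * (r - 1)) ^ 2) * radialDensity f r := by
  obtain ⟨B, hB⟩ := exists_abs_radialDensity_le f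
  have hpeak := integrable_peak_mul (continuous_radialDensity hf) hB
    (by positivity : (0 : ℝ) < 2 ^ m) 1
  have hpolar : layerMass f m = ∫ r in Set.Ioi (0 : ℝ),
      2 ^ m * Real.exp (-(4 ^ m * (1 - r ^ 2) ^ 2)) * radialDensity f r := by
    rw [layerMass, integral_eq_integral_toSphere volume (integrable_layer hf m)]
    refine setIntegral_congr_fun measurableSet_Ioi fun r (hr : 0 < r) ↦ ?_
    simp only [norm_smul, norm_eq_of_mem_sphere, mul_one, Real.norm_of_nonneg hr.le,
      integral_const_mul, radialDensity, sphereMass, abs_of_pos hr, finrank_euclideanSpace,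
      Fintype.card_fin, smul_eq_mul]
    ring
  calc layerMass f m ≤ ∫ r in Set.Ioi (0 : ℝ),
        2 ^ m * Real.exp (-(2 ^ m * (r - 1)) ^ 2) * radialDensity f r := by
        rw [hpolar]
        refine integral_mono_of_nonneg (Eventually.of_forall fun r ↦
          mul_nonneg (by positivity) (radialDensity_nonneg f r)) hpeak.integrableOn ?_
        filter_upwards [ae_restrict_mem measurableSet_Ioi] with r (hr : 0 < r)
        have := radialDensity_nonneg f r
        gcongr
        exact sq_two_pow_mul_sub_one_le hr.le m
    _ ≤ _ := setIntegral_le_integral hpeak (Eventually.of_forall fun r ↦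
        mul_nonneg (by positivity) (radialDensity_nonneg f r))

theorem exists_tendsto_layerMass_le [NeZero n] (hf : Integrable f) :
    ∃ a : ℕ → ℝ, (∀ m, layerMass f m ≤ a m) ∧
      Tendsto a atTop (𝓝 (√Real.pi * (Real.exp (-1) * sphereMass f 1))) := by
  obtain ⟨B, hB⟩ := exists_abs_radialDensity_le f
  refine ⟨_, layerMass_le hf, ?_⟩
  have hlim := (tendsto_integral_peak_mul (continuous_radialDensity hf) hB 1).comp
    (tendsto_pow_atTop_atTop_of_one_lt (one_lt_two (α := ℝ)))
  have hone : radialDensity f 1 = Real.exp (-1) * sphereMass f 1 := by simp [radialDensity]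
  rwa [hone] at hlim

end SphereLimit

noncomputable section DyadicBound

variable {n : ℕ} {f : E n → ℂ} {γ : ℝ}

theorem integrable_dyadicWeight_mul (γ : ℝ) (N : ℕ) (hf : Integrable f) :
    Integrable fun ξ : E n ↦ dyadicWeight γ N (1 - ‖ξ‖ ^ 2) *
      (Real.exp (-‖ξ‖ ^ 2) * ‖fourierInt f ξ‖ ^ 2) := by
  simp only [dyadicWeight, Finset.sum_mul, mul_assoc ((2 : ℝ) ^ (γ * _))]
  exact integrable_finsetSum _ fun i _ ↦ (integrable_layer hf i).const_mul _

theorem re_fourierForm_gaussDiff (γ : ℝ) (N m : ℕ) (hf : Integrable f) :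
    (fourierForm (formSymbol n (gaussDiff γ N m)) f f).re =
      √Real.pi * (dyadicMass γ N * layerMass f m - ∫ ξ : E n, dyadicWeight γ N (1 - ‖ξ‖ ^ 2) *
        (Real.exp (-‖ξ‖ ^ 2) * ‖fourierInt f ξ‖ ^ 2)) := by
  rw [layerMass, ← integral_const_mul, ← integral_sub ((integrable_layer hf m).const_mul _)
    (integrable_dyadicWeight_mul γ N hf), ← integral_const_mul, fourierForm,
    ← RCLike.re_eq_complex_re,
    ← integral_re (integrable_fourierForm
      (integrable_formSymbol (integrable_gaussDiff γ N m).integrableOn) hf hf)]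
  refine integral_congr_ae (Eventually.of_forall fun ξ ↦ ?_)
  simp only [Complex.mul_conj, Complex.normSq_eq_norm_sq, RCLike.re_eq_complex_re,
    Complex.re_mul_ofReal, formSymbol, re_halfMultiplier_gaussDiff]
  ring

theorem exists_integral_dyadicWeight_le {p : ℝ} [NeZero n] (hγ : 0 < γ) (hγ2 : γ < 2)
    (hp : 1 ≤ p) (hp' : p * ((n : ℝ) + 3 + 2 * γ) ≤ 2 * n + 2) :
    ∃ C : ℝ, 0 ≤ C ∧ ∀ (N : ℕ) (f : E n → ℂ), Integrable f → MemLp f 2 volume →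
      MemLp f (ENNReal.ofReal p) volume →
      ∫ ξ : E n, dyadicWeight γ N (1 - ‖ξ‖ ^ 2) * (Real.exp (-‖ξ‖ ^ 2) * ‖fourierInt f ξ‖ ^ 2) ≤
        dyadicMass γ N * (√Real.pi * (Real.exp (-1) * sphereMass f 1)) +
          C * (∫ x, ‖f x‖ ^ p) ^ (2 / p) := by
  obtain ⟨C, hC, hform⟩ := IsSymbol.exists_norm_fourierForm_le_rpow n hγ hp hp'
  obtain ⟨H, hH⟩ := exists_isSymbol_gaussDiff hγ hγ2
  have hH0 := (hH 0 0 le_rfl).nonneg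
  have hpi : 0 < √Real.pi := Real.sqrt_pos.2 Real.pi_pos
  refine ⟨C * H / √Real.pi, by positivity, fun N f hf hf2 hfp ↦ ?_⟩
  obtain ⟨a, ha, hlim⟩ := exists_tendsto_layerMass_le hf
  refine ge_of_tendsto ((hlim.const_mul (dyadicMass γ N)).add_const _) ?_
  filter_upwards [eventually_ge_atTop N] with m hm
  have hre := (neg_le_abs _).trans
    ((Complex.abs_re_le_norm _).trans (hform _ _ H f (hH N m hm) hf hf2 hfp))
  rw [re_fourierForm_gaussDiff γ N m hf, ← mul_neg, neg_sub, ← le_div_iff₀' hpi] at hre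
  have hlayer := mul_le_mul_of_nonneg_left (ha m) (dyadicMass_nonneg γ N)
  rw [div_mul_eq_mul_div]
  linarith

end DyadicBound

noncomputable section Approximation

variable {X F : Type*} [NormedAddCommGroup F] {n : ℕ} {p : ℝ}

theorem norm_indicator_one_lt_le_rpow (hp : 1 ≤ p) (f : X → F) (x : X) :
    ‖{x | 1 < ‖f x‖}.indicator f x‖ ≤ ‖f x‖ ^ p := by
  rw [Set.indicator_apply]
  split_ifs with hx
  · exact Real.self_le_rpow_of_one_le (le_of_lt hx) hp
  · rw [norm_zero]
    positivity

theorem norm_indicator_le_one_sq_le_rpow (hp0 : 0 < p) (hp2 : p ≤ 2) (f : X → F) (x : X) :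
    ‖{x | 1 < ‖f x‖}ᶜ.indicator f x‖ ^ 2 ≤ ‖f x‖ ^ p := by
  rw [Set.indicator_apply]
  split_ifs with hx
  · rw [← Real.rpow_two]
    exact Real.rpow_le_rpow_of_exponent_ge' (norm_nonneg _) (not_lt.1 hx) hp0.le hp2
  · rw [norm_zero, zero_pow two_ne_zero]
    positivity

theorem exists_integrable_add_memLp_two [MeasurableSpace X] {μ : Measure X} {f : X → F}
    (hp : 1 ≤ p) (hp2 : p ≤ 2) (hf : MemLp f (ENNReal.ofReal p) μ) :
    ∃ f₁ f₂ : X → F, f₁ + f₂ = f ∧ Integrable f₁ μ ∧ MemLp f₂ 2 μ ∧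
      ∫ x, ‖f₁ x‖ ∂μ ≤ ∫ x, ‖f x‖ ^ p ∂μ ∧ ∫ x, ‖f₂ x‖ ^ 2 ∂μ ≤ ∫ x, ‖f x‖ ^ p ∂μ := by
  have hp0 : 0 < p := by linarith
  have hfp := integrable_norm_rpow_of_memLp hp0 hf
  have hlarge : NullMeasurableSet {x | 1 < ‖f x‖} μ :=
    nullMeasurableSet_lt aemeasurable_const hf.1.norm.aemeasurable
  have hm₁ := hf.1.indicator₀ hlarge
  have hm₂ := hf.1.indicator₀ hlarge.compl
  have hi₁ : Integrable ({x | 1 < ‖f x‖}.indicator f) μ :=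
    hfp.mono' hm₁ (Eventually.of_forall fun x ↦ norm_indicator_one_lt_le_rpow hp f x)
  have hi₂ : Integrable (fun x ↦ ‖{x | 1 < ‖f x‖}ᶜ.indicator f x‖ ^ 2) μ :=
    hfp.mono' (hm₂.norm.pow 2) (Eventually.of_forall fun x ↦ by
      rw [Real.norm_of_nonneg (sq_nonneg _)]
      exact norm_indicator_le_one_sq_le_rpow hp0 hp2 f x)
  exact ⟨_, _, Set.indicator_self_add_compl _ f, hi₁,
    (memLp_two_iff_integrable_sq_norm hm₂).2 hi₂,
    integral_mono hi₁.norm hfp (norm_indicator_one_lt_le_rpow hp f),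
    integral_mono hi₂ hfp (norm_indicator_le_one_sq_le_rpow hp0 hp2 f)⟩

theorem exists_isFourierTransform_norm_le (n : ℕ) (hp : 1 ≤ p) (hp2 : p ≤ 2) :
    ∃ C : ℝ≥0, ∀ f : E n → ℂ, MemLp f (ENNReal.ofReal p) volume → ∃ g₁ g₂ : E n → ℂ,
      IsFourierTransform f (fun ξ ↦ g₁ ξ + g₂ ξ) ∧ (∀ ξ, ‖g₁ ξ‖ ≤ ∫ x, ‖f x‖ ^ p) ∧
      MemLp g₂ 2 volume ∧ eLpNorm g₂ 2 volume ≤ C * ENNReal.ofReal √(∫ x, ‖f x‖ ^ p) := by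
  obtain ⟨C, hC⟩ := exists_isFourierTransform_of_memLp_two n
  refine ⟨C, fun f hf ↦ ?_⟩
  obtain ⟨f₁, f₂, rfl, hf₁, hf₂, hle₁, hle₂⟩ := exists_integrable_add_memLp_two hp hp2 hf
  obtain ⟨g₂, hg₂, hmem, hle⟩ := hC f₂ hf₂
  refine ⟨fourierInt f₁, g₂, (isFourierTransform_of_integrable hf₁).add hg₂,
    fun ξ ↦ (norm_fourierInt_le _ _).trans hle₁, hmem, hle.trans ?_⟩
  gcongr
  rw [ENNReal.le_ofReal_iff_toReal_le hf₂.2.ne (Real.sqrt_nonneg _)]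
  rw [integral_norm_sq_eq_of_memLp hf₂] at hle₂
  exact Real.le_sqrt_of_sq_le hle₂

theorem exists_subseq_tendsto_zero (hp : 1 ≤ p) (hp2 : p ≤ 2) {f g : ℕ → E n → ℂ}
    (hfg : ∀ k, IsFourierTransform (f k) (g k))
    (hf : ∀ k, MemLp (f k) (ENNReal.ofReal p) volume)
    (hf0 : Tendsto (fun k ↦ eLpNorm (f k) (ENNReal.ofReal p) volume) atTop (𝓝 0)) :
    ∃ ns : ℕ → ℕ, StrictMono ns ∧ ∀ᵐ ξ, Tendsto (fun k ↦ g (ns k) ξ) atTop (𝓝 0) := by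
  have hp0 : 0 < p := by linarith
  obtain ⟨C, hC⟩ := exists_isFourierTransform_norm_le n hp hp2
  choose g₁ g₂ hft hle₁ hmem₂ hle₂ using fun k ↦ hC _ (hf k)
  have hpow : Tendsto (fun k ↦ ∫ x, ‖f k x‖ ^ p) atTop (𝓝 0) := by
    simp only [fun k ↦ integral_norm_rpow_eq_of_memLp hp0 (hf k)]
    simpa [Real.zero_rpow hp0.ne'] using
      ((ENNReal.tendsto_toReal ENNReal.zero_ne_top).comp hf0).rpow_const (p := p) (Or.inr hp0.le)
  have hbound : Tendsto (fun k ↦ C * ENNReal.ofReal √(∫ x, ‖f k x‖ ^ p)) atTop (𝓝 0) := by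
    simpa using ENNReal.Tendsto.const_mul (a := (C : ℝ≥0∞))
      (ENNReal.tendsto_ofReal ((Real.continuous_sqrt.tendsto 0).comp hpow))
      (Or.inr ENNReal.coe_ne_top)
  have hg₂ : Tendsto (fun k ↦ eLpNorm (g₂ k - 0) 2 volume) atTop (𝓝 0) := by
    simp only [sub_zero]
    exact tendsto_of_tendsto_of_tendsto_of_le_of_le tendsto_const_nhds hbound
      (fun _ ↦ zero_le) hle₂
  obtain ⟨ns, hns, hae⟩ := (tendstoInMeasure_of_tendsto_eLpNorm two_ne_zero
    (fun k ↦ (hmem₂ k).1) aestronglyMeasurable_const hg₂).exists_seq_tendsto_ae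
  refine ⟨ns, hns, ?_⟩
  filter_upwards [hae, ae_all_iff.2 fun k ↦ (hfg k).ae_eq (hft k)] with ξ hξ heq
  have hg₁ : Tendsto (fun k ↦ g₁ (ns k) ξ) atTop (𝓝 0) :=
    squeeze_zero_norm (fun k ↦ hle₁ (ns k) ξ) (hpow.comp hns.tendsto_atTop)
  replace hξ : Tendsto (fun k ↦ g₂ (ns k) ξ) atTop (𝓝 0) := hξ
  simpa only [heq, add_zero] using hg₁.add hξ

theorem exists_subseq_tendsto_fourierInt (hp : 1 ≤ p) (hp2 : p ≤ 2) {f : E n → ℂ}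
    (hf : MemLp f (ENNReal.ofReal p) volume) {φ : ℕ → E n → ℂ} (hφ : ∀ k, Integrable (φ k))
    (hφp : ∀ k, MemLp (φ k) (ENNReal.ofReal p) volume)
    (hlim : Tendsto (fun k ↦ eLpNorm (fun x ↦ φ k x - f x) (ENNReal.ofReal p) volume) atTop
      (𝓝 0)) :
    ∃ g : E n → ℂ, IsFourierTransform f g ∧ AEStronglyMeasurable g volume ∧
      ∃ ns : ℕ → ℕ, StrictMono ns ∧
        ∀ᵐ ξ, Tendsto (fun k ↦ fourierInt (φ (ns k)) ξ) atTop (𝓝 (g ξ)) := by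
  obtain ⟨C, hC⟩ := exists_isFourierTransform_norm_le n hp hp2
  obtain ⟨g₁, g₂, hg, -⟩ := hC f hf
  obtain ⟨ns, hns, hae⟩ := exists_subseq_tendsto_zero hp hp2
    (fun k ↦ (isFourierTransform_of_integrable (hφ k)).sub hg) (fun k ↦ (hφp k).sub hf) hlim
  have hconv : ∀ᵐ ξ, Tendsto (fun k ↦ fourierInt (φ (ns k)) ξ) atTop (𝓝 (g₁ ξ + g₂ ξ)) :=
    hae.mono fun ξ hξ ↦ tendsto_sub_nhds_zero_iff.1 hξ
  exact ⟨_, hg, aestronglyMeasurable_of_tendsto_ae atTop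
    (fun k ↦ (continuous_fourierInt (hφ (ns k))).aestronglyMeasurable) hconv, ns, hns, hconv⟩

end Approximation

noncomputable section Extension

section MeasureSpace

variable {X F : Type*} [NormedAddCommGroup F] [MeasurableSpace X] {μ : Measure X}

theorem tendsto_toReal_eLpNorm {p : ℝ≥0∞} (hp : 1 ≤ p) {f : X → F} (hf : MemLp f p μ)
    {φ : ℕ → X → F} (hφ : ∀ k, MemLp (φ k) p μ)
    (hlim : Tendsto (fun k ↦ eLpNorm (φ k - f) p μ) atTop (𝓝 0)) :
    Tendsto (fun k ↦ (eLpNorm (φ k) p μ).toReal) atTop (𝓝 (eLpNorm f p μ).toReal) := by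
  have : Fact (1 ≤ p) := ⟨hp⟩
  simpa only [Lp.norm_toLp] using ((Lp.tendsto_Lp_iff_tendsto_eLpNorm'' φ hφ f hf).2 hlim).norm

theorem integral_norm_rpow_rpow_two_div {p : ℝ} (hp : 0 < p) {f : X → F}
    (hf : MemLp f (ENNReal.ofReal p) μ) :
    (∫ x, ‖f x‖ ^ p ∂μ) ^ (2 / p) = (eLpNorm f (ENNReal.ofReal p) μ).toReal ^ 2 := by
  rw [integral_norm_rpow_eq_of_memLp hp hf, ← Real.rpow_mul ENNReal.toReal_nonneg,
    mul_div_cancel₀ _ hp.ne', Real.rpow_two]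

theorem lintegral_le_of_ae_le_liminf {u : X → ℝ≥0∞} {v : ℕ → X → ℝ≥0∞} {a : ℕ → ℝ≥0∞}
    {A : ℝ≥0∞} (hv : ∀ k, AEMeasurable (v k) μ)
    (hu : ∀ᵐ x ∂μ, u x ≤ liminf (fun k ↦ v k x) atTop) (hle : ∀ k, ∫⁻ x, v k x ∂μ ≤ a k)
    (ha : Tendsto a atTop (𝓝 A)) : ∫⁻ x, u x ∂μ ≤ A :=
  calc ∫⁻ x, u x ∂μ ≤ ∫⁻ x, liminf (fun k ↦ v k x) atTop ∂μ := lintegral_mono_ae hu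
    _ ≤ liminf (fun k ↦ ∫⁻ x, v k x ∂μ) atTop := lintegral_liminf_le' hv
    _ ≤ liminf a atTop := liminf_le_liminf (Eventually.of_forall hle)
    _ = A := ha.liminf_eq

theorem eLpNorm_two_le_of_lintegral_sq_le {f : X → F} {K : ℝ≥0} {t : ℝ≥0∞}
    (h : ∫⁻ x, ‖f x‖ₑ ^ (2 : ℝ) ∂μ ≤ K * t ^ 2) :
    eLpNorm f 2 μ ≤ NNReal.sqrt K * t := by
  rw [eLpNorm_eq_lintegral_rpow_enorm_toReal two_ne_zero ENNReal.ofNat_ne_top,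
    ENNReal.toReal_ofNat, one_div, ENNReal.rpow_inv_le_iff zero_lt_two]
  rwa [ENNReal.rpow_two, mul_pow, ← ENNReal.coe_pow, NNReal.sq_sqrt]

end MeasureSpace

variable {n : ℕ} {α β γ p : ℝ}

theorem sphereMass_one {f : E n → ℂ} (hf : Integrable f) :
    sphereMass f 1 = (eLpNorm (fun ω : Metric.sphere (0 : E n) 1 ↦ fourierInt f (ω : E n)) 2
      (surfaceMeasure n)).toReal ^ 2 := by
  have hcont := continuous_fourierInt hf
  simp only [sphereMass, one_smul]
  exact integral_norm_sq_eq_of_memLp (MemLp.of_bound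
    (Continuous.aestronglyMeasurable (by fun_prop)) (∫ x, ‖f x‖)
    (Eventually.of_forall fun _ ↦ norm_fourierInt_le _ _))

theorem lintegral_dyadicWeight_mul_eq (γ : ℝ) (N : ℕ) {f : E n → ℂ} (hf : Integrable f) :
    ∫⁻ ξ, ENNReal.ofReal (dyadicWeight γ N (1 - ‖ξ‖ ^ 2) *
        (Real.exp (-‖ξ‖ ^ 2) * ‖fourierInt f ξ‖ ^ 2)) =
      ENNReal.ofReal (∫ ξ, dyadicWeight γ N (1 - ‖ξ‖ ^ 2) *
        (Real.exp (-‖ξ‖ ^ 2) * ‖fourierInt f ξ‖ ^ 2)) :=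
  (ofReal_integral_eq_lintegral_ofReal (integrable_dyadicWeight_mul γ N hf)
    (Eventually.of_forall fun _ ↦ mul_nonneg (dyadicWeight_nonneg _ _ _) (by positivity))).symm

theorem exists_lintegral_dyadicWeight_le [NeZero n] (hγ : 0 < γ) (hγ2 : γ < 2) (hp : 1 ≤ p)
    (hp' : p * ((n : ℝ) + 3 + 2 * γ) ≤ 2 * n + 2) :
    ∃ C : ℝ≥0, ∀ f : E n → ℂ, MemLp f (ENNReal.ofReal p) volume →
      FourierVanishesOnSphere (ENNReal.ofReal p) f →
      ∃ g : E n → ℂ, IsFourierTransform f g ∧ AEStronglyMeasurable g volume ∧ ∀ N : ℕ,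
        ∫⁻ ξ, ENNReal.ofReal (dyadicWeight γ N (1 - ‖ξ‖ ^ 2) *
          (Real.exp (-‖ξ‖ ^ 2) * ‖g ξ‖ ^ 2)) ≤ C * eLpNorm f (ENNReal.ofReal p) volume ^ 2 := by
  obtain ⟨C, hC, hmain⟩ := exists_integral_dyadicWeight_le (n := n) hγ hγ2 hp hp'
  lift C to ℝ≥0 using hC
  have hp0 : 0 < p := by linarith
  have hp2 : p ≤ 2 := by
    nlinarith [n.cast_nonneg (α := ℝ)]
  refine ⟨C, fun f hf ⟨φ, hφ, hsphere⟩ ↦ ?_⟩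
  obtain ⟨g, hg, hgm, ns, hns, hae⟩ := exists_subseq_tendsto_fourierInt hp hp2 hf
    (fun k ↦ (φ k).integrable) (fun k ↦ (φ k).memLp _) hφ
  refine ⟨g, hg, hgm, fun N ↦ ?_⟩
  have hnorm := tendsto_toReal_eLpNorm (by simpa using ENNReal.ofReal_le_ofReal hp) hf
    (fun k ↦ (φ k).memLp _) hφ
  have htrace : Tendsto (fun k ↦ sphereMass (φ k) 1) atTop (𝓝 0) := by
    simp only [sphereMass_one (φ _).integrable]
    simp only [sub_zero] at hsphere
    simpa using ((ENNReal.tendsto_toReal ENNReal.zero_ne_top).comp hsphere).pow 2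
  have hlim : Tendsto (fun k ↦ ENNReal.ofReal
      (dyadicMass γ N * (√Real.pi * (Real.exp (-1) * sphereMass (φ k) 1)) +
        C * (∫ x, ‖φ k x‖ ^ p) ^ (2 / p))) atTop
      (𝓝 (C * eLpNorm f (ENNReal.ofReal p) volume ^ 2)) := by
    simp only [fun k ↦ integral_norm_rpow_rpow_two_div hp0 ((φ k).memLp (μ := volume) _)]
    convert ENNReal.tendsto_ofReal ((((htrace.const_mul (Real.exp (-1))).const_mul
      √Real.pi).const_mul (dyadicMass γ N)).add ((hnorm.pow 2).const_mul (C : ℝ))) using 2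
    rw [mul_zero, mul_zero, mul_zero, zero_add, ENNReal.ofReal_mul C.coe_nonneg,
      ENNReal.ofReal_coe_nnreal, ENNReal.ofReal_pow ENNReal.toReal_nonneg,
      ENNReal.ofReal_toReal hf.2.ne]
  refine lintegral_le_of_ae_le_liminf (fun k ↦
    (integrable_dyadicWeight_mul γ N (φ (ns k)).integrable).1.aemeasurable.ennreal_ofReal)
    ?_ (fun k ↦ ?_) (hlim.comp hns.tendsto_atTop)
  · filter_upwards [hae] with ξ hξ
    exact (ENNReal.tendsto_ofReal
      (((hξ.norm.pow 2).const_mul _).const_mul _)).liminf_eq.ge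
  · rw [lintegral_dyadicWeight_mul_eq γ N (φ (ns k)).integrable]
    exact ENNReal.ofReal_le_ofReal
      (hmain N _ (φ (ns k)).integrable ((φ (ns k)).memLp _) ((φ (ns k)).memLp _))

theorem multiplier_sq_le (hβ : 2 * β ≤ γ + 1) {ξ : E n} (hξ : ‖ξ‖ < 1) :
    multiplier (-β) ξ ^ 2 ≤ (1 - ‖ξ‖ ^ 2) ^ (-(γ + 1)) := by
  have hpos : 0 < 1 - ‖ξ‖ ^ 2 := sub_pos.2 (pow_lt_one₀ (norm_nonneg _) hξ two_ne_zero)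
  rw [multiplier, if_pos hξ, ← Real.rpow_mul_natCast hpos.le]
  refine Real.rpow_le_rpow_of_exponent_ge hpos (sub_le_self _ (sq_nonneg _)) ?_
  push_cast
  linarith

theorem eventually_multiplier_sq_le (hγ : -1 ≤ γ) (hβ : 2 * β ≤ γ + 1) (ξ : E n) :
    ∀ᶠ N in atTop, multiplier (-β) ξ ^ 2 ≤ Real.exp 2 * 2 ^ (γ + 1) *
      (dyadicWeight γ N (1 - ‖ξ‖ ^ 2) * Real.exp (-‖ξ‖ ^ 2)) := by
  by_cases hξ : ‖ξ‖ < 1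
  · have hξ2 : ‖ξ‖ ^ 2 < 1 := pow_lt_one₀ (norm_nonneg _) hξ two_ne_zero
    have hscale : Tendsto (fun N : ℕ ↦ ((2 : ℝ) ^ N)⁻¹) atTop (𝓝 0) :=
      tendsto_inv_atTop_zero.comp (tendsto_pow_atTop_atTop_of_one_lt one_lt_two)
    filter_upwards [hscale.eventually_lt_const (sub_pos.2 hξ2)] with N hN
    have hW := dyadicWeight_nonneg γ N (1 - ‖ξ‖ ^ 2)
    have hexp : Real.exp 1 ≤ Real.exp 2 * Real.exp (-‖ξ‖ ^ 2) := by
      rw [← Real.exp_add]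
      gcongr
      linarith
    calc multiplier (-β) ξ ^ 2 ≤ (1 - ‖ξ‖ ^ 2) ^ (-(γ + 1)) := multiplier_sq_le hβ hξ
      _ ≤ Real.exp 1 * 2 ^ (γ + 1) * dyadicWeight γ N (1 - ‖ξ‖ ^ 2) :=
          rpow_neg_le_dyadicWeight hγ (sub_le_self _ (sq_nonneg _)) hN
      _ ≤ Real.exp 2 * Real.exp (-‖ξ‖ ^ 2) * 2 ^ (γ + 1) * dyadicWeight γ N (1 - ‖ξ‖ ^ 2) := by
          gcongr
      _ = _ := by ring
  · refine Eventually.of_forall fun N ↦ ?_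
    rw [multiplier, if_neg hξ, zero_pow two_ne_zero]
    have := dyadicWeight_nonneg γ N (1 - ‖ξ‖ ^ 2)
    positivity

theorem measurable_multiplier (z : ℝ) : Measurable (multiplier z : E n → ℝ) := by
  unfold multiplier
  exact Measurable.ite (measurableSet_lt measurable_norm measurable_const)
    ((measurable_const.sub (measurable_norm.pow_const 2)).pow_const z) measurable_const

theorem lintegral_multiplier_mul_sq_le (hγ : -1 ≤ γ) (hβ : 2 * β ≤ γ + 1) {g : E n → ℂ}
    (hg : AEStronglyMeasurable g volume) {A : ℝ≥0∞}
    (hA : ∀ N : ℕ, ∫⁻ ξ, ENNReal.ofReal (dyadicWeight γ N (1 - ‖ξ‖ ^ 2) *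
      (Real.exp (-‖ξ‖ ^ 2) * ‖g ξ‖ ^ 2)) ≤ A) :
    ∫⁻ ξ, ‖(multiplier (-β) ξ : ℂ) * g ξ‖ₑ ^ (2 : ℝ) ≤
      ENNReal.ofReal (Real.exp 2 * 2 ^ (γ + 1)) * A := by
  have hmeas : ∀ N, AEMeasurable (fun ξ ↦ ENNReal.ofReal (dyadicWeight γ N (1 - ‖ξ‖ ^ 2) *
      (Real.exp (-‖ξ‖ ^ 2) * ‖g ξ‖ ^ 2))) volume := fun N ↦ by
    have := continuous_dyadicWeight γ N
    have := hg.norm.aemeasurable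
    exact ((Continuous.aemeasurable (by fun_prop)).mul
      ((Continuous.aemeasurable (by fun_prop)).mul (this.pow_const 2))).ennreal_ofReal
  refine lintegral_le_of_ae_le_liminf
    (v := fun N ξ ↦ ENNReal.ofReal (Real.exp 2 * 2 ^ (γ + 1)) * ENNReal.ofReal
      (dyadicWeight γ N (1 - ‖ξ‖ ^ 2) * (Real.exp (-‖ξ‖ ^ 2) * ‖g ξ‖ ^ 2)))
    (fun N ↦ (hmeas N).const_mul _)
    (Eventually.of_forall fun ξ ↦ le_liminf_of_le (by isBoundedDefault) ?_) (fun N ↦ ?_)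
    tendsto_const_nhds
  · filter_upwards [eventually_multiplier_sq_le hγ hβ ξ] with N hN
    rw [← ENNReal.ofReal_mul (by positivity), ← ofReal_norm,
      ENNReal.ofReal_rpow_of_nonneg (norm_nonneg _) zero_le_two, Real.rpow_two, norm_mul, mul_pow,
      Complex.norm_real, Real.norm_eq_abs, sq_abs, ← mul_assoc (dyadicWeight _ _ _), ← mul_assoc]
    gcongr
  · rw [lintegral_const_mul' _ _ ENNReal.ofReal_ne_top]
    gcongr
    exact hA N

theorem exists_isBochnerRiesz_of_le [NeZero n] (hβ : β ≤ α) (hα : 1 / 2 < α) (hα' : α < 3 / 2)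
    (hp : 1 ≤ p) (hp' : p * ((n : ℝ) + 1 + 4 * α) ≤ 2 * n + 2) :
    ∃ C : ℝ≥0, ∀ f : E n → ℂ, MemLp f (ENNReal.ofReal p) volume →
      FourierVanishesOnSphere (ENNReal.ofReal p) f →
      ∃ u : E n → ℂ, IsBochnerRiesz (-β) f u ∧ MemLp u 2 volume ∧
        eLpNorm u 2 volume ≤ C * eLpNorm f (ENNReal.ofReal p) volume := by
  obtain ⟨C, hweight⟩ := exists_lintegral_dyadicWeight_le (n := n) (γ := 2 * α - 1)
    (by linarith) (by linarith) hp (by linarith)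
  obtain ⟨D, hinverse⟩ := exists_isFourierTransform_inverse n
  set K : ℝ≥0 := (Real.exp 2 * 2 ^ (2 * α - 1 + 1)).toNNReal * C
  refine ⟨D * NNReal.sqrt K, fun f hf hvanish ↦ ?_⟩
  obtain ⟨g, hg, hgm, hle⟩ := hweight f hf hvanish
  have hnorm : eLpNorm (fun ξ ↦ (multiplier (-β) ξ : ℂ) * g ξ) 2 volume ≤
      NNReal.sqrt K * eLpNorm f (ENNReal.ofReal p) volume := by
    refine eLpNorm_two_le_of_lintegral_sq_le
      ((lintegral_multiplier_mul_sq_le (by linarith) (by linarith) hgm hle).trans_eq ?_)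
    rw [ENNReal.coe_mul, mul_assoc, ENNReal.ofReal]
  obtain ⟨u, hu, hmem, hule⟩ := hinverse (fun ξ ↦ (multiplier (-β) ξ : ℂ) * g ξ)
    ⟨(Complex.measurable_ofReal.comp (measurable_multiplier (-β))).aestronglyMeasurable.mul hgm,
      hnorm.trans_lt (ENNReal.mul_lt_top ENNReal.coe_lt_top hf.2)⟩
  refine ⟨u, ⟨g, hg, hu⟩, hmem, hule.trans ?_⟩
  rw [ENNReal.coe_mul, mul_assoc]
  gcongr

end Extension

end BochnerRiesz

theorem mainTheorem3 (n : ℕ) (hn : 2 ≤ n) (α p : ℝ)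
    (hα : 1 / 2 ≤ α) (hα' : α < 3 / 2)
    (hp : 1 ≤ p) (hp' : p ≤ (2 * (n : ℝ) + 2) / ((n : ℝ) + 1 + 4 * α))
    (hne : (α, p) ≠ (1 / 2, (2 * (n : ℝ) + 2) / ((n : ℝ) + 3))) :
    ∃ C : ℝ≥0, ∀ f : BochnerRiesz.E n → ℂ,
      MemLp f (ENNReal.ofReal p) volume →
      BochnerRiesz.FourierVanishesOnSphere (ENNReal.ofReal p) f →
      ∃ u : BochnerRiesz.E n → ℂ,
        BochnerRiesz.IsBochnerRiesz (-α) f u ∧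
        MemLp u 2 volume ∧
        eLpNorm u 2 volume ≤ C * eLpNorm f (ENNReal.ofReal p) volume := by
  have : NeZero n := ⟨by omega⟩
  rcases hα.lt_or_eq with hlt | rfl
  · exact BochnerRiesz.exists_isBochnerRiesz_of_le le_rfl hlt hα' hp
      ((le_div_iff₀ (by positivity)).1 hp')
  have hp0 : 0 < p := by linarith
  have hp3 : p * ((n : ℝ) + 3) < 2 * n + 2 := by
    rw [show (n : ℝ) + 1 + 4 * (1 / 2) = n + 3 by ring] at hp'
    exact (lt_div_iff₀ (by positivity)).1 (hp'.lt_of_ne fun h ↦ hne (by rw [h]))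
  obtain ⟨a, ha, ha'⟩ : ∃ a : ℝ, 1 / 2 < a ∧ a < min (3 / 2) (((2 * n + 2) / p - (n + 1)) / 4) := by
    refine exists_between (lt_min (by norm_num) ?_)
    linarith [(lt_div_iff₀' hp0).2 hp3]
  obtain ⟨ha₁, ha₂⟩ := lt_min_iff.1 ha'
  exact BochnerRiesz.exists_isBochnerRiesz_of_le ha.le ha ha₁ hp
    ((le_div_iff₀' hp0).1 (by linarith))
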